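/- Let $n\ge 4$ and $s\ge 1$. Use the alphabet $1<2<\cdots<n-1<\{n,\bar n\}<\overline{n-1}<\cdots<\bar 1$ ($n$ and $\bar n$ incomparable, $\bar{\bar i}=i$), and write $\binom{a}{b}$ for a column with top entry $a$ and bottom entry $b$. **The classical crystal.** Let $\mathcal T(s)$ be the set of tableaux of shape $(s,s)$ with weakly increasing rows, with $b\not\le a$ in every column $\binom ab$, and in which no column $\binom{n-1}{n}$ occurs to the left of a column $\binom{n}{\overline{n-1}}$ and no $\binom{n-1}{\bar n}$ to the left of $\binom{\bar n}{\overline{n-1}}$. For $k\ge 0$, let $B(k\varpi_2)$ be the type $D_n$ crystal of Kashiwara–Nakashima tableaux of shape $(k,k)$: those satisfying the same conditions and having no adjacent columns $\binom{a}{*}\binom{a}{\bar a}$ or $\binom{a}{\bar a}\binom{*}{\bar a}$ and no column $\binom{1}{\bar 1}$. Its operators $\tilde e_i,\tilde f_i$ ($1\le i\le n$) act on the column word $b_1a_1\cdots b_ka_k$ by the tensor product rule $\tilde f_i(b_2\otimes b_1)=\tilde f_i(b_2)\otimes b_1$ if $\varepsilon_i(b_2)\ge\varphi_i(b_1)$,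 and $b_2\otimes\tilde f_i(b_1)$ otherwise ($\tilde e_i$ being the partial inverse of $\tilde f_i$). On letters, $\tilde f_i$ is given by $i\mapsto i+1$, $\overline{i+1}\mapsto\bar i$ for $i<n$, and by $n-1\mapsto\bar n$, $n\mapsto\overline{n-1}$ for $i=n$. The height-two drop map $D:\mathcal T(s)\to\bigsqcup_{k=0}^s B(k\varpi_2)$ is the bijection that fixes $B(s\varpi_2)$, sends $\binom{1}{\bar 1}^s$ to the empty tableau, and otherwise removes the $m$ columns $\binom a{\bar a}$ of the unique $a$-configuration of $T$, which is one of $$\tbinom{a}{b}\tbinom{a}{\bar a}^{m}\tbinom{c}{d}\ \bigl(b\ne\bar a,\ \tbinom cd\ne\tbinom a{\bar a}\bigr),\qquad \tbinom{b}{c}\tbinom{a}{\bar a}^{m}\tbinom{d}{\bar a}\ \bigl(d\ne a,\ \tbinom bc\ne\tbinom a{\bar a}\bigr),\qquad \tbinom{b}{c}\tbinom{a}{\bar a}^{m+1}\tbinom{d}{e}\ (b\ne a,\ e\ne\bar a),$$ where $a\in\{1,\dots,n,\bar n\}$, $m\ge1$, the first column of the second and third type and the last column of the first and third type being possibly absent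 (at the border of $T$). Its inverse is the height-two fill map $F$. Put $\tilde e_i=F\tilde e_iD$ and $\tilde f_i=F\tilde f_iD$ on $\mathcal T(s)$ for $1\le i\le n$, and regard $B(k\varpi_2)$ as a subset of $\mathcal T(s)$ through $F$. The dual map $*$ sends $T\in B(k\varpi_2)$ to the tableau whose column word is the reversed column word of $T$ with $i\leftrightarrow\bar i$ applied to every letter (except that $n$ and $\bar n$ are fixed if $n$ is odd); on $\mathcal T(s)$ it is transported by $D$ and $F$. **The operators $\tilde e_0,\tilde f_0$.** The components of $\mathcal T(s)$ under the colours $2,\dots,n$ are $U_q(D_{n-1})$-crystals; let $B(v)$ denote the component with label $v$, and let its shape be its $D_{n-1}$-highest weight. They are the vertices of a graph $\mathcal{BC}$, with an edge from $v$ to $w$ if $\tilde f_1(b)\in B(w)$ for some $b\in B(v)$. Let $\mathcal{BC}(k\varpi_2)$ be its part in $B(k\varpi_2)$. For $v\in\mathcal{BC}(k\varpi_2)$ let $R(v)$ be $s-k$ plus the graph distance from $v$ to the vertex containing the highest weight vector of $B(k\varpi_2)$, and let $\ell$ be minimal such that $\mathcal{BC}(\ell\varpi_2)$ has a vertex with the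 same shape and the same $R$ as $v$. Then $\check\sigma(v)$ is the vertex of $\mathcal{BC}((s+\ell-k)\varpi_2)$ of the same shape as $v$ with $R(\check\sigma(v))=2s-R(v)$. If $b=\tilde f_{i_1}\cdots\tilde f_{i_m}x$ with $i_1,\dots,i_m\in\{2,\dots,n\}$ and $x$ the $U_q(D_{n-1})$-highest weight vector of $B(v)$, put $\sigma(b)=\tilde f_{i_1}\cdots\tilde f_{i_m}y$ with $y$ the $U_q(D_{n-1})$-highest weight vector of $B(\check\sigma(v))$. Set $\tilde f_0=\sigma\tilde f_1\sigma$ and $\tilde e_0=\sigma\tilde e_1\sigma$. The set $\mathcal T(s)$ with $\tilde e_i,\tilde f_i$ for $0\le i\le n$ is the affine crystal $\tilde B^{2,s}$ of type $D_n^{(1)}$. Write $\varnothing$ for the value of an operator that does not act, $\varphi_0(b)=\max\{m\mid\tilde f_0^m(b)\ne\varnothing\}$ and $\varepsilon_0(b)=\max\{m\mid\tilde e_0^m(b)\ne\varnothing\}$. **Statement.** For $0\le k\le s$, the component $B(k\varpi_2)\subset\tilde B^{2,s}$ has a unique (classical) highest weight vector $u_k$ and a unique lowest weight vector, which is $u_k^*$.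 Moreover: 1. $\tilde f_0(u_k)=u_{k+1}$ for $0\le k<s$, and $\tilde f_0(u_s)=\varnothing$; 2. $\tilde e_0(u_k)=u_{k-1}$ for $0<k\le s$; 3. $\varphi_0(u_k)=\varepsilon_0(u_k^*)=s-k$ and $\varphi_0(u_k^*)=\varepsilon_0(u_k)=s+k$ for $0\le k\le s$. -/

import Mathlib

/-!
The affine crystal of type `D_n^{(1)}` on two-row rectangular tableaux.

Letters are nonzero integers of absolute value at most `n`: the integer `i > 0` is the letter `i`
and the integer `-i` is the barred letter.  A tableau with two rows of equal length is the list of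
its columns from left to right; the column `(a, b)` has top entry `a` and bottom entry `b`.
-/

namespace TypeD

/-! ### The vector crystal and words -/

/-- The alphabet `1, …, n, bar n, …, bar 1`. -/
def IsLetter (n : ℕ) (x : ℤ) : Prop := 1 ≤ |x| ∧ |x| ≤ n

/-- Height in `1 < 2 < ⋯ < n - 1 < {n, bar n} < bar (n - 1) < ⋯ < bar 1`. -/
def height (n : ℕ) (x : ℤ) : ℤ := if 0 < x then x else 2 * n + x

/-- The partial order on the alphabet; `n` and `bar n` are incomparable. -/
def le (n : ℕ) (x y : ℤ) : Prop := x = y ∨ height n x < height n y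

/-- The operator `f_i` (`1 ≤ i ≤ n`) on letters: `i → i+1` and `bar (i+1) → bar i` for `i < n`,
and `n-1 → bar n`, `n → bar (n-1)` for `i = n`.  The value `none` is `∅`. -/
def letterF (n i : ℕ) (x : ℤ) : Option ℤ :=
  if i < n then
    if x = i then some (i + 1) else if x = -(i + 1) then some (-i) else none
  else
    if x = n - 1 then some (-n) else if x = n then some (-(n - 1)) else none

/-- The operator `e_i` (`1 ≤ i ≤ n`) on letters, the partial inverse of `f_i`. -/
def letterE (n i : ℕ) (x : ℤ) : Option ℤ :=
  if i < n then
    if x = i + 1 then some i else if x = -i then some (-(i + 1)) else none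
  else
    if x = -n then some (n - 1) else if x = -(n - 1) then some n else none

/-- `φ_i` of a letter (all `i`-strings of letters have length at most one). -/
def letterPhi (n i : ℕ) (x : ℤ) : ℕ := if (letterF n i x).isSome then 1 else 0

/-- `ε_i` of a letter. -/
def letterEps (n i : ℕ) (x : ℤ) : ℕ := if (letterE n i x).isSome then 1 else 0

/-- `φ_i` of the word `x₁ x₂ ⋯ = x₁ ⊗ (x₂ ⊗ ⋯)`:
`φ_i(b₂ ⊗ b₁) = φ_i(b₂) + max(0, φ_i(b₁) - ε_i(b₂))` (the subtraction below truncates). -/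
def wordPhi (n i : ℕ) : List ℤ → ℕ
  | [] => 0
  | x :: w => letterPhi n i x + (wordPhi n i w - letterEps n i x)

/-- `f_i` on words, by the tensor product rule
`f_i(b₂ ⊗ b₁) = f_i(b₂) ⊗ b₁` if `ε_i(b₂) ≥ φ_i(b₁)`, and `b₂ ⊗ f_i(b₁)` otherwise. -/
def wordF (n i : ℕ) : List ℤ → Option (List ℤ)
  | [] => none
  | x :: w =>
    if wordPhi n i w ≤ letterEps n i x then (letterF n i x).map (fun y => y :: w)
    else (wordF n i w).map (fun v => x :: v)

/-- `e_i` on words, by the tensor product rule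
`e_i(b₂ ⊗ b₁) = e_i(b₂) ⊗ b₁` if `ε_i(b₂) > φ_i(b₁)`, and `b₂ ⊗ e_i(b₁)` otherwise. -/
def wordE (n i : ℕ) : List ℤ → Option (List ℤ)
  | [] => none
  | x :: w =>
    if wordPhi n i w < letterEps n i x then (letterE n i x).map (fun y => y :: w)
    else (wordE n i w).map (fun v => x :: v)

/-! ### Tableaux and the classical crystals `B(k ϖ₂)` -/

/-- The column word `b₁ a₁ b₂ a₂ ⋯`. -/
def columnWord : List (ℤ × ℤ) → List ℤ
  | [] => []
  | c :: t => c.2 :: c.1 :: columnWord t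

/-- The two-row array with a given column word. -/
def ofColumnWord : List ℤ → List (ℤ × ℤ)
  | b :: a :: w => (a, b) :: ofColumnWord w
  | _ => []

/-- `f_i` on two-row tableaux, through the column word. -/
def tabF (n i : ℕ) (t : List (ℤ × ℤ)) : Option (List (ℤ × ℤ)) :=
  (wordF n i (columnWord t)).map ofColumnWord

/-- `e_i` on two-row tableaux, through the column word. -/
def tabE (n i : ℕ) (t : List (ℤ × ℤ)) : Option (List (ℤ × ℤ)) :=
  (wordE n i (columnWord t)).map ofColumnWord

/-- The conditions defining the tableaux of `𝒯(s)`, apart from the number of columns. -/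
structure IsTableau (n : ℕ) (t : List (ℤ × ℤ)) : Prop where
  letters : ∀ c ∈ t, IsLetter n c.1 ∧ IsLetter n c.2
  /-- rows weakly increase -/
  rows : t.IsChain (fun c d => le n c.1 d.1 ∧ le n c.2 d.2)
  /-- in a column with top `a` and bottom `b`, not `b ≤ a` -/
  columns : ∀ c ∈ t, ¬ le n c.2 c.1
  /-- no column `(n-1, n)` followed, at any distance, by `(n, bar (n-1))`, and no column
  `(n-1, bar n)` followed by `(bar n, bar (n-1))` -/
  middle : t.Pairwise (fun c d =>
    ¬ (c = ((n : ℤ) - 1, (n : ℤ)) ∧ d = ((n : ℤ), -((n : ℤ) - 1))) ∧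
    ¬ (c = ((n : ℤ) - 1, -(n : ℤ)) ∧ d = (-(n : ℤ), -((n : ℤ) - 1))))

/-- The Kashiwara–Nakashima tableaux of shape `(k, k)`, `k = t.length`: these are the elements of
the classical crystal `B(k ϖ₂)` of type `D_n`. -/
structure IsKN (n : ℕ) (t : List (ℤ × ℤ)) : Prop extends IsTableau n t where
  /-- no adjacent columns `(a, *) (a, bar a)` or `(a, bar a) (*, bar a)` -/
  noConfig : t.IsChain (fun c d => d ≠ (c.1, -c.1) ∧ ¬ (c.2 = -c.1 ∧ d.2 = -c.1))
  /-- no column `(1, bar 1)` -/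
  noOne : ((1 : ℤ), (-1 : ℤ)) ∉ t

/-- The set `𝒯(s)` of tableaux of shape `(s, s)`. -/
def Tab (n s : ℕ) : Type := {t : List (ℤ × ℤ) // t.length = s ∧ IsTableau n t}

/-! ### The height-two drop and fill maps -/

/-- `t` is obtained from `T` by removing `m` columns `(a, bar a)` of an `a`-configuration of `T`
(`a ∈ {1, …, n, bar n}`, `m > 0`).  The neighbouring columns in a configuration are absent
when the configuration lies at the border of `T`. -/
def RemovesConfig (n : ℕ) (T t : List (ℤ × ℤ)) : Prop :=
  ∃ (a : ℤ) (m : ℕ) (L R : List (ℤ × ℤ)),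
    ((1 ≤ a ∧ a ≤ n) ∨ a = -n) ∧ 0 < m ∧
    T = L ++ List.replicate m (a, -a) ++ R ∧ t = L ++ R ∧
    ( -- `(a, b) (a, bar a)^m c` with `b ≠ bar a` and `c ≠ (a, bar a)`
      ((∃ b, L.getLast? = some (a, b) ∧ b ≠ -a) ∧ R.head? ≠ some (a, -a)) ∨
      -- `c (a, bar a)^m (d, bar a)` with `d ≠ a` and `c ≠ (a, bar a)`
      (L.getLast? ≠ some (a, -a) ∧ ∃ d, R.head? = some (d, -a) ∧ d ≠ a) ∨
      -- `(b, c) (a, bar a)^(m+1) (d, e)` with `b ≠ a` and `e ≠ bar a`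
      (∃ R₁, R = (a, -a) :: R₁ ∧ (∀ c, L.getLast? = some c → c.1 ≠ a) ∧
        (∀ c, R₁.head? = some c → c.2 ≠ -a)))

open Classical in
/-- The height-two drop map `𝒯(s) → ⨁_{k ≤ s} B(k ϖ₂)`.  Every `T` that is neither in
`B(s ϖ₂)` nor equal to `(1, bar 1)^s` has exactly one `a`-configuration, so that the choice below
is forced and the last branch is not reached. -/
noncomputable def drop {n s : ℕ} (T : Tab n s) : List (ℤ × ℤ) :=
  if IsKN n T.1 then T.1
  else if T.1 = List.replicate s (1, -1) then []
  else if h : ∃ t, RemovesConfig n T.1 t then h.choose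
  else T.1

/-- The criterion `b ≤ bar a ≤ b'` for adjacent columns `(a, b) (a', b')`. -/
def FillsLeft (n : ℕ) (c d : ℤ × ℤ) : Prop := le n c.2 (-c.1) ∧ le n (-c.1) d.2

/-- The criterion `a ≤ bar b' ≤ a'` for adjacent columns `(a, b) (a', b')`. -/
def FillsRight (n : ℕ) (c d : ℤ × ℤ) : Prop := le n c.1 (-d.2) ∧ le n (-d.2) d.1

/-- `T` is obtained from `t ∈ B(k ϖ₂)` by the height-two filling with `s - k` columns:
nothing is done if `k = s`; the empty tableau is filled by `(1, bar 1)^s`; otherwise one inserts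
`(a, bar a)^(s-k)` or `(bar b', b')^(s-k)` between two adjacent columns `(a, b) (a', b')` that
satisfy the respective criterion; if there are no such columns, one appends
`(a, bar a)^(s-k)` after the last column `(a, b)` or prepends `(bar b', b')^(s-k)` before the
first column `(a', b')`, so that the result is in `𝒯(s)` but not in `B(s ϖ₂)`. -/
def IsFilling (n s : ℕ) (t T : List (ℤ × ℤ)) : Prop :=
  (t.length = s ∧ T = t) ∨
  (t.length < s ∧ t = [] ∧ T = List.replicate s (1, -1)) ∨
  (t.length < s ∧ ∃ L c d R, t = L ++ c :: d :: R ∧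
    ((FillsLeft n c d ∧
        T = L ++ c :: (List.replicate (s - t.length) (c.1, -c.1) ++ d :: R)) ∨
     (FillsRight n c d ∧
        T = L ++ c :: (List.replicate (s - t.length) (-d.2, d.2) ++ d :: R)))) ∨
  (t.length < s ∧ (∀ L c d R, t = L ++ c :: d :: R → ¬ FillsLeft n c d ∧ ¬ FillsRight n c d) ∧
    IsTableau n T ∧ ¬ IsKN n T ∧
    ((∃ c, t.getLast? = some c ∧ T = t ++ List.replicate (s - t.length) (c.1, -c.1)) ∨
     (∃ d, t.head? = some d ∧ T = List.replicate (s - t.length) (-d.2, d.2) ++ t)))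

open Classical in
/-- The height-two fill map `⨁_{k ≤ s} B(k ϖ₂) → 𝒯(s)`, inverse to `drop`.  On the tableaux of
`B(k ϖ₂)`, `k ≤ s`, the filling exists and is unique; the value `none` only occurs for arrays
that are not of this kind. -/
noncomputable def fill (n s : ℕ) (t : List (ℤ × ℤ)) : Option (Tab n s) :=
  if h : ∃ T : Tab n s, IsFilling n s t T.1 then some h.choose else none

/-! ### The classical crystal structure on `𝒯(s)` -/

/-- `f_i = fill ∘ f_i ∘ drop`, for `1 ≤ i ≤ n`. -/
noncomputable def classicalF {n s : ℕ} (i : ℕ) (T : Tab n s) : Option (Tab n s) :=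
  (tabF n i (drop T)).bind (fill n s)

/-- `e_i = fill ∘ e_i ∘ drop`, for `1 ≤ i ≤ n`. -/
noncomputable def classicalE {n s : ℕ} (i : ℕ) (T : Tab n s) : Option (Tab n s) :=
  (tabE n i (drop T)).bind (fill n s)

/-- `T` lies in the classical component `B(k ϖ₂) ⊂ 𝒯(s)`. -/
def InB {n s : ℕ} (k : ℕ) (T : Tab n s) : Prop := (drop T).length = k

/-- `T` is a highest weight vector of the classical component `B(k ϖ₂) ⊂ 𝒯(s)`. -/
def IsHighest {n s : ℕ} (k : ℕ) (T : Tab n s) : Prop :=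
  InB k T ∧ ∀ i, 1 ≤ i → i ≤ n → classicalE i T = none

/-- `T` is a lowest weight vector of the classical component `B(k ϖ₂) ⊂ 𝒯(s)`. -/
def IsLowest {n s : ℕ} (k : ℕ) (T : Tab n s) : Prop :=
  InB k T ∧ ∀ i, 1 ≤ i → i ≤ n → classicalF i T = none

/-- The dual map on letters: `i ↔ bar i`, except that `n` and `bar n` are fixed if `n` is odd. -/
def letterDual (n : ℕ) (x : ℤ) : ℤ := if |x| = n ∧ Odd n then x else -x

/-- The dual map `*` on the classical components: apply the dual map to the letters of the reversed
column word.  For a tableau of rectangular shape the result is already a column word of the same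
shape, so that no rectification is needed. -/
noncomputable def dual {n s : ℕ} (T : Tab n s) : Option (Tab n s) :=
  fill n s (ofColumnWord ((columnWord (drop T)).reverse.map (letterDual n)))

/-! ### The branching component graph -/

/-- The coefficient of `ε_j` in the weight of `T`. -/
def weight {n s : ℕ} (T : Tab n s) (j : ℕ) : ℤ :=
  ((columnWord T.1).count (j : ℤ) : ℤ) - ((columnWord T.1).count (-(j : ℤ)) : ℤ)

/-- The graph on `𝒯(s)` formed by the edges of colours `2, …, n`, without orientation. -/
def branchingGraph (n s : ℕ) : SimpleGraph (Tab n s) :=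
  SimpleGraph.fromRel (fun b c => ∃ i, 2 ≤ i ∧ i ≤ n ∧ classicalF i b = some c)

/-- The vertices of the branching component graph: the connected `U_q(D_{n-1})`-crystals. -/
abbrev BCVertex (n s : ℕ) : Type := (branchingGraph n s).ConnectedComponent

/-- The branching component vertex containing `b`. -/
def vertexOf {n s : ℕ} (b : Tab n s) : BCVertex n s :=
  (branchingGraph n s).connectedComponentMk b

/-- The branching component graph, without orientation: there is an edge from `v` to `w` if
`f_1(b) ∈ B(w)` for some `b ∈ B(v)`. -/
def bcGraph (n s : ℕ) : SimpleGraph (BCVertex n s) :=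
  SimpleGraph.fromRel (fun v w =>
    ∃ b c : Tab n s, vertexOf b = v ∧ classicalF 1 b = some c ∧ vertexOf c = w)

/-- `v` lies in `BC(k ϖ₂)`. -/
def InBC {n s : ℕ} (k : ℕ) (v : BCVertex n s) : Prop := ∃ b : Tab n s, vertexOf b = v ∧ InB k b

/-- `R(v) = p`, where `R(v) = r_k(v) + s - k` for `v` in `BC(k ϖ₂)` and `r_k(v)` is the graph
distance to the vertex that contains the highest weight vector of `B(k ϖ₂)`. -/
def HasRank {n s : ℕ} (v : BCVertex n s) (p : ℕ) : Prop :=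
  ∃ (k : ℕ) (u : Tab n s), k ≤ s ∧ InBC k v ∧ IsHighest k u ∧
    p = (bcGraph n s).dist v (vertexOf u) + (s - k)

/-- `b` is a highest weight vector for `U_q(D_{n-1})` (colours `2, …, n`). -/
def IsBranchHighest {n s : ℕ} (b : Tab n s) : Prop :=
  ∀ i, 2 ≤ i → i ≤ n → classicalE i b = none

/-- `v` and `w` have the same shape: the partitions that label them are the highest weights of the
corresponding `U_q(D_{n-1})`-crystals. -/
def SameShape {n s : ℕ} (v w : BCVertex n s) : Prop :=
  ∃ x y : Tab n s, vertexOf x = v ∧ vertexOf y = w ∧ IsBranchHighest x ∧ IsBranchHighest y ∧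
    ∀ j, 2 ≤ j → j ≤ n → weight x j = weight y j

/-- `w` is the image of `v` under the shape-preserving involution of the branching component graph:
if `v` lies in `BC(k ϖ₂)` and has rank `p`, and `ℓ` is minimal such that the image of `v` under
the rank- and shape-preserving inclusions `BC(0) ⊂ BC(ϖ₂) ⊂ ⋯ ⊂ BC(s ϖ₂)` lies in
`BC(ℓ ϖ₂)`, then `w` is the vertex of the same shape and of rank `2s - p` in
`BC((s + ℓ - k) ϖ₂)`. -/
def IsSigmaCheck {n s : ℕ} (v w : BCVertex n s) : Prop :=
  ∃ k l p k' p' : ℕ, InBC k v ∧ HasRank v p ∧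
    IsLeast {j : ℕ | ∃ x : BCVertex n s, InBC j x ∧ HasRank x p ∧ SameShape v x} l ∧
    k' + k = s + l ∧ p' + p = 2 * s ∧
    InBC k' w ∧ HasRank w p' ∧ SameShape v w

/-! ### The affine crystal structure -/

/-- `f_{i₁} f_{i₂} ⋯ f_{iₘ}` applied to `b`. -/
noncomputable def applyF {n s : ℕ} : List ℕ → Tab n s → Option (Tab n s)
  | [], b => some b
  | i :: I, b => (applyF I b).bind (classicalF i)

/-- `c = σ(b)`: the branching component of `c` is the image of that of `b`, and
`b = f_{i₁} ⋯ f_{iₘ} x`, `c = f_{i₁} ⋯ f_{iₘ} y` for colours in `{2, …, n}` and for the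
`U_q(D_{n-1})`-highest weight vectors `x`, `y` of the two components. -/
def IsSigma {n s : ℕ} (b c : Tab n s) : Prop :=
  IsSigmaCheck (vertexOf b) (vertexOf c) ∧
  ∃ (x y : Tab n s) (I : List ℕ), IsBranchHighest x ∧ IsBranchHighest y ∧
    (∀ i ∈ I, 2 ≤ i ∧ i ≤ n) ∧ applyF I x = some b ∧ applyF I y = some c

open Classical in
/-- The involution `σ`; the relation `IsSigma` determines the image of every vertex uniquely, and
the last branch is not reached. -/
noncomputable def sigma {n s : ℕ} (b : Tab n s) : Tab n s :=
  if h : ∃ c, IsSigma b c then h.choose else b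

/-- `f_i` on the affine crystal, `0 ≤ i ≤ n`, with `f_0 = σ f_1 σ`. -/
noncomputable def crystalF {n s : ℕ} (i : ℕ) (b : Tab n s) : Option (Tab n s) :=
  if i = 0 then (classicalF 1 (sigma b)).map sigma else classicalF i b

/-- `e_i` on the affine crystal, `0 ≤ i ≤ n`, with `e_0 = σ e_1 σ`. -/
noncomputable def crystalE {n s : ℕ} (i : ℕ) (b : Tab n s) : Option (Tab n s) :=
  if i = 0 then (classicalE 1 (sigma b)).map sigma else classicalE i b

/-- The `m`-th power of a partial operator, applied to `b`. -/
def iter {V : Type} (g : V → Option V) : ℕ → V → Option V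
  | 0, b => some b
  | m + 1, b => (iter g m b).bind g

/-- `φ_i(b) = N`, where `φ_i(b) = max {m | f_i^m(b) ≠ ∅}`. -/
def HasPhi {n s : ℕ} (i : ℕ) (b : Tab n s) (N : ℕ) : Prop :=
  IsGreatest {m : ℕ | iter (crystalF i) m b ≠ none} N

/-- `ε_i(b) = N`, where `ε_i(b) = max {m | e_i^m(b) ≠ ∅}`. -/
def HasEps {n s : ℕ} (i : ℕ) (b : Tab n s) (N : ℕ) : Prop :=
  IsGreatest {m : ℕ | iter (crystalE i) m b ≠ none} N

end TypeD

/-!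
The idea of the proof is that the vectors `u_k = (1, 2)^k` and `u_k^* = (bar 2, bar 1)^k` form one
`0`-string
`u_s^* → ⋯ → u_1^* → u_0 = u_0^* → u_1 → ⋯ → u_s`,
which the involution `σ` carries to the `1`-string of length `2s` through `(1, bar 2)^s`, whose
members are `(1, bar 2)^q (2, bar 2)^r (2, bar 1)^t` with `q + r + t = s` and `r ≤ 1`
(`sigma_zeroString`). Along the latter, `f_1` changes one letter at a time, and its ends are seen
from the letters that occur (`classicalF_one_oneString`). All string lengths can then be read off.

To evaluate `σ`, three facts are needed.

* The drop map is a bijection onto the Kashiwara–Nakashima tableaux with at most `s` columns, whose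
  inverse is the fill map (`fill_eq_some_iff`), and these tableaux are stable under the crystal
  operators (`IsKN.tabF`, `IsKN.tabE`). The columns `(a, bar a)` of a tableau form one block; the
  drop map shortens this block to the length, zero or one, that is allowed between its neighbours.
  So the classical operators on `𝒯(s)` are those on dropped tableaux, and `u_k` and `u_k^*` are the
  only highest and lowest weight vectors of `B(k ϖ₂)` (`isHighest_iff`, `isLowest_iff`).
* The rank `R(v)` of a branching component is `s` minus the coefficient of `ε₁` in its weight
  (`hasRank_iff`): every path to the highest weight vector raises this coefficient by at most one
  with each edge, and raising operators provide a path along which it rises by one with each edge.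
* The branching components met by the two strings have one-row shapes `(k)`. Such a component is a
  copy of the crystal of row words `2^k, …, (bar 2)^k`: the remaining letters of the tableaux are
  `±1` or lie in an array `(1, bar 2)^q (2, bar 2)^r (2, bar 1)^q` on which the colours `2, …, n`
  act trivially (`IsModel`). In `B(m ϖ₂)` there is at most one component of shape `(k)` with given
  coefficient of `ε₁` (`IsKN.eq_of_branchHighest`), and it needs at least `k` columns, since a
  column contains the letter `2` at most once. This determines `σ` on the components of the two
  strings (`IsModel.sigma_eq`). The vectors `u_k` are branching highest weight vectors, and the
  vectors `u_k^*` are reached from the row word `2^k` by lowering it to `(bar 2)^k`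
  (`exists_applyWordF_replicate`).
-/

namespace TypeD

/-! ### Words -/

section Letters

variable {n i : ℕ}

theorem letterF_eq_some_iff (hi : 1 ≤ i) (hin : i ≤ n) {x y : ℤ} :
    letterF n i x = some y ↔
      (i < n ∧ ((x = i ∧ y = i + 1) ∨ (x = -(i + 1) ∧ y = -i))) ∨
      (i = n ∧ ((x = n - 1 ∧ y = -n) ∨ (x = n ∧ y = -(n - 1)))) := by
  unfold letterF
  split_ifs <;> simp only [Option.some.injEq, false_iff] <;> omega

theorem letterE_eq_some_iff (hi : 1 ≤ i) (hin : i ≤ n) {x y : ℤ} :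
    letterE n i x = some y ↔
      (i < n ∧ ((y = i ∧ x = i + 1) ∨ (y = -(i + 1) ∧ x = -i))) ∨
      (i = n ∧ ((y = n - 1 ∧ x = -n) ∨ (y = n ∧ x = -(n - 1)))) := by
  unfold letterE
  split_ifs <;> simp only [Option.some.injEq, false_iff] <;> omega

theorem letterE_eq_some_iff_letterF (hi : 1 ≤ i) (hin : i ≤ n) {x y : ℤ} :
    letterE n i y = some x ↔ letterF n i x = some y := by
  rw [letterE_eq_some_iff hi hin, letterF_eq_some_iff hi hin]

theorem letterF_neg (hi : 1 ≤ i) (hin : i ≤ n) {x y : ℤ} :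
    letterF n i (-y) = some (-x) ↔ letterF n i x = some y := by
  rw [letterF_eq_some_iff hi hin, letterF_eq_some_iff hi hin]
  omega

theorem letterPhi_eq_one_iff {x : ℤ} : letterPhi n i x = 1 ↔ ∃ y, letterF n i x = some y := by
  simp [letterPhi, Option.isSome_iff_exists]

theorem letterEps_eq_one_iff {x : ℤ} : letterEps n i x = 1 ↔ ∃ y, letterE n i x = some y := by
  simp [letterEps, Option.isSome_iff_exists]

theorem letterPhi_eq_zero_iff {x : ℤ} : letterPhi n i x = 0 ↔ letterF n i x = none := by
  simp [letterPhi]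

theorem letterEps_eq_zero_iff {x : ℤ} : letterEps n i x = 0 ↔ letterE n i x = none := by
  simp [letterEps]

theorem letterPhi_le_one (x : ℤ) : letterPhi n i x ≤ 1 := by
  unfold letterPhi; split_ifs <;> omega

theorem letterEps_le_one (x : ℤ) : letterEps n i x ≤ 1 := by
  unfold letterEps; split_ifs <;> omega

theorem letterPhi_eq_one_iff' (hin : i ≤ n) {x : ℤ} : letterPhi n i x = 1 ↔
    (i < n ∧ (x = i ∨ x = -(i + 1))) ∨ (i = n ∧ (x = n - 1 ∨ x = n)) := by
  unfold letterPhi letterF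
  split_ifs <;> simp_all <;> omega

theorem letterEps_eq_one_iff' (hin : i ≤ n) {x : ℤ} : letterEps n i x = 1 ↔
    (i < n ∧ (x = i + 1 ∨ x = -i)) ∨ (i = n ∧ (x = -n ∨ x = -(n - 1))) := by
  unfold letterEps letterE
  split_ifs <;> simp_all <;> omega

theorem letterPhi_neg (hi : 1 ≤ i) (hin : i ≤ n) (x : ℤ) :
    letterPhi n i (-x) = letterEps n i x := by
  have h1 := letterPhi_le_one (n := n) (i := i) (-x)
  have h2 := letterEps_le_one (n := n) (i := i) x
  have h3 := letterPhi_eq_one_iff' hin (x := -x)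
  have h4 := letterEps_eq_one_iff' hin (x := x)
  have : letterPhi n i (-x) = 1 ↔ letterEps n i x = 1 := by rw [h3, h4]; omega
  omega

theorem letterEps_neg (hi : 1 ≤ i) (hin : i ≤ n) (x : ℤ) :
    letterEps n i (-x) = letterPhi n i x := by
  rw [← letterPhi_neg hi hin, neg_neg]

/-- The effect of one arrow `x → y` of the vector crystal on the string lengths. -/
theorem string_of_letterF (hn : 2 ≤ n) (hi : 1 ≤ i) (hin : i ≤ n) {x y : ℤ}
    (h : letterF n i x = some y) :
    letterPhi n i x = 1 ∧ letterEps n i x = 0 ∧ letterPhi n i y = 0 ∧ letterEps n i y = 1 := by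
  have a1 := letterPhi_eq_one_iff.2 ⟨y, h⟩
  have a2 := letterEps_eq_one_iff.2 ⟨x, (letterE_eq_some_iff_letterF hi hin).2 h⟩
  have h1 := letterPhi_le_one (n := n) (i := i) y
  have h2 := letterEps_le_one (n := n) (i := i) x
  have h3 := letterPhi_eq_one_iff' hin (x := y)
  have h4 := letterEps_eq_one_iff' hin (x := x)
  rw [letterF_eq_some_iff hi hin] at h
  refine ⟨a1, ?_, ?_, a2⟩
  · have : ¬ letterEps n i x = 1 := by rw [h4]; omega
    omega
  · have : ¬ letterPhi n i y = 1 := by rw [h3]; omega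
    omega

end Letters

section Words

variable {n i : ℕ}

/-- `ε_i` of a word, by the tensor product rule
`ε_i(b₂ ⊗ b₁) = ε_i(b₁) + max(0, ε_i(b₂) - φ_i(b₁))`. -/
def wordEps (n i : ℕ) : List ℤ → ℕ
  | [] => 0
  | x :: w => wordEps n i w + (letterEps n i x - wordPhi n i w)

theorem wordPhi_append_wordEps_append (p r : List ℤ) :
    wordPhi n i (p ++ r) = wordPhi n i p + (wordPhi n i r - wordEps n i p) ∧
    wordEps n i (p ++ r) = wordEps n i r + (wordEps n i p - wordPhi n i r) := by
  induction p with
  | nil => simp [wordPhi, wordEps]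
  | cons x p ih => simp only [List.cons_append, wordPhi, wordEps, ih.1, ih.2]; omega

theorem wordPhi_append (p r : List ℤ) :
    wordPhi n i (p ++ r) = wordPhi n i p + (wordPhi n i r - wordEps n i p) :=
  (wordPhi_append_wordEps_append p r).1

theorem wordEps_append (p r : List ℤ) :
    wordEps n i (p ++ r) = wordEps n i r + (wordEps n i p - wordPhi n i r) :=
  (wordPhi_append_wordEps_append p r).2

theorem wordF_eq_none_iff {w : List ℤ} :
    wordF n i w = none ↔ wordPhi n i w = 0 := by
  induction w with
  | nil => simp [wordF, wordPhi]
  | cons x w ih =>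
    simp only [wordF, wordPhi]
    split_ifs with h
    · rw [Option.map_eq_none_iff, ← letterPhi_eq_zero_iff]; omega
    · rw [Option.map_eq_none_iff, ih]; omega

theorem wordE_cons_eq_none_iff {x : ℤ} {w : List ℤ} :
    wordE n i (x :: w) = none ↔ wordE n i w = none ∧ letterEps n i x ≤ wordPhi n i w := by
  simp only [wordE]
  have h1 := letterEps_le_one (n := n) (i := i) x
  have h2 := letterEps_eq_zero_iff (n := n) (i := i) (x := x)
  split_ifs with h
  · rw [Option.map_eq_none_iff, ← h2]; omega
  · rw [Option.map_eq_none_iff]; simp; omega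

/-- The signature rule: `f_i` changes one letter, which is preceded by a word with `ε_i = 0` and
followed by a word with `φ_i = 0`. -/
theorem wordF_eq_some_iff (hn : 2 ≤ n) (hi : 1 ≤ i) (hin : i ≤ n) {w w' : List ℤ} :
    wordF n i w = some w' ↔ ∃ p x y q, w = p ++ x :: q ∧ w' = p ++ y :: q ∧
      letterF n i x = some y ∧ wordEps n i p = 0 ∧ wordPhi n i q = 0 := by
  constructor
  · induction w generalizing w' with
    | nil => simp [wordF]
    | cons z w ih =>
      simp only [wordF]
      split_ifs with h
      · rw [Option.map_eq_some_iff]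
        rintro ⟨y, hy, rfl⟩
        have := string_of_letterF hn hi hin hy
        exact ⟨[], z, y, w, rfl, rfl, hy, rfl, by omega⟩
      · rw [Option.map_eq_some_iff]
        rintro ⟨v, hv, rfl⟩
        obtain ⟨p, x, y, q, rfl, rfl, hxy, hp, hq⟩ := ih hv
        refine ⟨z :: p, x, y, q, rfl, rfl, hxy, ?_, hq⟩
        have := string_of_letterF hn hi hin hxy
        rw [wordPhi_append] at h
        simp only [wordPhi, wordEps] at h ⊢
        omega
  · rintro ⟨p, x, y, q, rfl, rfl, hxy, hp, hq⟩
    have hs := string_of_letterF hn hi hin hxy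
    induction p with
    | nil => simp [wordF, hq, hxy]
    | cons z p ih =>
      simp only [wordEps, Nat.add_eq_zero_iff] at hp
      have : ¬ wordPhi n i (p ++ x :: q) ≤ letterEps n i z := by
        rw [wordPhi_append]; simp only [wordPhi]; omega
      simp [wordF, this, ih hp.1]

theorem wordE_eq_some_iff_wordF (hn : 2 ≤ n) (hi : 1 ≤ i) (hin : i ≤ n) {w w' : List ℤ} :
    wordE n i w' = some w ↔ wordF n i w = some w' := by
  constructor
  · rw [wordF_eq_some_iff hn hi hin]
    induction w' generalizing w with
    | nil => simp [wordE]
    | cons z v ih =>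
      simp only [wordE]
      split_ifs with h
      · rw [Option.map_eq_some_iff]
        rintro ⟨y, hy, rfl⟩
        have := letterEps_le_one (n := n) (i := i) z
        exact ⟨[], y, z, v, rfl, rfl, (letterE_eq_some_iff_letterF hi hin).1 hy, rfl, by omega⟩
      · rw [Option.map_eq_some_iff]
        rintro ⟨w, hv, rfl⟩
        obtain ⟨p, x, y, q, rfl, rfl, hxy, hp, hq⟩ := ih hv
        refine ⟨z :: p, x, y, q, rfl, rfl, hxy, ?_, hq⟩
        have := string_of_letterF hn hi hin hxy
        rw [wordPhi_append] at h
        simp only [wordPhi, wordEps] at h ⊢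
        omega
  · rw [wordF_eq_some_iff hn hi hin]
    rintro ⟨p, x, y, q, rfl, rfl, hxy, hp, hq⟩
    have hs := string_of_letterF hn hi hin hxy
    induction p with
    | nil => simp [wordE, hq, hs, (letterE_eq_some_iff_letterF hi hin).2 hxy]
    | cons z p ih =>
      simp only [wordEps, Nat.add_eq_zero_iff] at hp
      have : ¬ wordPhi n i (p ++ y :: q) < letterEps n i z := by
        rw [wordPhi_append]; simp only [wordPhi]; omega
      simp [wordE, this, ih hp.1]

/-- The word of the dual crystal element: reverse the word and bar all letters. -/
def barWord (w : List ℤ) : List ℤ := (w.map (fun x => -x)).reverse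

theorem barWord_append (p q : List ℤ) : barWord (p ++ q) = barWord q ++ barWord p := by
  simp [barWord]

theorem barWord_cons (x : ℤ) (q : List ℤ) : barWord (x :: q) = barWord q ++ [-x] := by
  simp [barWord]

theorem barWord_barWord (w : List ℤ) : barWord (barWord w) = w := by
  simp [barWord]

theorem wordPhi_wordEps_barWord (hi : 1 ≤ i) (hin : i ≤ n) (w : List ℤ) :
    wordPhi n i (barWord w) = wordEps n i w ∧ wordEps n i (barWord w) = wordPhi n i w := by
  induction w with
  | nil => simp [barWord, wordPhi, wordEps]
  | cons x w ih =>
    rw [barWord_cons, wordPhi_append, wordEps_append, ih.1, ih.2]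
    simp only [wordPhi, wordEps, letterPhi_neg hi hin, letterEps_neg hi hin]
    omega

/-- Duality reverses the arrows of the crystal. -/
theorem wordF_barWord (hn : 2 ≤ n) (hi : 1 ≤ i) (hin : i ≤ n) {w w' : List ℤ}
    (h : wordF n i w = some w') : wordF n i (barWord w') = some (barWord w) := by
  rw [wordF_eq_some_iff hn hi hin] at h ⊢
  obtain ⟨p, x, y, q, rfl, rfl, hxy, hp, hq⟩ := h
  refine ⟨barWord q, -y, -x, barWord p, ?_, ?_, (letterF_neg hi hin).2 hxy, ?_, ?_⟩
  · simp [barWord_append, barWord_cons]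
  · simp [barWord_append, barWord_cons]
  · rw [(wordPhi_wordEps_barWord hi hin q).2, hq]
  · rw [(wordPhi_wordEps_barWord hi hin p).1, hp]

end Words

/-! ### Column words -/

section Columns

variable {n i : ℕ}

theorem ofColumnWord_columnWord (t : List (ℤ × ℤ)) : ofColumnWord (columnWord t) = t := by
  induction t with
  | nil => rfl
  | cons c t ih => simp [columnWord, ofColumnWord, ih]

theorem columnWord_injective : Function.Injective columnWord :=
  Function.LeftInverse.injective ofColumnWord_columnWord

theorem columnWord_append (t t' : List (ℤ × ℤ)) :
    columnWord (t ++ t') = columnWord t ++ columnWord t' := by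
  induction t with
  | nil => rfl
  | cons c t ih => simp [columnWord, ih]

/-- A letter of a column word is the bottom or the top entry of a column. -/
theorem columnWord_eq_append_cons {t : List (ℤ × ℤ)} {p q : List ℤ} {x : ℤ}
    (h : columnWord t = p ++ x :: q) : ∃ L a b R, t = L ++ (a, b) :: R ∧
      ((x = b ∧ p = columnWord L ∧ q = a :: columnWord R) ∨
       (x = a ∧ p = columnWord L ++ [b] ∧ q = columnWord R)) := by
  induction t generalizing p with
  | nil => simp [columnWord] at h
  | cons c t ih =>
    obtain ⟨a, b⟩ := c
    simp only [columnWord] at h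
    match p, h with
    | [], h =>
      simp only [List.nil_append, List.cons.injEq] at h
      exact ⟨[], a, b, t, rfl, Or.inl ⟨h.1.symm, rfl, h.2.symm⟩⟩
    | [z], h =>
      simp only [List.cons_append, List.nil_append, List.cons.injEq] at h
      exact ⟨[], a, b, t, rfl, Or.inr ⟨h.2.1.symm, by simp [columnWord, h.1], h.2.2.symm⟩⟩
    | z :: z' :: p, h =>
      simp only [List.cons_append, List.cons.injEq] at h
      obtain ⟨L, a', b', R, rfl, hx⟩ := ih h.2.2
      refine ⟨(a, b) :: L, a', b', R, rfl, ?_⟩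
      simp only [columnWord, ← h.1, ← h.2.1]
      simpa using hx

theorem exists_columnWord_of_wordF (hn : 2 ≤ n) (hi : 1 ≤ i) (hin : i ≤ n) {t : List (ℤ × ℤ)}
    {w : List ℤ} : wordF n i (columnWord t) = some w → ∃ L a b a' b' R, t = L ++ (a, b) :: R ∧
      w = columnWord (L ++ (a', b') :: R) ∧
      ((a' = a ∧ letterF n i b = some b' ∧
          wordEps n i (columnWord L) = 0 ∧ wordPhi n i (a :: columnWord R) = 0) ∨
       (b' = b ∧ letterF n i a = some a' ∧
          wordEps n i (columnWord L ++ [b]) = 0 ∧ wordPhi n i (columnWord R) = 0)) := by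
  intro hw
  obtain ⟨p, x, y, q, hw1, rfl, hxy, hp, hq⟩ := (wordF_eq_some_iff hn hi hin).1 hw
  obtain ⟨L, a, b, R, rfl, ⟨rfl, rfl, rfl⟩ | ⟨rfl, rfl, rfl⟩⟩ := columnWord_eq_append_cons hw1
  · exact ⟨L, a, x, a, y, R, rfl, by simp [columnWord_append, columnWord],
      Or.inl ⟨rfl, hxy, hp, hq⟩⟩
  · exact ⟨L, x, b, y, b, R, rfl, by simp [columnWord_append, columnWord],
      Or.inr ⟨rfl, hxy, hp, hq⟩⟩

theorem tabF_eq_some_iff (hn : 2 ≤ n) (hi : 1 ≤ i) (hin : i ≤ n) {t t' : List (ℤ × ℤ)} :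
    tabF n i t = some t' ↔ wordF n i (columnWord t) = some (columnWord t') := by
  unfold tabF
  rw [Option.map_eq_some_iff]
  constructor
  · rintro ⟨w, hw, rfl⟩
    obtain ⟨L, a, b, a', b', R, -, rfl, -⟩ := exists_columnWord_of_wordF hn hi hin hw
    rw [hw, ofColumnWord_columnWord]
  · exact fun h => ⟨_, h, ofColumnWord_columnWord t'⟩

theorem barWord_columnWord (t : List (ℤ × ℤ)) :
    barWord (columnWord t) = columnWord ((t.map fun c => (-c.2, -c.1)).reverse) := by
  induction t with
  | nil => rfl
  | cons c t ih =>
    simp [columnWord, barWord_cons, columnWord_append, ih]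

/-- The dual of a two-row tableau: rotate by a half turn and bar all letters. -/
def barTab (t : List (ℤ × ℤ)) : List (ℤ × ℤ) := (t.map fun c => (-c.2, -c.1)).reverse

theorem barTab_barTab (t : List (ℤ × ℤ)) : barTab (barTab t) = t := by
  simp [barTab, Function.comp_def]

/-- Duality reverses the arrows of the crystal of two-row arrays. -/
theorem tabF_barTab (hn : 2 ≤ n) (hi : 1 ≤ i) (hin : i ≤ n) {t t' : List (ℤ × ℤ)}
    (h : tabF n i t = some t') : tabF n i (barTab t') = some (barTab t) := by
  rw [tabF_eq_some_iff hn hi hin] at h ⊢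
  rw [barTab, barTab, ← barWord_columnWord, ← barWord_columnWord]
  exact wordF_barWord hn hi hin h

theorem tabE_eq_some_iff (hn : 2 ≤ n) (hi : 1 ≤ i) (hin : i ≤ n) {t t' : List (ℤ × ℤ)} :
    tabE n i t' = some t ↔ tabF n i t = some t' := by
  rw [tabF_eq_some_iff hn hi hin]
  unfold tabE
  rw [Option.map_eq_some_iff]
  constructor
  · rintro ⟨w, hw, rfl⟩
    rw [wordE_eq_some_iff_wordF hn hi hin] at hw
    have h := wordF_barWord hn hi hin hw
    rw [barWord_columnWord] at h
    obtain ⟨L, a, b, a', b', R, -, h, -⟩ := exists_columnWord_of_wordF hn hi hin h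
    have h2 := congrArg barWord h
    rw [barWord_barWord, barWord_columnWord] at h2
    rw [h2] at hw ⊢
    rw [ofColumnWord_columnWord, hw]
  · intro h
    exact ⟨_, (wordE_eq_some_iff_wordF hn hi hin).2 h, ofColumnWord_columnWord t⟩

theorem tabF_eq_none_iff {t : List (ℤ × ℤ)} :
    tabF n i t = none ↔ wordF n i (columnWord t) = none := by
  simp [tabF]

theorem tabE_eq_none_iff {t : List (ℤ × ℤ)} :
    tabE n i t = none ↔ wordE n i (columnWord t) = none := by
  simp [tabE]

end Columns

/-! ### The order on letters and columns -/

section Order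

variable {n : ℕ}

theorem IsLetter.height_eq {x : ℤ} (hx : IsLetter n x) :
    (0 < x ∧ x ≤ n ∧ height n x = x) ∨ (x < 0 ∧ -(n : ℤ) ≤ x ∧ height n x = 2 * n + x) := by
  obtain ⟨h1, h2⟩ := hx
  unfold height
  split_ifs with h
  · rw [abs_of_pos h] at h2; omega
  · rw [abs_of_nonpos (by omega)] at h1 h2; omega

theorem isLetter_iff {x : ℤ} : IsLetter n x ↔ (0 < x ∧ x ≤ n) ∨ (x < 0 ∧ -(n : ℤ) ≤ x) := by
  constructor
  · intro h; have := h.height_eq; omega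
  · rintro (h | h)
    · rw [IsLetter, abs_of_pos h.1]; omega
    · rw [IsLetter, abs_of_neg h.1]; omega

theorem IsLetter.neg {x : ℤ} (hx : IsLetter n x) : IsLetter n (-x) := by
  rwa [IsLetter, abs_neg]

theorem le_refl (x : ℤ) : le n x x := Or.inl rfl

theorem le_trans {x y z : ℤ} (h1 : le n x y) (h2 : le n y z) : le n x z := by
  unfold le at *
  rcases h1 with rfl | h1
  · exact h2
  · rcases h2 with rfl | h2
    · exact Or.inr h1
    · exact Or.inr (h1.trans h2)

theorem le_antisymm {x y : ℤ} (h1 : le n x y) (h2 : le n y x) : x = y := by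
  unfold le at *
  omega

theorem le_neg_neg {x y : ℤ} (hx : IsLetter n x) (hy : IsLetter n y) (h : le n x y) :
    le n (-y) (-x) := by
  have h1 := hx.height_eq
  have h2 := hy.height_eq
  have h3 := hx.neg.height_eq
  have h4 := hy.neg.height_eq
  unfold le at *
  omega

/-- Entrywise comparison of columns, the condition on rows in `IsTableau`. -/
abbrev ColLe (n : ℕ) (c d : ℤ × ℤ) : Prop := le n c.1 d.1 ∧ le n c.2 d.2

/-- The condition on pairs of columns `c … d` in `IsTableau`. -/
abbrev MiddleFree (n : ℕ) (c d : ℤ × ℤ) : Prop :=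
  ¬ (c = ((n : ℤ) - 1, (n : ℤ)) ∧ d = ((n : ℤ), -((n : ℤ) - 1))) ∧
  ¬ (c = ((n : ℤ) - 1, -(n : ℤ)) ∧ d = (-(n : ℤ), -((n : ℤ) - 1)))

/-- The condition on adjacent columns `c d` in `IsKN`. -/
abbrev ConfigFree (c d : ℤ × ℤ) : Prop := d ≠ (c.1, -c.1) ∧ ¬ (c.2 = -c.1 ∧ d.2 = -c.1)

instance : Trans (ColLe n) (ColLe n) (ColLe n) :=
  ⟨fun h1 h2 => ⟨le_trans h1.1 h2.1, le_trans h1.2 h2.2⟩⟩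

theorem IsTableau.pairwise {t : List (ℤ × ℤ)} (h : IsTableau n t) : t.Pairwise (ColLe n) :=
  List.isChain_iff_pairwise.1 h.rows

theorem isTableau_of_pairwise {t : List (ℤ × ℤ)} (h1 : ∀ c ∈ t, IsLetter n c.1 ∧ IsLetter n c.2)
    (h2 : t.Pairwise (ColLe n)) (h3 : ∀ c ∈ t, ¬ le n c.2 c.1)
    (h4 : t.Pairwise (MiddleFree n)) : IsTableau n t :=
  ⟨h1, List.isChain_iff_pairwise.2 h2, h3, h4⟩

theorem ColLe.antisymm {c d : ℤ × ℤ} (h1 : ColLe n c d) (h2 : ColLe n d c) : c = d :=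
  Prod.ext (le_antisymm h1.1 h2.1) (le_antisymm h1.2 h2.2)

/-- Replacing one column of a Kashiwara–Nakashima tableau. -/
theorem IsKN.replace {L R : List (ℤ × ℤ)} {c c' : ℤ × ℤ} (h : IsKN n (L ++ c :: R))
    (hlet : IsLetter n c'.1 ∧ IsLetter n c'.2) (hcol : ¬ le n c'.2 c'.1)
    (hL : ∀ e ∈ L.getLast?, ColLe n e c' ∧ ConfigFree e c')
    (hR : ∀ d ∈ R.head?, ColLe n c' d ∧ ConfigFree c' d)
    (hLm : ∀ e ∈ L, MiddleFree n e c') (hRm : ∀ d ∈ R, MiddleFree n c' d)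
    (hone : c' ≠ (1, -1)) : IsKN n (L ++ c' :: R) := by
  obtain ⟨⟨h1, h2, h3, h4⟩, h5, h6⟩ := h
  refine ⟨⟨?_, ?_, ?_, ?_⟩, ?_, ?_⟩
  · intro d hd
    rcases List.mem_append.1 hd with hd | hd
    · exact h1 d (by simp [hd])
    · rcases List.mem_cons.1 hd with rfl | hd
      · exact hlet
      · exact h1 d (by simp [hd])
  · rw [List.isChain_append, List.isChain_cons] at h2 ⊢
    refine ⟨h2.1, ⟨fun d hd => (hR d hd).1, h2.2.1.2⟩, fun e he d hd => ?_⟩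
    simp only [List.head?_cons, Option.mem_def, Option.some.injEq] at hd
    subst hd
    exact (hL e he).1
  · intro d hd
    rcases List.mem_append.1 hd with hd | hd
    · exact h3 d (by simp [hd])
    · rcases List.mem_cons.1 hd with rfl | hd
      · exact hcol
      · exact h3 d (by simp [hd])
  · rw [List.pairwise_append, List.pairwise_cons] at h4 ⊢
    refine ⟨h4.1, ⟨hRm, h4.2.1.2⟩, fun e he d hd => ?_⟩
    rcases List.mem_cons.1 hd with rfl | hd
    · exact hLm e he
    · exact h4.2.2 e he d (by simp [hd])
  · rw [List.isChain_append, List.isChain_cons] at h5 ⊢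
    refine ⟨h5.1, ⟨fun d hd => (hR d hd).2, h5.2.1.2⟩, fun e he d hd => ?_⟩
    simp only [List.head?_cons, Option.mem_def, Option.some.injEq] at hd
    subst hd
    exact (hL e he).2
  · simp only [List.mem_append, List.mem_cons, not_or] at h6 ⊢
    exact ⟨h6.1, fun h => hone h.symm, h6.2.2⟩

end Order

/-! ### Stability of the Kashiwara–Nakashima tableaux -/

section Stability

variable {n i : ℕ}

/-- The column `c'` arises from the column `c` by applying `f_i`, `i < n`, to one letter, which the
other letter does not cancel in the `i`-signature. -/
abbrev RaisesColumn (i : ℕ) (c c' : ℤ × ℤ) : Prop :=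
  (c'.1 = c.1 ∧ ((c.2 = i ∧ c'.2 = i + 1) ∨ (c.2 = -(i + 1) ∧ c'.2 = -i)) ∧
    c.1 ≠ i ∧ c.1 ≠ -(i + 1)) ∨
  (c'.2 = c.2 ∧ ((c.1 = i ∧ c'.1 = i + 1) ∨ (c.1 = -(i + 1) ∧ c'.1 = -i)) ∧
    c.2 ≠ i + 1 ∧ c.2 ≠ -i)

/-- The condition on the next column `d` under which `f_i`, `i < n`, acts on the column `c`,
changing it to `c'`: a letter of `d` that `f_i` could change is cancelled by the letter read just
before it. -/
abbrev AllowsNext (i : ℕ) (c c' d : ℤ × ℤ) : Prop :=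
  (c'.1 = c.1 ∧ ((d.2 = i ∨ d.2 = -(i + 1)) → c.1 = i + 1 ∨ c.1 = -i)) ∨
  (c'.2 = c.2 ∧ d.2 ≠ i ∧ d.2 ≠ -(i + 1) ∧
    ((d.1 = i ∨ d.1 = -(i + 1)) → d.2 = i + 1 ∨ d.2 = -i))

set_option maxHeartbeats 800000 in
theorem RaisesColumn.colLe_next (hi : 1 ≤ i) (hin : i < n) {c c' d : ℤ × ℤ}
    (hc : RaisesColumn i c c') (hd : AllowsNext i c c' d)
    (lc : IsLetter n c.1 ∧ IsLetter n c.2) (ld : IsLetter n d.1 ∧ IsLetter n d.2)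
    (kc : ¬ le n c.2 c.1) (kd : ¬ le n d.2 d.1) (h : ColLe n c d) (h' : ConfigFree c d)
    (hm : MiddleFree n c d) : ColLe n c' d := by
  obtain ⟨a, b⟩ := c
  obtain ⟨a', b'⟩ := c'
  obtain ⟨x, y⟩ := d
  have e1 : height n (i : ℤ) = i := by unfold height; split_ifs <;> omega
  have e2 : height n ((i : ℤ) + 1) = i + 1 := by unfold height; split_ifs <;> omega
  have e3 : height n (-((i : ℤ) + 1)) = 2 * n - (i + 1) := by
    unfold height; split_ifs <;> omega
  have e4 : height n (-(i : ℤ)) = 2 * n - i := by unfold height; split_ifs <;> omega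
  have z1 := lc.1.height_eq
  have z2 := lc.2.height_eq
  have z3 := ld.1.height_eq
  have z4 := ld.2.height_eq
  simp only [ConfigFree, MiddleFree, RaisesColumn, AllowsNext, ne_eq, Prod.mk.injEq, ColLe] at *
  unfold le at *
  rcases hc with ⟨rfl, ⟨rfl, rfl⟩ | ⟨rfl, rfl⟩, c1, c2⟩ |
      ⟨rfl, ⟨rfl, rfl⟩ | ⟨rfl, rfl⟩, c1, c2⟩
  · have hy : ¬ (y = i ∨ y = -(i + 1)) := by
      intro hy
      rcases hd with hd | hd
      · have := hd.2 hy
        rw [e1] at kc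
        clear h h' hm kd hd hy z2 z3 z4
        omega
      · omega
    have hy' := h.2
    have h1 := h.1
    rw [e1] at hy'
    rw [e2]
    clear kc h hd h' hm kd z1 z2 z3
    exact ⟨h1, by omega⟩
  · have hy : ¬ y = -(i + 1) := by
      intro hy
      rcases hd with hd | hd
      · have := hd.2 (Or.inr hy)
        rw [e3] at kc
        clear h hm kd hd z2 z3 z4
        omega
      · omega
    have hy' := h.2
    have h1 := h.1
    rw [e3] at hy'
    rw [e4]
    clear kc h hd h' hm kd z1 z2 z3
    exact ⟨h1, by omega⟩
  · have hb : i + 1 ≤ height n b' := by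
      rw [e1] at kc
      clear h hd h' hm kd z1 z3 z4
      omega
    obtain ⟨-, -, -, hd⟩ := hd.resolve_left (by omega)
    have hy : (x = i ∨ x = -(i + 1)) → y = -i := by
      intro hx
      rcases hd hx with rfl | rfl
      · have := h.2
        rw [e2] at this
        clear h hd h' hm kd kc z1 z3 z4
        omega
      · rfl
    have hx : x ≠ i := fun hx => h'.1 ⟨hx, hy (Or.inl hx)⟩
    refine ⟨?_, h.2⟩
    have h1 := h.1
    rw [e1] at h1
    rw [e2]
    by_cases hx' : x = -(i + 1)
    · have hy' := hy (Or.inr hx')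
      have h2 := h.2
      subst hy'
      rw [e4] at h2
      clear h hd h' kd kc z1 z4 hy
      by_cases hin' : i + 1 = n
      · clear e1 e2 e3 e4
        exact absurd ⟨⟨by omega, by omega⟩, by omega, by omega⟩ hm.2
      · rw [hx', e3]
        omega
    · clear h hd h' kd kc z1 z4 hy hm
      omega
  · have hb : 2 * n - i < height n b' := by
      rw [e3] at kc
      clear h hd h' hm kd z1 z3 z4
      omega
    obtain ⟨-, -, -, hd⟩ := hd.resolve_left (by omega)
    have hx : x ≠ -(i + 1) := by
      intro hx
      have h2 := h.2
      rcases hd (Or.inr hx) with rfl | rfl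
      · rw [e2] at h2
        clear h hd h' hm kd kc z1 z3 z4
        omega
      · rw [e4] at h2
        clear h hd h' hm kd kc z1 z3 z4
        omega
    refine ⟨?_, h.2⟩
    have h1 := h.1
    rw [e3] at h1
    rw [e4]
    clear h hd h' kd kc z1 z4 hm
    rcases h1.resolve_left (Ne.symm hx) |> Int.add_one_le_of_lt |> eq_or_lt_of_le with h1 | h1
    · left; omega
    · right; omega

theorem RaisesColumn.configFree_next (hi : 1 ≤ i) {c c' d : ℤ × ℤ}
    (hc : RaisesColumn i c c') (hd : AllowsNext i c c' d)
    (lc : IsLetter n c.1 ∧ IsLetter n c.2) (ld : IsLetter n d.1 ∧ IsLetter n d.2)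
    (kc : ¬ le n c.2 c.1) (kd : ¬ le n d.2 d.1) (h : ColLe n c d) (h' : ConfigFree c d) :
    ConfigFree c' d := by
  have z1 := lc.1.height_eq
  have z2 := lc.2.height_eq
  have z3 := ld.1.height_eq
  have z4 := ld.2.height_eq
  obtain ⟨a, b⟩ := c
  obtain ⟨a', b'⟩ := c'
  obtain ⟨x, y⟩ := d
  clear lc ld
  simp only [ConfigFree, RaisesColumn, AllowsNext, ne_eq, Prod.mk.injEq, ColLe] at *
  unfold le at *
  rcases hc with ⟨rfl, ⟨rfl, rfl⟩ | ⟨rfl, rfl⟩, c1, c2⟩ |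
      ⟨rfl, ⟨rfl, rfl⟩ | ⟨rfl, rfl⟩, c1, c2⟩ <;> refine ⟨?_, ?_⟩ <;> omega

/-- A new pair `(n - 1, ±n) … (±n, bar (n - 1))` would leave no room for the column `e` that
follows the changed one. -/
theorem RaisesColumn.middleFree (hn : 4 ≤ n) (hi : 1 ≤ i) (hin : i < n) {c c' d e : ℤ × ℤ}
    (hc : RaisesColumn i c c') (he : AllowsNext i c c' e)
    (lc : IsLetter n c.1 ∧ IsLetter n c.2)
    (le' : IsLetter n e.1 ∧ IsLetter n e.2)
    (kc : ¬ le n c.2 c.1) (ke : ¬ le n e.2 e.1) (h : ColLe n c e)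
    (hed : e = d ∨ ColLe n e d ∧ MiddleFree n e d) : MiddleFree n c' d := by
  have z1 := lc.1.height_eq
  have z2 := lc.2.height_eq
  have z3 := le'.1.height_eq
  have z4 := le'.2.height_eq
  obtain ⟨a, b⟩ := c
  obtain ⟨a', b'⟩ := c'
  obtain ⟨x, y⟩ := d
  obtain ⟨z, w⟩ := e
  have e1 : height n (n : ℤ) = n := by unfold height; split_ifs <;> omega
  have e2 : height n (-(n : ℤ)) = n := by unfold height; split_ifs <;> omega
  have e3 : height n (-((n : ℤ) - 1)) = n + 1 := by unfold height; split_ifs <;> omega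
  clear lc le'
  simp only [MiddleFree, RaisesColumn, AllowsNext, ne_eq, Prod.mk.injEq, ColLe] at *
  unfold le at *
  refine ⟨?_, ?_⟩ <;> rintro ⟨⟨rfl, rfl⟩, rfl, rfl⟩
  · rw [e1, e3] at hed
    rcases hc with ⟨rfl, ⟨rfl, c3⟩ | ⟨rfl, c3⟩, c1, c2⟩ |
      ⟨rfl, ⟨rfl, c3⟩ | ⟨rfl, c3⟩, c1, c2⟩
    · omega
    · omega
    · rcases hed with ⟨rfl, rfl⟩ | hed
      · omega
      · omega
    · omega
  · rw [e2, e3] at hed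
    rcases hc with ⟨rfl, ⟨rfl, c3⟩ | ⟨rfl, c3⟩, c1, c2⟩ |
      ⟨rfl, ⟨rfl, c3⟩ | ⟨rfl, c3⟩, c1, c2⟩
    · omega
    · omega
    · rcases hed with ⟨rfl, rfl⟩ | hed
      · omega
      · omega
    · omega

theorem RaisesColumn.isLetter (hi : 1 ≤ i) (hin : i < n) {c c' : ℤ × ℤ}
    (hc : RaisesColumn i c c') (lc : IsLetter n c.1 ∧ IsLetter n c.2) :
    IsLetter n c'.1 ∧ IsLetter n c'.2 := by
  obtain ⟨a, b⟩ := c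
  obtain ⟨a', b'⟩ := c'
  simp only [isLetter_iff, RaisesColumn] at *
  omega

theorem RaisesColumn.colLe (hi : 1 ≤ i) {c c' : ℤ × ℤ}
    (hc : RaisesColumn i c c') : ColLe n c c' := by
  obtain ⟨a, b⟩ := c
  obtain ⟨a', b'⟩ := c'
  have e1 : height n (i : ℤ) = i := by unfold height; split_ifs <;> omega
  have e2 : height n ((i : ℤ) + 1) = i + 1 := by unfold height; split_ifs <;> omega
  have e3 : height n (-((i : ℤ) + 1)) = 2 * n - (i + 1) := by
    unfold height; split_ifs <;> omega
  have e4 : height n (-(i : ℤ)) = 2 * n - i := by unfold height; split_ifs <;> omega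
  simp only [RaisesColumn, ColLe] at *
  unfold le
  rcases hc with ⟨rfl, ⟨rfl, rfl⟩ | ⟨rfl, rfl⟩, c1, c2⟩ |
      ⟨rfl, ⟨rfl, rfl⟩ | ⟨rfl, rfl⟩, c1, c2⟩
  · exact ⟨Or.inl rfl, Or.inr (by rw [e1, e2]; omega)⟩
  · exact ⟨Or.inl rfl, Or.inr (by rw [e3, e4]; omega)⟩
  · exact ⟨Or.inr (by rw [e1, e2]; omega), Or.inl rfl⟩
  · exact ⟨Or.inr (by rw [e3, e4]; omega), Or.inl rfl⟩

theorem RaisesColumn.not_le (hi : 1 ≤ i) (hin : i < n) {c c' : ℤ × ℤ}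
    (hc : RaisesColumn i c c') (lc : IsLetter n c.1 ∧ IsLetter n c.2) (kc : ¬ le n c.2 c.1) :
    ¬ le n c'.2 c'.1 := by
  have lc' := hc.isLetter hi hin lc
  have z1 := lc.1.height_eq
  have z2 := lc.2.height_eq
  have z3 := lc'.1.height_eq
  have z4 := lc'.2.height_eq
  obtain ⟨a, b⟩ := c
  obtain ⟨a', b'⟩ := c'
  clear lc lc'
  simp only [RaisesColumn] at *
  unfold le at *
  rcases hc with ⟨rfl, ⟨rfl, rfl⟩ | ⟨rfl, rfl⟩, c1, c2⟩ |
      ⟨rfl, ⟨rfl, rfl⟩ | ⟨rfl, rfl⟩, c1, c2⟩ <;> omega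

theorem RaisesColumn.configFree_prev (hi : 1 ≤ i) (hin : i < n) {c c' e : ℤ × ℤ}
    (hc : RaisesColumn i c c') (lc : IsLetter n c.1 ∧ IsLetter n c.2)
    (le' : IsLetter n e.1 ∧ IsLetter n e.2) (kc : ¬ le n c.2 c.1) (h : ColLe n e c)
    (h' : ConfigFree e c) : ConfigFree e c' := by
  have z1 := lc.1.height_eq
  have z2 := lc.2.height_eq
  have z3 := le'.1.height_eq
  have z4 := le'.2.height_eq
  obtain ⟨a, b⟩ := c
  obtain ⟨a', b'⟩ := c'
  obtain ⟨x, y⟩ := e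
  clear lc le'
  simp only [ConfigFree, RaisesColumn, ne_eq, Prod.mk.injEq, ColLe] at *
  unfold le at *
  rcases hc with ⟨rfl, ⟨rfl, rfl⟩ | ⟨rfl, rfl⟩, c1, c2⟩ |
      ⟨rfl, ⟨rfl, rfl⟩ | ⟨rfl, rfl⟩, c1, c2⟩ <;> refine ⟨?_, ?_⟩ <;> omega

theorem RaisesColumn.middleFree_prev (hi : 1 ≤ i) (hin : i < n) {c c' e : ℤ × ℤ}
    (hc : RaisesColumn i c c') (lc : IsLetter n c.1 ∧ IsLetter n c.2)
    (kc : ¬ le n c.2 c.1) (h : ColLe n e c) (h' : MiddleFree n e c) : MiddleFree n e c' := by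
  have z1 := lc.1.height_eq
  have z2 := lc.2.height_eq
  obtain ⟨a, b⟩ := c
  obtain ⟨a', b'⟩ := c'
  obtain ⟨x, y⟩ := e
  have e1 : height n (n : ℤ) = n := by unfold height; split_ifs <;> omega
  have e2 : height n (-(n : ℤ)) = n := by unfold height; split_ifs <;> omega
  clear lc
  simp only [MiddleFree, RaisesColumn, ne_eq, Prod.mk.injEq, ColLe] at *
  unfold le at *
  refine ⟨?_, ?_⟩ <;> rintro ⟨⟨rfl, rfl⟩, rfl, rfl⟩ <;>
  rcases hc with ⟨c0, ⟨c3, c4⟩ | ⟨c3, c4⟩, c1, c2⟩ |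
      ⟨c0, ⟨c3, c4⟩ | ⟨c3, c4⟩, c1, c2⟩ <;> simp only [e1, e2] at h <;> omega

/-- The colours `i < n` preserve the Kashiwara–Nakashima tableaux: one column changes, and the
conditions on it and its neighbours are checked against the signature rule. -/
theorem IsKN.tabF_of_lt (hn : 4 ≤ n) (hi : 1 ≤ i) (hin : i < n) {t t' : List (ℤ × ℤ)}
    (ht : IsKN n t) (h : tabF n i t = some t') : IsKN n t' := by
  rw [tabF_eq_some_iff (by omega) hi hin.le] at h
  obtain ⟨L, a, b, a', b', R, rfl, h2, hstep⟩ :=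
    exists_columnWord_of_wordF (by omega) hi hin.le h
  obtain rfl := columnWord_injective h2
  have hab := ht.letters (a, b) (by simp)
  have hcol := ht.columns (a, b) (by simp)
  have hphi : ∀ x : ℤ, letterPhi n i x = 1 ↔ x = i ∨ x = -(i + 1) := fun x => by
    rw [letterPhi_eq_one_iff' hin.le]; omega
  have heps : ∀ x : ℤ, letterEps n i x = 1 ↔ x = i + 1 ∨ x = -i := fun x => by
    rw [letterEps_eq_one_iff' hin.le]; omega
  -- what the signature rule says about the changed column
  have hchange : RaisesColumn i (a, b) (a', b') := by
    rcases hstep with ⟨h1, h2, h3, h4⟩ | ⟨h1, h2, h3, h4⟩ <;>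
      rw [letterF_eq_some_iff hi hin.le] at h2
    · have := hphi a
      simp only [wordPhi] at h4
      simp only [RaisesColumn]
      omega
    · have := heps b
      have := letterEps_le_one (n := n) (i := i) b
      rw [wordEps_append] at h3
      simp only [wordEps, wordPhi] at h3
      simp only [RaisesColumn]
      omega
  -- and about the column after it
  have hnext : ∀ d ∈ R.head?, AllowsNext i (a, b) (a', b') d := by
    intro d hd
    obtain ⟨R', rfl⟩ : ∃ R', R = d :: R' := by
      cases R with
      | nil => simp at hd
      | cons e R' => simp at hd; exact ⟨R', by rw [hd]⟩
    have e1 := letterEps_le_one (n := n) (i := i) a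
    have e2 := letterEps_le_one (n := n) (i := i) d.2
    rcases hstep with ⟨h1, h2, h3, h4⟩ | ⟨h1, h2, h3, h4⟩
    · refine Or.inl ⟨h1, ?_⟩
      simp only [wordPhi, columnWord] at h4
      change (d.2 = i ∨ d.2 = -(i + 1)) → a = i + 1 ∨ a = -i
      rw [← hphi, ← heps]
      omega
    · refine Or.inr ⟨h1, ?_⟩
      simp only [wordPhi, columnWord] at h4
      have := hphi d.2
      rw [← hphi, ← heps]
      omega
  clear hstep h h2 hphi heps
  have hpw := ht.pairwise
  have hmid := ht.middle
  have hcf := ht.noConfig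
  rw [List.pairwise_append, List.pairwise_cons] at hpw hmid
  rw [List.isChain_append, List.isChain_cons] at hcf
  simp only [List.head?_cons, Option.mem_def, Option.some.injEq, forall_eq'] at hcf
  have hlet' := hchange.isLetter hi hin hab
  have hup := hchange.colLe (n := n) hi
  refine ht.replace hlet' (hchange.not_le hi hin hab hcol) (fun e he => ?_) (fun d hd => ?_)
    (fun e he => ?_) (fun d hd => ?_) ?_
  · have heL := List.mem_of_getLast? he
    have h1 := hpw.2.2 e heL (a, b) (by simp)
    exact ⟨⟨le_trans h1.1 hup.1, le_trans h1.2 hup.2⟩,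
      hchange.configFree_prev hi hin hab (ht.letters e (by simp [heL])) hcol h1
        (hcf.2.2 e he)⟩
  · have hdR := List.mem_of_mem_head? hd
    have h1 := hpw.2.1.1 d hdR
    have h2 := hcf.2.1.1 d hd
    have l1 := ht.letters d (by simp [hdR])
    have l3 := ht.columns d (by simp [hdR])
    exact ⟨hchange.colLe_next hi hin (hnext d hd) hab l1 hcol l3 h1 h2
        (hmid.2.1.1 d hdR),
      hchange.configFree_next hi (hnext d hd) hab l1 hcol l3 h1 h2⟩
  · exact hchange.middleFree_prev hi hin hab hcol (hpw.2.2 e he (a, b) (by simp))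
      (hmid.2.2 e he (a, b) (by simp))
  · obtain ⟨e, R', rfl⟩ : ∃ e R', R = e :: R' := by
      cases R with
      | nil => simp at hd
      | cons e R' => exact ⟨e, R', rfl⟩
    refine hchange.middleFree hn hi hin (hnext e rfl) hab (ht.letters e (by simp)) hcol
      (ht.columns e (by simp)) (hpw.2.1.1 e (by simp)) ?_
    rcases List.mem_cons.1 hd with rfl | hd
    · exact Or.inl rfl
    · exact Or.inr ⟨(List.pairwise_cons.1 hpw.2.1.2).1 d hd,
        (List.pairwise_cons.1 hmid.2.1.2).1 d hd⟩
  · rintro h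
    simp only [Prod.mk.injEq] at h
    simp only [RaisesColumn] at hchange
    unfold le at hcol
    omega

/-- The diagram automorphism exchanging the colours `n - 1` and `n`, on letters. -/
def swapLetter (n : ℕ) (x : ℤ) : ℤ := if x = n ∨ x = -n then -x else x

/-- The diagram automorphism exchanging the colours `n - 1` and `n`, on two-row arrays. -/
def swapTab (n : ℕ) (t : List (ℤ × ℤ)) : List (ℤ × ℤ) :=
  t.map fun c => (swapLetter n c.1, swapLetter n c.2)

theorem swapLetter_swapLetter (x : ℤ) : swapLetter n (swapLetter n x) = x := by
  unfold swapLetter; split_ifs <;> omega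

theorem swapLetter_neg (x : ℤ) : swapLetter n (-x) = -swapLetter n x := by
  unfold swapLetter; split_ifs <;> omega

theorem swapLetter_injective : Function.Injective (swapLetter n) :=
  Function.LeftInverse.injective swapLetter_swapLetter

theorem swapTab_swapTab (t : List (ℤ × ℤ)) : swapTab n (swapTab n t) = t := by
  simp [swapTab, Function.comp_def, swapLetter_swapLetter]

theorem height_swapLetter (hn : 1 ≤ n) (x : ℤ) : height n (swapLetter n x) = height n x := by
  unfold height swapLetter; split_ifs <;> omega

theorem le_swapLetter (hn : 1 ≤ n) (x y : ℤ) :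
    le n (swapLetter n x) (swapLetter n y) ↔ le n x y := by
  rw [le, le, height_swapLetter hn, height_swapLetter hn, swapLetter_injective.eq_iff]

theorem IsLetter.swap {x : ℤ} (hx : IsLetter n x) : IsLetter n (swapLetter n x) := by
  rw [isLetter_iff] at *
  unfold swapLetter; split_ifs <;> omega

theorem letterF_swapLetter (hn : 4 ≤ n) {x y : ℤ} (h : letterF n n x = some y) :
    letterF n (n - 1) (swapLetter n x) = some (swapLetter n y) := by
  rw [letterF_eq_some_iff (by omega) (by omega)] at *
  unfold swapLetter
  split_ifs <;> omega

theorem letterPhi_swapLetter (hn : 4 ≤ n) (x : ℤ) :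
    letterPhi n (n - 1) (swapLetter n x) = letterPhi n n x ∧
    letterEps n (n - 1) (swapLetter n x) = letterEps n n x := by
  have h1 := letterPhi_eq_one_iff' (n := n) (i := n - 1) (by omega) (x := swapLetter n x)
  have h2 := letterPhi_eq_one_iff' (n := n) (i := n) (by omega) (x := x)
  have h3 := letterEps_eq_one_iff' (n := n) (i := n - 1) (by omega) (x := swapLetter n x)
  have h4 := letterEps_eq_one_iff' (n := n) (i := n) (by omega) (x := x)
  have h5 := letterPhi_le_one (n := n) (i := n - 1) (swapLetter n x)
  have h6 := letterPhi_le_one (n := n) (i := n) x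
  have h7 := letterEps_le_one (n := n) (i := n - 1) (swapLetter n x)
  have h8 := letterEps_le_one (n := n) (i := n) x
  have h9 : (x = n ∨ x = -n) ∧ swapLetter n x = -x ∨
      ¬ (x = n ∨ x = -n) ∧ swapLetter n x = x := by
    unfold swapLetter; split_ifs <;> simp_all
  have k1 : letterPhi n (n - 1) (swapLetter n x) = 1 ↔ letterPhi n n x = 1 := by
    rw [h1, h2]; omega
  have k2 : letterEps n (n - 1) (swapLetter n x) = 1 ↔ letterEps n n x = 1 := by
    rw [h3, h4]; omega
  omega

theorem wordPhi_swap (hn : 4 ≤ n) (w : List ℤ) :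
    wordPhi n (n - 1) (w.map (swapLetter n)) = wordPhi n n w ∧
    wordEps n (n - 1) (w.map (swapLetter n)) = wordEps n n w := by
  induction w with
  | nil => simp [wordPhi, wordEps]
  | cons x w ih =>
    simp [wordPhi, wordEps, ih, letterPhi_swapLetter hn]

theorem columnWord_swapTab (t : List (ℤ × ℤ)) :
    columnWord (swapTab n t) = (columnWord t).map (swapLetter n) := by
  induction t with
  | nil => rfl
  | cons c t ih => simpa [swapTab, columnWord] using ih

theorem tabF_swapTab (hn : 4 ≤ n) {t t' : List (ℤ × ℤ)} (h : tabF n n t = some t') :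
    tabF n (n - 1) (swapTab n t) = some (swapTab n t') := by
  rw [tabF_eq_some_iff (by omega) (by omega) (by omega),
    wordF_eq_some_iff (by omega) (by omega) (by omega)] at *
  obtain ⟨p, x, y, q, h1, h2, h3, h4, h5⟩ := h
  refine ⟨p.map (swapLetter n), swapLetter n x, swapLetter n y, q.map (swapLetter n), ?_, ?_,
    letterF_swapLetter hn h3, ?_, ?_⟩
  · rw [columnWord_swapTab, h1]; simp
  · rw [columnWord_swapTab, h2]; simp
  · rw [(wordPhi_swap hn p).2, h4]
  · rw [(wordPhi_swap hn q).1, h5]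

theorem IsKN.swap (hn : 4 ≤ n) {t : List (ℤ × ℤ)} (h : IsKN n t) : IsKN n (swapTab n t) := by
  obtain ⟨⟨h1, h2, h3, h4⟩, h5, h6⟩ := h
  have key : ∀ x y : ℤ, swapLetter n x = y ↔ x = swapLetter n y := fun x y => by
    rw [← swapLetter_injective.eq_iff, swapLetter_swapLetter]
  have s1 : swapLetter n ((n : ℤ) - 1) = n - 1 := by unfold swapLetter; split_ifs <;> omega
  have s2 : swapLetter n (n : ℤ) = -n := by unfold swapLetter; split_ifs <;> omega
  have s3 : swapLetter n (1 : ℤ) = 1 := by unfold swapLetter; split_ifs <;> omega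
  refine ⟨⟨?_, ?_, ?_, ?_⟩, ?_, ?_⟩
  · intro c hc
    obtain ⟨d, hd, rfl⟩ := List.mem_map.1 hc
    exact ⟨(h1 d hd).1.swap, (h1 d hd).2.swap⟩
  · rw [swapTab, List.isChain_map]
    simpa only [le_swapLetter (show 1 ≤ n by omega)] using h2
  · intro c hc
    obtain ⟨d, hd, rfl⟩ := List.mem_map.1 hc
    simpa only [le_swapLetter (show 1 ≤ n by omega)] using h3 d hd
  · rw [swapTab, List.pairwise_map]
    refine h4.imp ?_
    rintro ⟨a, b⟩ ⟨x, y⟩ ⟨k1, k2⟩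
    simp only [Prod.mk.injEq, key, swapLetter_neg, s1, s2, neg_neg] at k1 k2 ⊢
    exact ⟨k2, k1⟩
  · rw [swapTab, List.isChain_map]
    refine h5.imp ?_
    rintro ⟨a, b⟩ ⟨x, y⟩ ⟨k1, k2⟩
    simpa only [ne_eq, Prod.mk.injEq, ← swapLetter_neg, swapLetter_injective.eq_iff] using
      And.intro k1 k2
  · intro hc
    obtain ⟨⟨a, b⟩, hd, h⟩ := List.mem_map.1 hc
    simp only [Prod.mk.injEq, key, swapLetter_neg, s3] at h
    rw [h.1, h.2] at hd
    exact h6 hd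

/-- The lowering operators preserve the Kashiwara–Nakashima tableaux; the colour `n` is reduced to
the colour `n - 1` by the diagram automorphism. -/
theorem IsKN.tabF (hn : 4 ≤ n) (hi : 1 ≤ i) (hin : i ≤ n) {t t' : List (ℤ × ℤ)}
    (ht : IsKN n t) (h : tabF n i t = some t') : IsKN n t' := by
  rcases hin.lt_or_eq with hlt | rfl
  · exact ht.tabF_of_lt hn hi hlt h
  · rw [← swapTab_swapTab (n := i) t']
    exact ((ht.swap hn).tabF_of_lt hn (by omega) (by omega) (tabF_swapTab hn h)).swap hn

theorem IsKN.bar {t : List (ℤ × ℤ)} (h : IsKN n t) : IsKN n (barTab t) := by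
  obtain ⟨⟨h1, h2, h3, h4⟩, h5, h6⟩ := h
  have hmem : ∀ c ∈ barTab t, (-c.2, -c.1) ∈ t := by
    intro c hc
    simp only [barTab, List.mem_reverse, List.mem_map] at hc
    obtain ⟨d, hd, rfl⟩ := hc
    simpa using hd
  refine ⟨⟨?_, ?_, ?_, ?_⟩, ?_, ?_⟩
  · intro c hc
    have := h1 _ (hmem c hc)
    simp only at this
    exact ⟨by simpa using this.2.neg, by simpa using this.1.neg⟩
  · refine List.Pairwise.isChain ?_
    rw [barTab, List.pairwise_reverse, List.pairwise_map]
    refine (IsTableau.pairwise ⟨h1, h2, h3, h4⟩).imp_of_mem ?_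
    intro c d hc hd hcd
    exact ⟨le_neg_neg (h1 c hc).2 (h1 d hd).2 hcd.2, le_neg_neg (h1 c hc).1 (h1 d hd).1 hcd.1⟩
  · intro c hc
    have := h1 _ (hmem c hc)
    have h := h3 _ (hmem c hc)
    exact fun h' => h (le_neg_neg (by simpa using this.1.neg) (by simpa using this.2.neg) h')
  · rw [barTab, List.pairwise_reverse, List.pairwise_map]
    refine h4.imp ?_
    rintro ⟨a, b⟩ ⟨x, y⟩ ⟨k1, k2⟩
    simp only [Prod.mk.injEq] at k1 k2 ⊢
    omega
  · rw [barTab, List.isChain_reverse, List.isChain_map]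
    refine h5.imp ?_
    rintro ⟨a, b⟩ ⟨x, y⟩ ⟨k1, k2⟩
    simp only [ne_eq, Prod.mk.injEq] at k1 k2 ⊢
    omega
  · intro hc
    have := hmem _ hc
    simp at this
    exact h6 this

/-- The raising operators preserve the Kashiwara–Nakashima tableaux, by duality. -/
theorem IsKN.tabE (hn : 4 ≤ n) (hi : 1 ≤ i) (hin : i ≤ n) {t t' : List (ℤ × ℤ)}
    (ht : IsKN n t) (h : tabE n i t = some t') : IsKN n t' := by
  rw [tabE_eq_some_iff (by omega) hi hin] at h
  rw [← barTab_barTab t']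
  exact (ht.bar.tabF hn hi hin (tabF_barTab (by omega) hi hin h)).bar

theorem length_of_tabF (hn : 2 ≤ n) (hi : 1 ≤ i) (hin : i ≤ n) {t t' : List (ℤ × ℤ)}
    (h : tabF n i t = some t') : t'.length = t.length := by
  rw [tabF_eq_some_iff hn hi hin] at h
  obtain ⟨L, a, b, a', b', R, rfl, h2, -⟩ := exists_columnWord_of_wordF hn hi hin h
  rw [columnWord_injective h2]
  simp

end Stability

/-! ### The drop and fill maps are inverse to each other -/

section Drop

variable {n : ℕ}

/-- The columns `(a, bar a)`. -/
abbrev IsDiag (c : ℤ × ℤ) : Prop := c.2 = -c.1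

theorem IsTableau.sublist {t T : List (ℤ × ℤ)} (hT : IsTableau n T) (h : t.Sublist T) :
    IsTableau n t :=
  isTableau_of_pairwise (fun c hc => hT.letters c (h.subset hc)) (hT.pairwise.sublist h)
    (fun c hc => hT.columns c (h.subset hc)) (hT.middle.sublist h)

/-- All columns `(a, bar a)` of a tableau are equal. -/
theorem IsTableau.eq_of_isDiag {T : List (ℤ × ℤ)} (hT : IsTableau n T) {c d : ℤ × ℤ}
    (hc : c ∈ T) (hd : d ∈ T) (h1 : IsDiag c) (h2 : IsDiag d) : c = d := by
  have key : T.Pairwise (fun c d => IsDiag c → IsDiag d → c = d) := by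
    refine hT.pairwise.imp_of_mem ?_
    rintro ⟨a, b⟩ ⟨x, y⟩ hc hd ⟨h1, h2⟩ h3 h4
    simp only [IsDiag] at h1 h2 h3 h4
    subst h3 h4
    have l1 := (hT.letters _ hc).2
    have l2 := (hT.letters _ hd).2
    have := le_neg_neg l1 l2 h2
    rw [neg_neg, neg_neg] at this
    rw [le_antisymm h1 this]
  have hsymm : Std.Symm (fun c d : ℤ × ℤ => IsDiag c → IsDiag d → c = d) :=
    ⟨fun c d h h1 h2 => (h h2 h1).symm⟩
  exact key.forall_of_forall (fun _ _ _ _ => rfl) hc hd h1 h2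

theorem IsTableau.diag_range {T : List (ℤ × ℤ)} (hT : IsTableau n T) {a : ℤ}
    (h : (a, -a) ∈ T) : (1 ≤ a ∧ a ≤ n) ∨ a = -n := by
  have h1 := (hT.letters _ h).1.height_eq
  have h2 := (hT.letters _ h).2.height_eq
  have h3 := hT.columns _ h
  unfold le at h3
  simp only at h1 h2 h3
  omega

/-- All columns of a tableau between two equal ones are equal to them. So if `x = (a, bar a)` does
not occur next to a given occurrence of `x`, then it does not occur further away on that side, and
neither does any other column `(a', bar a')`. -/
theorem not_isDiag_of_le {L R : List (ℤ × ℤ)} {x : ℤ × ℤ} (hT : IsTableau n (L ++ x :: R))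
    (hx : IsDiag x) : (L.getLast? ≠ some x → ∀ c ∈ L, ¬ IsDiag c) ∧
      (R.head? ≠ some x → ∀ c ∈ R, ¬ IsDiag c) := by
  have hpw := hT.pairwise
  rw [List.pairwise_append, List.pairwise_cons] at hpw
  constructor
  · intro hL c hc hd
    obtain rfl := hT.eq_of_isDiag (c := c) (d := x) (by simp [hc]) (by simp) hd hx
    apply hL
    obtain ⟨L', e, rfl⟩ := List.eq_nil_or_concat'  L |>.resolve_left (by rintro rfl; simp at hc)
    rcases List.mem_append.1 hc with hc | hc
    · have h1 := (List.pairwise_append.1 hpw.1).2.2 c hc e (by simp)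
      have h2 := hpw.2.2 e (by simp) c (by simp)
      rw [List.getLast?_concat, ColLe.antisymm h1 h2]
    · simp at hc; simp [hc]
  · intro hR c hc hd
    obtain rfl := hT.eq_of_isDiag (c := c) (d := x) (by simp [hc]) (by simp) hd hx
    apply hR
    cases R with
    | nil => simp at hc
    | cons e R =>
      rcases List.mem_cons.1 hc with rfl | hc
      · rfl
      · have h1 := hpw.2.1.1 e (by simp)
        have h2 := (List.pairwise_cons.1 hpw.2.1.2).1 c hc
        rw [List.head?_cons, ColLe.antisymm h1 h2]

/-- The columns `(a, bar a)` of a tableau form one block. -/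
theorem IsTableau.exists_block {T : List (ℤ × ℤ)} (hT : IsTableau n T) : ∃ a M L R,
    T = L ++ List.replicate M (a, -a) ++ R ∧ (∀ c ∈ L, ¬ IsDiag c) ∧ (∀ c ∈ R, ¬ IsDiag c) := by
  induction T with
  | nil => exact ⟨1, 0, [], [], rfl, by simp, by simp⟩
  | cons c T ih =>
    obtain ⟨a, M, L, R, rfl, hL, hR⟩ := ih (hT.sublist (List.sublist_cons_self _ _))
    by_cases hc : IsDiag c
    · cases M with
      | zero =>
        refine ⟨c.1, 1, [], L ++ R, ?_, by simp, ?_⟩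
        · simp [← hc]
        · intro d hd
          rcases List.mem_append.1 hd with hd | hd
          exacts [hL d hd, hR d hd]
      | succ M =>
        obtain rfl := hT.eq_of_isDiag (c := c) (d := (a, -a)) (by simp)
          (by simp [List.replicate_succ]) hc rfl
        obtain rfl : L = [] := by
          by_contra hne
          obtain ⟨l, L', rfl⟩ := List.exists_cons_of_ne_nil hne
          have hpw := hT.pairwise
          simp only [List.cons_append, List.pairwise_cons] at hpw
          have h1 := hpw.1 l (by simp)
          have h2 := hpw.2.1 (a, -a) (by simp [List.replicate_succ])
          exact hL l (by simp) (by rw [← ColLe.antisymm h1 h2])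
        exact ⟨a, M + 2, [], R, by simp [List.replicate_succ], by simp, hR⟩
    · refine ⟨a, M, c :: L, R, by simp, ?_, hR⟩
      intro d hd
      rcases List.mem_cons.1 hd with rfl | hd
      exacts [hc, hL d hd]

/-- The block decomposition of a tableau is unique, if there is a column `(a, bar a)`. -/
theorem block_unique {a a' : ℤ} {M M' : ℕ} {L L' R R' : List (ℤ × ℤ)}
    (h : L ++ List.replicate M (a, -a) ++ R = L' ++ List.replicate M' (a', -a') ++ R')
    (hL : ∀ c ∈ L, ¬ IsDiag c) (hR : ∀ c ∈ R, ¬ IsDiag c)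
    (hL' : ∀ c ∈ L', ¬ IsDiag c) (hR' : ∀ c ∈ R', ¬ IsDiag c) :
    M = M' ∧ (0 < M → a = a' ∧ L = L' ∧ R = R') := by
  have filt : ∀ (a : ℤ) (M : ℕ) (L R : List (ℤ × ℤ)), (∀ c ∈ L, ¬ IsDiag c) →
      (∀ c ∈ R, ¬ IsDiag c) → (L ++ List.replicate M (a, -a) ++ R).filter (fun c => IsDiag c) =
        List.replicate M (a, -a) := by
    intro a M L R hL hR
    have e1 : L.filter (fun c => IsDiag c) = [] :=
      List.filter_eq_nil_iff.2 fun c hc => by simpa using hL c hc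
    have e2 : R.filter (fun c => IsDiag c) = [] :=
      List.filter_eq_nil_iff.2 fun c hc => by simpa using hR c hc
    rw [List.filter_append, List.filter_append, e1, e2]
    simp
  have h1 := filt a M L R hL hR
  rw [h, filt a' M' L' R' hL' hR'] at h1
  have hM : M = M' := by simpa using (congrArg List.length h1).symm
  subst hM
  refine ⟨rfl, fun hM => ?_⟩
  obtain ⟨m, rfl⟩ : ∃ m, M = m + 1 := ⟨M - 1, by omega⟩
  have ha : a = a' := by
    simp only [List.replicate_succ, List.cons.injEq, Prod.mk.injEq] at h1
    exact h1.1.1.symm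
  subst ha
  have tw : ∀ L R : List (ℤ × ℤ), (∀ c ∈ L, ¬ IsDiag c) →
      (L ++ List.replicate (m + 1) (a, -a) ++ R).takeWhile (fun c => ¬ IsDiag c) = L := by
    intro L R hL
    rw [List.append_assoc, List.takeWhile_append_of_pos (by simpa using hL)]
    simp [List.replicate_succ]
  have h2 := tw L R hL
  rw [h, tw L' R' hL'] at h2
  subst h2
  refine ⟨rfl, rfl, ?_⟩
  simpa using h

/-- The column `(a, bar a)` is not allowed between `L` and `R` in a Kashiwara–Nakashima
tableau. -/
def Touches (a : ℤ) (L R : List (ℤ × ℤ)) : Prop :=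
  a = 1 ∨ (∃ b, L.getLast? = some (a, b)) ∨ (∃ d, R.head? = some (d, -a))

/-- A choice-free description of the drop map: in the block of columns `(a, bar a)`, all columns
are removed if none is allowed there, and all but one otherwise. -/
def Dropped (T t : List (ℤ × ℤ)) : Prop :=
  ∃ (a : ℤ) (M : ℕ) (L R : List (ℤ × ℤ)) (j : ℕ),
    T = L ++ List.replicate M (a, -a) ++ R ∧ t = L ++ List.replicate j (a, -a) ++ R ∧
    (∀ c ∈ L, ¬ IsDiag c) ∧ (∀ c ∈ R, ¬ IsDiag c) ∧
    (M = 0 ∧ j = 0 ∨ 0 < M ∧ (j = 0 ∧ Touches a L R ∨ j = 1 ∧ ¬ Touches a L R))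

theorem Dropped.unique {T t t' : List (ℤ × ℤ)} (h : Dropped T t) (h' : Dropped T t') :
    t = t' := by
  obtain ⟨a, M, L, R, j, rfl, rfl, hL, hR, hj⟩ := h
  obtain ⟨a', M', L', R', j', hT, rfl, hL', hR', hj'⟩ := h'
  obtain ⟨rfl, h2⟩ := block_unique hT hL hR hL' hR'
  rcases Nat.eq_zero_or_pos M with rfl | hM
  · obtain rfl : j = 0 := by omega
    obtain rfl : j' = 0 := by omega
    simpa using hT
  · obtain ⟨rfl, rfl, rfl⟩ := h2 hM
    have : j = j' := by
      rcases hj with ⟨h, _⟩ | ⟨-, ⟨rfl, h1⟩ | ⟨rfl, h1⟩⟩ <;>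
        rcases hj' with ⟨h', _⟩ | ⟨-, ⟨rfl, h2⟩ | ⟨rfl, h2⟩⟩ <;>
          first | rfl | omega | contradiction
    rw [this]

theorem IsTableau.exists_dropped {T : List (ℤ × ℤ)} (hT : IsTableau n T) : ∃ t, Dropped T t := by
  obtain ⟨a, M, L, R, rfl, hL, hR⟩ := hT.exists_block
  rcases Nat.eq_zero_or_pos M with rfl | hM
  · exact ⟨_, a, 0, L, R, 0, rfl, rfl, hL, hR, by simp⟩
  · by_cases ht : Touches a L R
    · exact ⟨_, a, M, L, R, 0, rfl, rfl, hL, hR, Or.inr ⟨hM, Or.inl ⟨rfl, ht⟩⟩⟩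
    · exact ⟨_, a, M, L, R, 1, rfl, rfl, hL, hR, Or.inr ⟨hM, Or.inr ⟨rfl, ht⟩⟩⟩

theorem isKN_of_forall_not_isDiag {t : List (ℤ × ℤ)} (ht : IsTableau n t)
    (h : ∀ c ∈ t, ¬ IsDiag c) : IsKN n t := by
  refine ⟨ht, List.Pairwise.isChain (List.pairwise_of_forall_mem_list ?_), fun h1 => h _ h1 rfl⟩
  intro c hc d hd
  refine ⟨fun h' => h d hd ?_, fun h' => h c hc h'.1⟩
  rw [h']

/-- A single column `(a, bar a)` that touches neither neighbour satisfies the conditions on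
Kashiwara–Nakashima tableaux. -/
theorem isKN_of_not_touches {a : ℤ} {L R : List (ℤ × ℤ)}
    (ht : IsTableau n (L ++ (a, -a) :: R)) (hL : ∀ c ∈ L, ¬ IsDiag c)
    (hR : ∀ c ∈ R, ¬ IsDiag c) (h : ¬ Touches a L R) : IsKN n (L ++ (a, -a) :: R) := by
  have h1 := (isKN_of_forall_not_isDiag (ht.sublist (by simp)) hL).noConfig
  have h2 := (isKN_of_forall_not_isDiag (t := R) (ht.sublist (by simp)) hR).noConfig
  simp only [Touches, not_or, not_exists] at h
  refine ⟨ht, ?_, ?_⟩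
  · rw [List.isChain_append, List.isChain_cons]
    refine ⟨h1, ⟨?_, h2⟩, ?_⟩
    · rintro ⟨x, y⟩ hd
      refine ⟨?_, fun h' => h.2.2 x ?_⟩
      · intro h'
        exact hR _ (List.mem_of_mem_head? hd) (by rw [h'])
      · have := h'.2
        simp only at this
        rw [← this]; exact hd
    · rintro ⟨x, y⟩ he d hd
      simp only [List.head?_cons, Option.mem_def, Option.some.injEq] at hd
      subst hd
      refine ⟨?_, fun h' => hL _ (List.mem_of_getLast? he) h'.1⟩
      intro h'
      simp only [Prod.mk.injEq] at h'
      rw [← h'.1] at he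
      exact h.2.1 y he
  · intro h'
    rcases List.mem_append.1 h' with h' | h'
    · exact hL _ h' rfl
    · rcases List.mem_cons.1 h' with h' | h'
      · simp at h'; exact h.1 h'.symm
      · exact hR _ h' rfl

theorem Dropped.isKN {T t : List (ℤ × ℤ)} (hT : IsTableau n T) (h : Dropped T t) : IsKN n t := by
  obtain ⟨a, M, L, R, j, rfl, rfl, hL, hR, hj⟩ := h
  have hsub : (L ++ List.replicate j (a, -a) ++ R).Sublist (L ++ List.replicate M (a, -a) ++ R) :=
    ((List.Sublist.refl L).append (List.replicate_sublist_replicate _ |>.2 (by omega))).append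
      (List.Sublist.refl R)
  have ht := hT.sublist hsub
  have h0 : j = 0 ∨ j = 1 ∧ ¬ Touches a L R := by tauto
  rcases h0 with rfl | ⟨rfl, h0⟩
  · refine isKN_of_forall_not_isDiag ht ?_
    intro c hc
    simp only [List.replicate_zero, List.append_nil, List.mem_append] at hc
    rcases hc with hc | hc
    exacts [hL c hc, hR c hc]
  · simp only [List.replicate_one, List.append_assoc, List.singleton_append] at ht ⊢
    exact isKN_of_not_touches ht hL hR h0

theorem Dropped.length_le {T t : List (ℤ × ℤ)} (h : Dropped T t) : t.length ≤ T.length := by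
  obtain ⟨a, M, L, R, j, rfl, rfl, hL, hR, hj⟩ := h
  simp
  omega

theorem eq_one_of_le_one {x : ℤ} (hx : IsLetter n x) (h : le n x 1) : x = 1 := by
  have h1 := hx.height_eq
  have h2 : height n 1 = 1 := by simp [height]
  unfold le at h
  omega

theorem eq_neg_one_of_neg_one_le {x : ℤ} (hx : IsLetter n x) (h : le n (-1) x) : x = -1 := by
  have h1 := hx.height_eq
  have h2 : height n (-1) = 2 * n - 1 := by simp [height]; ring
  unfold le at h
  omega

theorem IsKN.dropped_self {t : List (ℤ × ℤ)} (ht : IsKN n t) : Dropped t t := by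
  obtain ⟨a, M, L, R, rfl, hL, hR⟩ := ht.toIsTableau.exists_block
  refine ⟨a, M, L, R, M, rfl, rfl, hL, hR, ?_⟩
  have hcf := ht.noConfig
  match M with
  | 0 => simp
  | 1 =>
    refine Or.inr ⟨one_pos, Or.inr ⟨rfl, ?_⟩⟩
    simp only [List.replicate_one, List.append_assoc, List.singleton_append] at hcf
    rw [List.isChain_append, List.isChain_cons] at hcf
    rintro (rfl | ⟨b, hb⟩ | ⟨d, hd⟩)
    · exact ht.noOne (by simp)
    · exact (hcf.2.2 _ hb (a, -a) (by simp)).1 rfl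
    · exact (hcf.2.1.1 _ hd).2 ⟨rfl, rfl⟩
  | M + 2 =>
    exfalso
    simp only [List.replicate_succ, List.append_assoc, List.cons_append] at hcf
    rw [List.isChain_append, List.isChain_cons] at hcf
    exact (hcf.2.1.1 (a, -a) (by simp)).1 rfl

theorem RemovesConfig.dropped {T t : List (ℤ × ℤ)} (hT : IsTableau n T)
    (hne : ∀ s, T ≠ List.replicate s (1, -1)) (h : RemovesConfig n T t) : Dropped T t := by
  obtain ⟨a, m, L, R, -, hm, rfl, rfl, h⟩ := h
  have hLd : L.getLast? ≠ some (a, -a) → ∀ c ∈ L, ¬ IsDiag c := by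
    refine (not_isDiag_of_le (n := n) (R := List.replicate (m - 1) (a, -a) ++ R) ?_ rfl).1
    rwa [← List.cons_append, ← List.replicate_succ, Nat.sub_add_cancel hm, ← List.append_assoc]
  have hRd : R.head? ≠ some (a, -a) → ∀ c ∈ R, ¬ IsDiag c := by
    refine (not_isDiag_of_le (n := n) (L := L ++ List.replicate (m - 1) (a, -a)) ?_ rfl).2
    have e : L ++ List.replicate (m - 1) (a, -a) ++ (a, -a) :: R =
        L ++ List.replicate m (a, -a) ++ R := by
      obtain ⟨k, rfl⟩ : ∃ k, m = k + 1 := ⟨m - 1, by omega⟩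
      simp [List.replicate_succ']
    rwa [e]
  rcases h with ⟨⟨b, hb, hba⟩, hR⟩ | ⟨hL, d, hd, hda⟩ | ⟨R₁, rfl, h1, h2⟩
  · refine ⟨a, m, L, R, 0, rfl, by simp, hLd ?_, hRd hR, Or.inr ⟨hm, Or.inl ⟨rfl, ?_⟩⟩⟩
    · rw [hb]; simpa using hba
    · exact Or.inr (Or.inl ⟨b, hb⟩)
  · refine ⟨a, m, L, R, 0, rfl, by simp, hLd hL, hRd ?_, Or.inr ⟨hm, Or.inl ⟨rfl, ?_⟩⟩⟩
    · rw [hd]; simpa using hda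
    · exact Or.inr (Or.inr ⟨d, hd⟩)
  · have e : L ++ List.replicate m (a, -a) ++ (a, -a) :: R₁ =
        L ++ List.replicate (m + 1) (a, -a) ++ R₁ := by
      simp [List.replicate_succ']
    have hL : L.getLast? ≠ some (a, -a) := fun h => h1 _ h rfl
    have hR : R₁.head? ≠ some (a, -a) := fun h => h2 _ h rfl
    rw [e] at hT hne ⊢
    have hpw := hT.pairwise
    simp only [List.append_assoc, List.replicate_succ, List.cons_append] at hpw hT
    rw [List.pairwise_append, List.pairwise_cons] at hpw
    refine ⟨a, m + 1, L, R₁, 1, rfl, by simp, hLd hL, ?_,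
      Or.inr ⟨by omega, Or.inr ⟨rfl, ?_⟩⟩⟩
    · refine (not_isDiag_of_le (n := n) (L := L ++ List.replicate m (a, -a)) (x := (a, -a))
        ?_ rfl).2 hR
      have e' : L ++ List.replicate m (a, -a) ++ (a, -a) :: R₁ =
          L ++ (a, -a) :: (List.replicate m (a, -a) ++ R₁) := by
        rw [e, List.replicate_succ]; simp
      rwa [e']
    · rintro (rfl | ⟨b, hb⟩ | ⟨d, hd⟩)
      · apply hne (m + 1)
        obtain rfl : L = [] := by
          by_contra hLn
          have hl := List.getLast_mem hLn
          refine h1 _ (List.getLast?_eq_getLast_of_ne_nil hLn) ?_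
          exact eq_one_of_le_one (hT.letters _ (by simp [hl])).1
            (hpw.2.2 _ hl (1, -1) (by simp)).1
        obtain rfl : R₁ = [] := by
          cases R₁ with
          | nil => rfl
          | cons d R₁ =>
            exact absurd (eq_neg_one_of_neg_one_le (hT.letters d (by simp)).2
              (hpw.2.1.1 d (by simp)).2) (h2 d rfl)
        simp
      · exact h1 _ hb rfl
      · exact h2 _ hd rfl

theorem Dropped.removesConfig {T t : List (ℤ × ℤ)} (hT : IsTableau n T) (hKN : ¬ IsKN n T)
    (hne : ∀ s, T ≠ List.replicate s (1, -1)) (h : Dropped T t) : RemovesConfig n T t := by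
  have htKN := h.isKN hT
  obtain ⟨a, M, L, R, j, rfl, rfl, hL, hR, ⟨rfl, rfl⟩ | ⟨hM, ⟨rfl, ht⟩ | ⟨rfl, ht⟩⟩⟩ := h
  · exact absurd htKN hKN
  · have hmem : (a, -a) ∈ L ++ List.replicate M (a, -a) ++ R := by simp; omega
    refine ⟨a, M, L, R, hT.diag_range hmem, hM, rfl, by simp, ?_⟩
    have hLx : L.getLast? ≠ some (a, -a) := fun h => hL _ (List.mem_of_getLast? h) rfl
    have hRx : R.head? ≠ some (a, -a) := fun h => hR _ (List.mem_of_mem_head? h) rfl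
    have hl : (∃ b, L.getLast? = some (a, b)) → ∃ b, L.getLast? = some (a, b) ∧ b ≠ -a := by
      rintro ⟨b, hb⟩
      exact ⟨b, hb, fun h => hLx (by rw [hb, h])⟩
    have hr : (∃ d, R.head? = some (d, -a)) → ∃ d, R.head? = some (d, -a) ∧ d ≠ a := by
      rintro ⟨b, hb⟩
      exact ⟨b, hb, fun h => hRx (by rw [hb, h])⟩
    rcases ht with rfl | ht | ht
    · have hpw := hT.pairwise
      rw [List.append_assoc, List.pairwise_append, List.pairwise_append] at hpw
      by_cases hLn : L = []
      · subst hLn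
        cases R with
        | nil => exact absurd (by simp) (hne M)
        | cons d R =>
          refine Or.inr (Or.inl ⟨hLx, hr ⟨d.1, ?_⟩⟩)
          rw [List.head?_cons, ← eq_neg_one_of_neg_one_le (hT.letters d (by simp)).2
            (hpw.2.1.2.2 (1, -1) (by simp; omega) d (by simp)).2]
      · refine Or.inl ⟨hl ⟨(L.getLast hLn).2, ?_⟩, hRx⟩
        have hl := List.getLast_mem hLn
        rw [List.getLast?_eq_getLast_of_ne_nil hLn,
          ← eq_one_of_le_one (hT.letters _ (by simp [hl])).1
            (hpw.2.2 _ hl (1, -1) (by simp; omega)).1]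
    · exact Or.inl ⟨hl ht, hRx⟩
    · exact Or.inr (Or.inl ⟨hLx, hr ht⟩)
  · have hmem : (a, -a) ∈ L ++ List.replicate M (a, -a) ++ R := by simp; omega
    obtain ⟨m, rfl⟩ : ∃ m, M = m + 1 := ⟨M - 1, by omega⟩
    have hm : 0 < m := by
      rcases Nat.eq_zero_or_pos m with rfl | hm
      · exact absurd htKN hKN
      · exact hm
    refine ⟨a, m, L, (a, -a) :: R, hT.diag_range hmem, hm, by simp [List.replicate_succ'],
      by simp, Or.inr (Or.inr ⟨R, rfl, ?_, ?_⟩)⟩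
    · rintro ⟨x, y⟩ hc rfl
      exact ht (Or.inr (Or.inl ⟨y, hc⟩))
    · rintro ⟨x, y⟩ hc h
      simp only at h
      exact ht (Or.inr (Or.inr ⟨x, by rw [hc, h]⟩))

/-- The drop map is given by `Dropped`. -/
theorem drop_eq_of_dropped {s : ℕ} {T : Tab n s} {t : List (ℤ × ℤ)} (h : Dropped T.1 t) :
    drop T = t := by
  obtain ⟨T, hs, hT⟩ := T
  simp only at h
  unfold drop
  simp only
  split_ifs with h1 h2 h3
  · exact h1.dropped_self.unique h
  · subst h2
    have hpos : 0 < s := by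
      rcases Nat.eq_zero_or_pos s with rfl | hs
      · exact absurd (isKN_of_forall_not_isDiag hT (by simp)) h1
      · exact hs
    refine Dropped.unique (T := List.replicate s (1, -1)) ?_ h
    exact ⟨1, s, [], [], 0, by simp, by simp, by simp, by simp,
      Or.inr ⟨hpos, Or.inl ⟨rfl, Or.inl rfl⟩⟩⟩
  · have hne : ∀ s, T ≠ List.replicate s (1, -1) := by
      rintro s' rfl
      simp only [List.length_replicate] at hs
      exact h2 (by rw [hs])
    exact (h3.choose_spec.dropped hT hne).unique h
  · have hne : ∀ s, T ≠ List.replicate s (1, -1) := by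
      rintro s' rfl
      simp only [List.length_replicate] at hs
      exact h2 (by rw [hs])
    exact absurd ⟨_, h.removesConfig hT h1 hne⟩ h3

theorem dropped_drop {s : ℕ} (T : Tab n s) : Dropped T.1 (drop T) := by
  obtain ⟨t, ht⟩ := T.2.2.exists_dropped
  rwa [drop_eq_of_dropped ht]

theorem isKN_drop {s : ℕ} (T : Tab n s) : IsKN n (drop T) := (dropped_drop T).isKN T.2.2

theorem length_drop_le {s : ℕ} (T : Tab n s) : (drop T).length ≤ s := by
  have := (dropped_drop T).length_le
  rwa [T.2.1] at this

/-- A column `(a, bar a)` inserted at two places of an array without such columns: the two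
arrays cannot both be tableaux. -/
theorem eq_nil_of_insert_of_insert {a a' : ℤ} {m m' : ℕ} {L N R' : List (ℤ × ℤ)} (hm : 0 < m)
    (hm' : 0 < m')
    (h1 : IsTableau n (L ++ List.replicate m (a, -a) ++ (N ++ R')))
    (h2 : IsTableau n (L ++ N ++ List.replicate m' (a', -a') ++ R'))
    (hN : ∀ c ∈ N, ¬ IsDiag c) : N = [] := by
  by_contra hne
  obtain ⟨e, N, rfl⟩ := List.exists_cons_of_ne_nil hne
  have p1 := h1.pairwise
  have p2 := h2.pairwise
  rw [List.append_assoc, List.pairwise_append, List.pairwise_append] at p1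
  rw [List.append_assoc, List.pairwise_append] at p2
  have q1 := p1.2.1.2.2 (a, -a) (by simp; omega) e (by simp)
  have q2 := p2.2.2 e (by simp) (a', -a') (by simp; omega)
  have l1 := h1.letters (a, -a) (by simp; omega)
  have l2 := h2.letters (a', -a') (by simp; omega)
  have q3 := le_neg_neg l1.2 l2.2 (le_trans q1.2 q2.2)
  simp only [neg_neg] at q3
  obtain rfl := le_antisymm (le_trans q1.1 q2.1) q3
  refine hN e (by simp) ?_
  rw [IsDiag, ← le_antisymm q1.1 q2.1, ← le_antisymm q1.2 q2.2]

/-- At a given place, only one kind of columns `(a, bar a)` that touch a neighbour can be inserted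
so that the result is a tableau. -/
theorem touches_unique {a a' : ℤ} {m m' : ℕ} {L R : List (ℤ × ℤ)} (hm : 0 < m) (hm' : 0 < m')
    (h1 : IsTableau n (L ++ List.replicate m (a, -a) ++ R))
    (h2 : IsTableau n (L ++ List.replicate m' (a', -a') ++ R))
    (t1 : Touches a L R) (t2 : Touches a' L R) : a = a' := by
  have key : ∀ {a a' : ℤ} {m m' : ℕ}, 0 < m → 0 < m' →
      IsTableau n (L ++ List.replicate m (a, -a) ++ R) →
      IsTableau n (L ++ List.replicate m' (a', -a') ++ R) →
      (∃ b, L.getLast? = some (a, b)) → (∃ d, R.head? = some (d, -a')) → a = a' := by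
    rintro a a' m m' hm hm' h1 h2 ⟨b, hb⟩ ⟨d, hd⟩
    have p1 := h1.pairwise
    have p2 := h2.pairwise
    rw [List.append_assoc, List.pairwise_append, List.pairwise_append] at p1 p2
    have q1 := p1.2.1.2.2 (a, -a) (by simp; omega) _ (List.mem_of_mem_head? hd)
    have q2 := p2.2.2 _ (List.mem_of_getLast? hb) (a', -a') (by simp; omega)
    have l1 := h1.letters (a, -a) (by simp; omega)
    have l2 := h2.letters (a', -a') (by simp; omega)
    have q3 := le_neg_neg l1.2 l2.2 q1.2
    simp only [neg_neg] at q3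
    exact le_antisymm q2.1 q3
  have one : ∀ {a : ℤ} {m : ℕ}, 0 < m → IsTableau n (L ++ List.replicate m (a, -a) ++ R) →
      Touches a L R →
      (L = [] ∧ R = [] ∧ a = 1) ∨ (∃ b, L.getLast? = some (a, b)) ∨
        (∃ d, R.head? = some (d, -a)) := by
    rintro a m hm hT (rfl | ht)
    · have hpw := hT.pairwise
      rw [List.append_assoc, List.pairwise_append, List.pairwise_append] at hpw
      by_cases hLn : L = []
      · subst hLn
        cases R with
        | nil => exact Or.inl ⟨rfl, rfl, rfl⟩
        | cons d R =>
          refine Or.inr (Or.inr ⟨d.1, ?_⟩)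
          rw [List.head?_cons, ← eq_neg_one_of_neg_one_le (hT.letters d (by simp)).2
            (hpw.2.1.2.2 (1, -1) (by simp; omega) d (by simp)).2]
      · refine Or.inr (Or.inl ⟨(L.getLast hLn).2, ?_⟩)
        have hl := List.getLast_mem hLn
        rw [List.getLast?_eq_getLast_of_ne_nil hLn,
          ← eq_one_of_le_one (hT.letters _ (by simp [hl])).1
            (hpw.2.2 _ hl (1, -1) (by simp; omega)).1]
    · exact Or.inr ht
  rcases one hm h1 t1 with ⟨rfl, rfl, rfl⟩ | t1 | t1 <;>
    rcases one hm' h2 t2 with ⟨h, h', rfl⟩ | t2 | t2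
  · rfl
  · simp at t2
  · simp at t2
  · subst h; simp at t1
  · obtain ⟨b, hb⟩ := t1
    obtain ⟨b', hb'⟩ := t2
    rw [hb] at hb'
    simp at hb'
    exact hb'.1
  · exact key hm hm' h1 h2 t1 t2
  · subst h'; simp at t1
  · exact (key hm' hm h2 h1 t2 t1).symm
  · obtain ⟨b, hb⟩ := t1
    obtain ⟨b', hb'⟩ := t2
    rw [hb] at hb'
    simp at hb'
    exact hb'.2

/-- A tableau is recovered from its image: if the image contains a column `(a, bar a)`, then this
column is repeated, and otherwise the place and the kind of the inserted columns are forced. -/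
theorem drop_injective {s : ℕ} : Function.Injective (drop : Tab n s → List (ℤ × ℤ)) := by
  intro T T' h
  have d := dropped_drop T
  have d' := dropped_drop T'
  rw [← h] at d'
  clear h
  generalize drop T = t at d d'
  obtain ⟨T, hs, hT⟩ := T
  obtain ⟨T', hs', hT'⟩ := T'
  apply Subtype.ext
  simp only at d d' ⊢
  obtain ⟨a, M, L, R, j, rfl, rfl, hL, hR, hj⟩ := d
  obtain ⟨a', M', L', R', j', rfl, ht, hL', hR', hj'⟩ := d'
  obtain ⟨rfl, hu⟩ := block_unique ht hL hR hL' hR'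
  have hlen := congrArg List.length ht
  simp only [List.length_append, List.length_replicate] at hs hs' hlen
  obtain rfl : M = M' := by omega
  rcases Nat.eq_zero_or_pos j with rfl | hj0
  -- the image contains no column `(a, bar a)`: compare the two places of insertion
  · rcases hj with ⟨rfl, -⟩ | ⟨hM, hj⟩
    · simpa using ht
    · have t1 : Touches a L R := by simpa using hj
      have t2 : Touches a' L' R' := by
        rcases hj' with h | h
        · omega
        · simpa using h.2
      simp only [List.replicate_zero, List.append_nil] at ht
      rcases List.append_eq_append_iff.1 ht with ⟨N, rfl, rfl⟩ | ⟨N, rfl, rfl⟩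
      · obtain rfl := eq_nil_of_insert_of_insert hM hM hT hT' (fun c hc => hR c (by simp [hc]))
        simp only [List.nil_append, List.append_nil] at hT hT' t1 t2 ⊢
        rw [touches_unique hM hM hT hT' t1 t2]
      · obtain rfl := eq_nil_of_insert_of_insert hM hM hT' hT (fun c hc => hL c (by simp [hc]))
        simp only [List.nil_append, List.append_nil] at hT hT' t1 t2 ⊢
        rw [touches_unique hM hM hT hT' t1 t2]
  · obtain ⟨rfl, rfl, rfl⟩ := hu hj0
    rfl

/-- Removing an inserted block `(a, bar a)^m` that touches one of its neighbours is an instance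
of the removal of a configuration. -/
theorem removesConfig_of_insert {a : ℤ} {m : ℕ} {L R : List (ℤ × ℤ)} (hm : 0 < m)
    (ht : IsKN n (L ++ R)) (hT : IsTableau n (L ++ List.replicate m (a, -a) ++ R))
    (h : (∃ b, L.getLast? = some (a, b)) ∨ (∃ d, R.head? = some (d, -a))) :
    RemovesConfig n (L ++ List.replicate m (a, -a) ++ R) (L ++ R) := by
  have hmem : (a, -a) ∈ L ++ List.replicate m (a, -a) ++ R := by simp; omega
  have hr := hT.diag_range hmem
  have hcf := ht.noConfig
  rcases h with ⟨b, hb⟩ | ⟨d, hd⟩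
  · by_cases hba : b = -a
    · subst hba
      obtain ⟨L', rfl⟩ := List.getLast?_eq_some_iff.1 hb
      refine ⟨a, m, L', (a, -a) :: R, hr, hm, ?_, by simp,
        Or.inr (Or.inr ⟨R, rfl, ?_, ?_⟩)⟩
      · simp only [List.append_assoc, List.append_cancel_left_eq, List.singleton_append]
        rw [← List.replicate_succ, List.replicate_succ']
        simp
      · intro c hc h
        simp only [List.append_assoc, List.singleton_append] at hcf
        rw [List.isChain_append] at hcf
        exact (hcf.2.2 c hc (a, -a) (by simp)).1 (by rw [h])
      · intro c hc h
        rw [List.isChain_append] at hcf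
        exact (hcf.2.2 (a, -a) (by simp) c hc).2 ⟨rfl, h⟩
    · refine ⟨a, m, L, R, hr, hm, rfl, rfl, Or.inl ⟨⟨b, hb, hba⟩, fun h => ?_⟩⟩
      rw [List.isChain_append] at hcf
      exact (hcf.2.2 _ hb _ h).1 rfl
  · by_cases hda : d = a
    · subst hda
      obtain ⟨R', rfl⟩ := List.head?_eq_some_iff.1 hd
      refine ⟨d, m, L, (d, -d) :: R', hr, hm, rfl, rfl,
        Or.inr (Or.inr ⟨R', rfl, ?_, ?_⟩)⟩
      · intro c hc h
        rw [List.isChain_append] at hcf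
        exact (hcf.2.2 c hc (d, -d) (by simp)).1 (by rw [h])
      · intro c hc h
        rw [List.isChain_append, List.isChain_cons] at hcf
        exact (hcf.2.1.1 c hc).2 ⟨rfl, h⟩
    · refine ⟨a, m, L, R, hr, hm, rfl, rfl, Or.inr (Or.inl ⟨fun h => ?_, d, hd, hda⟩)⟩
      rw [List.isChain_append] at hcf
      exact (hcf.2.2 _ h _ hd).2 ⟨rfl, rfl⟩

/-- Filling is undone by dropping. -/
theorem IsFilling.dropped {s : ℕ} {t T : List (ℤ × ℤ)} (ht : IsKN n t) (hT : IsTableau n T)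
    (hs : T.length = s) (h : IsFilling n s t T) : Dropped T t := by
  have ins : ∀ {a : ℤ} {m : ℕ} {L R : List (ℤ × ℤ)}, 0 < m → t = L ++ R →
      T = L ++ List.replicate m (a, -a) ++ R →
      ((∃ b, L.getLast? = some (a, b)) ∨ (∃ d, R.head? = some (d, -a))) → Dropped T t := by
    rintro a m L R hm rfl rfl h
    refine (removesConfig_of_insert hm ht hT h).dropped hT fun s' hs' => ?_
    apply ht.noOne
    have hall := (List.eq_replicate_iff.1 hs').2
    rcases h with ⟨b, hb⟩ | ⟨d, hd⟩
    · have hmem := List.mem_of_getLast? hb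
      rw [← hall (a, b) (by simp [hmem])]
      simp [hmem]
    · have hmem := List.mem_of_mem_head? hd
      rw [← hall (d, -a) (by simp [hmem])]
      simp [hmem]
  rcases h with ⟨-, rfl⟩ | ⟨h1, rfl, rfl⟩ |
    ⟨h1, L, c, d, R, h2, ⟨-, h3⟩ | ⟨-, h3⟩⟩ | ⟨h1, -, -, -, ⟨c, h2, h3⟩ | ⟨d, h2, h3⟩⟩
  · exact ht.dropped_self
  · exact ⟨1, s, [], [], 0, by simp, by simp, by simp, by simp,
      Or.inr ⟨h1, Or.inl ⟨rfl, Or.inl rfl⟩⟩⟩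
  · exact ins (a := c.1) (m := s - t.length) (L := L ++ [c]) (R := d :: R) (by omega)
      (by simp [h2]) (by simp [h3]) (Or.inl ⟨c.2, by simp⟩)
  · exact ins (a := -d.2) (m := s - t.length) (L := L ++ [c]) (R := d :: R) (by omega)
      (by simp [h2]) (by simp [h3]) (Or.inr ⟨d.1, by simp⟩)
  · exact ins (a := c.1) (m := s - t.length) (L := t) (R := []) (by omega)
      (by simp) (by simp [h3]) (Or.inl ⟨c.2, by simp [h2]⟩)
  · exact ins (a := -d.2) (m := s - t.length) (L := []) (R := t) (by omega)
      (by simp) (by simp [h3]) (Or.inr ⟨d.1, by simp [h2]⟩)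

/-- Insertion of columns `(a, bar a)` into a tableau. -/
theorem IsTableau.insert {a : ℤ} {m : ℕ} {L R : List (ℤ × ℤ)} (hn : 2 ≤ n)
    (ht : IsTableau n (L ++ R)) (ha : IsLetter n a) (hcol : ¬ le n (-a) a)
    (hL : ∀ c ∈ L.getLast?, ColLe n c (a, -a)) (hR : ∀ d ∈ R.head?, ColLe n (a, -a) d) :
    IsTableau n (L ++ List.replicate m (a, -a) ++ R) := by
  have hL' : ∀ c ∈ L, ColLe n c (a, -a) := by
    intro c hc
    obtain ⟨L', e, rfl⟩ := List.eq_nil_or_concat' L |>.resolve_left (by rintro rfl; simp at hc)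
    have h1 := hL e (by simp)
    rcases List.mem_append.1 hc with hc | hc
    · have hpw := ht.pairwise
      rw [List.append_assoc, List.pairwise_append] at hpw
      have h2 := hpw.2.2 c hc e (by simp)
      exact ⟨le_trans h2.1 h1.1, le_trans h2.2 h1.2⟩
    · simp at hc; rwa [hc]
  have hR' : ∀ c ∈ R, ColLe n (a, -a) c := by
    intro c hc
    cases R with
    | nil => simp at hc
    | cons e R =>
      have h1 := hR e (by simp)
      rcases List.mem_cons.1 hc with rfl | hc
      · exact h1
      · have hpw := ht.pairwise
        rw [List.pairwise_append, List.pairwise_cons] at hpw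
        have h2 := hpw.2.1.1 c hc
        exact ⟨le_trans h1.1 h2.1, le_trans h1.2 h2.2⟩
  have hpw := ht.pairwise
  have hmd := ht.middle
  rw [List.pairwise_append] at hpw hmd
  have m1 : ∀ c, MiddleFree n c (a, -a) := by
    rintro ⟨x, y⟩
    simp only [MiddleFree, Prod.mk.injEq]
    omega
  have m2 : ∀ d, MiddleFree n (a, -a) d := by
    rintro ⟨x, y⟩
    simp only [MiddleFree, Prod.mk.injEq]
    omega
  have hmem : ∀ c ∈ L ++ List.replicate m (a, -a) ++ R, c ∈ L ++ R ∨ c = (a, -a) := by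
    intro c hc
    simp only [List.mem_append, List.mem_replicate] at hc ⊢
    tauto
  refine isTableau_of_pairwise ?_ ?_ ?_ ?_
  · intro c hc
    rcases hmem c hc with hc | rfl
    · exact ht.letters c hc
    · exact ⟨ha, ha.neg⟩
  · rw [List.append_assoc, List.pairwise_append, List.pairwise_append]
    refine ⟨hpw.1, ⟨List.pairwise_replicate.2 (Or.inr ⟨le_refl _, le_refl _⟩), hpw.2.1, ?_⟩, ?_⟩
    · intro c hc d hd
      rw [(List.mem_replicate.1 hc).2]
      exact hR' d hd
    · intro c hc d hd
      rcases List.mem_append.1 hd with hd | hd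
      · rw [(List.mem_replicate.1 hd).2]
        exact hL' c hc
      · exact hpw.2.2 c hc d hd
  · intro c hc
    rcases hmem c hc with hc | rfl
    · exact ht.columns c hc
    · exact hcol
  · rw [List.append_assoc, List.pairwise_append, List.pairwise_append]
    refine ⟨hmd.1, ⟨List.pairwise_replicate.2 (Or.inr (m1 _)), hmd.2.1, ?_⟩, ?_⟩
    · intro c hc d hd
      rw [(List.mem_replicate.1 hc).2]
      exact m2 d
    · intro c hc d hd
      rcases List.mem_append.1 hd with hd | hd
      · rw [(List.mem_replicate.1 hd).2]
        exact m1 c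
      · exact hmd.2.2 c hc d hd

/-- The entries of a column, after barring the bottom one, are comparable. -/
theorem le_neg_or_neg_le {a b : ℤ} (ha : IsLetter n a) (hb : IsLetter n b) (h : ¬ le n b a) :
    le n b (-a) ∨ le n (-b) a := by
  have h1 := ha.height_eq
  have h2 := hb.height_eq
  have h3 := ha.neg.height_eq
  have h4 := hb.neg.height_eq
  unfold le at *
  omega

/-- Between a column with `b ≤ bar a` and one with `bar b' ≤ a'` there is a place to fill. -/
theorem fillsLeft_or_fillsRight {c d : ℤ × ℤ} (hc : IsLetter n c.1 ∧ IsLetter n c.2)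
    (hd : IsLetter n d.1 ∧ IsLetter n d.2) (kc : ¬ le n c.2 c.1) (h : ColLe n c d)
    (h1 : le n c.2 (-c.1)) (h2 : le n (-d.2) d.1) : FillsLeft n c d ∨ FillsRight n c d := by
  have e : le n c.1 (-d.2) ∨ le n (-c.1) d.2 := by
    have z1 := hc.1.height_eq
    have z2 := hc.2.height_eq
    have z3 := hd.2.height_eq
    have z4 := hc.1.neg.height_eq
    have z5 := hd.2.neg.height_eq
    have h3 := h.2
    clear h h2 hc hd
    unfold le at *
    omega
  rcases e with e | e
  · exact Or.inr ⟨e, h2⟩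
  · exact Or.inl ⟨h1, e⟩

/-- Every Kashiwara–Nakashima tableau with at most `s` columns can be filled. Every column has
`b ≤ bar a` or `bar b ≤ a`; where adjacent columns change from the first kind to the second, there
is a place to fill. Otherwise the first or the last column can be used. -/
theorem exists_isFilling (hn : 2 ≤ n) {s : ℕ} {t : List (ℤ × ℤ)} (ht : IsKN n t)
    (hs : t.length ≤ s) : ∃ T, T.length = s ∧ IsTableau n T ∧ IsFilling n s t T := by
  rcases hs.eq_or_lt with hs | hs
  · exact ⟨t, hs, ht.toIsTableau, Or.inl ⟨hs, rfl⟩⟩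
  by_cases htn : t = []
  · subst htn
    refine ⟨List.replicate s (1, -1), by simp, ?_, Or.inr (Or.inl ⟨hs, rfl, rfl⟩)⟩
    have := IsTableau.insert (a := 1) (m := s) (L := []) (R := []) hn
      (by simpa using ht.toIsTableau)
      (by rw [isLetter_iff]; omega) ?_ (by simp) (by simp)
    · simpa using this
    · have e1 : height n 1 = 1 := by simp [height]
      have e2 : height n (-1) = 2 * n - 1 := by simp [height]; ring
      unfold le
      rw [e1, e2]
      omega
  -- insertion of columns to the right of `c`, respectively to the left of `d`
  have insL : ∀ {L R : List (ℤ × ℤ)} {c : ℤ × ℤ}, t = L ++ c :: R → le n c.2 (-c.1) →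
      (∀ d ∈ R.head?, le n (-c.1) d.2) →
      IsTableau n (L ++ [c] ++ List.replicate (s - t.length) (c.1, -c.1) ++ R) := by
    rintro L R c rfl h1 h2
    have hc : c ∈ L ++ c :: R := by simp
    refine IsTableau.insert hn (by simpa using ht.toIsTableau) (ht.letters c hc).1 ?_ ?_ ?_
    · exact fun h => ht.columns c hc (le_trans h1 h)
    · intro e he
      simp only [List.getLast?_concat, Option.mem_def, Option.some.injEq] at he
      subst he
      exact ⟨le_refl _, h1⟩
    · intro d hd
      refine ⟨?_, h2 d hd⟩
      have hpw := ht.pairwise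
      rw [List.pairwise_append, List.pairwise_cons] at hpw
      exact (hpw.2.1.1 d (List.mem_of_mem_head? hd)).1
  have insR : ∀ {L R : List (ℤ × ℤ)} {d : ℤ × ℤ}, t = L ++ d :: R → le n (-d.2) d.1 →
      (∀ c ∈ L.getLast?, le n c.1 (-d.2)) →
      IsTableau n (L ++ List.replicate (s - t.length) (-d.2, d.2) ++ d :: R) := by
    rintro L R d rfl h1 h2
    have hd : d ∈ L ++ d :: R := by simp
    have := IsTableau.insert (a := -d.2) (m := s - (L ++ d :: R).length) hn
      ht.toIsTableau (ht.letters d hd).2.neg ?_ ?_ ?_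
    · simpa using this
    · rw [neg_neg]
      exact fun h => ht.columns d hd (le_trans h h1)
    · intro e he
      rw [neg_neg]
      refine ⟨h2 e he, ?_⟩
      have hpw := ht.pairwise
      rw [List.pairwise_append, List.pairwise_cons] at hpw
      exact (hpw.2.2 e (List.mem_of_getLast? he) d (by simp)).2
    · intro e he
      simp only [List.head?_cons, Option.mem_def, Option.some.injEq] at he
      subst he
      rw [neg_neg]
      exact ⟨h1, le_refl _⟩
  by_cases hadj : ∃ L c d R, t = L ++ c :: d :: R ∧ (FillsLeft n c d ∨ FillsRight n c d)
  · obtain ⟨L, c, d, R, h, hf⟩ := hadj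
    rcases hf with hf | hf
    · refine ⟨_, ?_, insL h hf.1 (by simpa using hf.2),
        Or.inr (Or.inr (Or.inl ⟨hs, L, c, d, R, h, Or.inl ⟨hf, by simp⟩⟩))⟩
      have hl := congrArg List.length h
      simp at hl ⊢
      omega
    · refine ⟨_, ?_, insR (L := L ++ [c]) (R := R) (by simp [h]) hf.2 (by simpa using hf.1),
        Or.inr (Or.inr (Or.inl ⟨hs, L, c, d, R, h, Or.inr ⟨hf, by simp⟩⟩))⟩
      have hl := congrArg List.length h
      simp at hl ⊢
      omega
  have hadj' : ∀ L c d R, t = L ++ c :: d :: R → ¬ FillsLeft n c d ∧ ¬ FillsRight n c d := by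
    intro L c d R h
    exact not_or.1 fun h' => hadj ⟨L, c, d, R, h, h'⟩
  have hm : 0 < s - t.length := by omega
  -- if the first column has `b ≤ bar a`, then so do all columns
  have hprop : ∀ L R : List (ℤ × ℤ), t = L ++ R → (∀ c ∈ t.head?, le n c.2 (-c.1)) →
      ∀ c ∈ L.getLast?, le n c.2 (-c.1) := by
    intro L
    induction L using List.reverseRecOn with
    | nil => simp
    | append_singleton L d ih =>
      intro R h h0 e he
      simp only [List.getLast?_concat, Option.mem_def, Option.some.injEq] at he
      subst he
      rcases List.eq_nil_or_concat' L with rfl | ⟨L, c, rfl⟩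
      · exact h0 d (by simp [h])
      · have hc := ih (d :: R) (by simp [h]) h0 c (by simp)
        have hct : c ∈ t := by simp [h]
        have hdt : d ∈ t := by simp [h]
        rcases le_neg_or_neg_le (ht.letters d hdt).1 (ht.letters d hdt).2 (ht.columns d hdt) with
          h1 | h1
        · exact h1
        · have hpw := ht.pairwise
          rw [h, List.append_assoc, List.pairwise_append] at hpw
          have := hadj' L c d R (by simp [h])
          exact absurd (fillsLeft_or_fillsRight (ht.letters c hct) (ht.letters d hdt)
            (ht.columns c hct) (hpw.2.2 c (by simp) d (by simp)) hc h1) (not_or.2 this)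
  obtain ⟨c, R, rfl⟩ := List.exists_cons_of_ne_nil htn
  rcases le_neg_or_neg_le (ht.letters c (by simp)).1 (ht.letters c (by simp)).2
    (ht.columns c (by simp)) with h1 | h1
  · obtain ⟨L, e, he⟩ := List.eq_nil_or_concat' (c :: R) |>.resolve_left htn
    have h2 := hprop (c :: R) [] (by simp) (by simpa using h1) e (by simp [he])
    have hT := insL (R := []) he h2 (by simp)
    rw [← he] at hT
    simp only [List.append_nil] at hT
    refine ⟨_, ?_, hT, Or.inr (Or.inr (Or.inr ⟨hs, hadj', hT, ?_, Or.inl ⟨e, by simp [he], rfl⟩⟩))⟩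
    · simp at hs ⊢; omega
    · intro hKN
      have hcf := hKN.noConfig
      obtain ⟨m, hm'⟩ : ∃ m, s - (c :: R).length = m + 1 := ⟨s - (c :: R).length - 1, by omega⟩
      rw [List.isChain_append, hm'] at hcf
      exact (hcf.2.2 e (by simp [he]) (e.1, -e.1) (by simp [List.replicate_succ])).1 rfl
  · have hT := insR (L := []) (R := R) rfl h1 (by simp)
    simp only [List.nil_append] at hT
    refine ⟨_, ?_, hT, Or.inr (Or.inr (Or.inr ⟨hs, hadj', hT, ?_, Or.inr ⟨c, rfl, rfl⟩⟩))⟩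
    · simp at hs ⊢; omega
    · intro hKN
      have hcf := hKN.noConfig
      rw [List.isChain_append] at hcf
      refine (hcf.2.2 (-c.2, c.2) ?_ c (by simp)).2 ⟨by simp, by simp⟩
      obtain ⟨m, hm'⟩ : ∃ m, s - (c :: R).length = m + 1 := ⟨s - (c :: R).length - 1, by omega⟩
      rw [hm', List.replicate_succ']
      simp

/-- On the Kashiwara–Nakashima tableaux with at most `s` columns, the fill map is defined and
inverse to the drop map. -/
theorem fill_eq_some_iff (hn : 2 ≤ n) {s : ℕ} {t : List (ℤ × ℤ)} (ht : IsKN n t)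
    (hs : t.length ≤ s) {T : Tab n s} : fill n s t = some T ↔ drop T = t := by
  obtain ⟨T', hT', hT'', hfill⟩ := exists_isFilling hn ht hs
  have hex : ∃ T : Tab n s, IsFilling n s t T.1 := ⟨⟨T', hT', hT''⟩, hfill⟩
  have hspec := hex.choose_spec.dropped ht hex.choose.2.2 hex.choose.2.1
  have h2 := drop_eq_of_dropped hspec
  rw [fill, dif_pos hex, Option.some.injEq]
  constructor
  · rintro rfl; exact h2
  · intro h; exact drop_injective (h2.trans h.symm)

theorem exists_drop_eq (hn : 2 ≤ n) {s : ℕ} {t : List (ℤ × ℤ)} (ht : IsKN n t)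
    (hs : t.length ≤ s) : ∃ T : Tab n s, drop T = t := by
  obtain ⟨T', hT', hT'', hfill⟩ := exists_isFilling hn ht hs
  exact ⟨⟨T', hT', hT''⟩, drop_eq_of_dropped (hfill.dropped ht hT'' hT')⟩

end Drop

/-! ### The classical crystal structure and the branching components -/

section Classical

variable {n s i : ℕ}

theorem classicalF_eq_some_iff (hn : 4 ≤ n) (hi : 1 ≤ i) (hin : i ≤ n) {T T' : Tab n s} :
    classicalF i T = some T' ↔ tabF n i (drop T) = some (drop T') := by
  have key : ∀ t, tabF n i (drop T) = some t → (fill n s t = some T' ↔ drop T' = t) := fun t h =>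
    fill_eq_some_iff (by omega) ((isKN_drop T).tabF hn hi hin h)
      ((length_of_tabF (by omega) hi hin h).trans_le (length_drop_le T))
  rw [classicalF, Option.bind_eq_some_iff]
  constructor
  · rintro ⟨t, h1, h2⟩
    rw [h1, (key t h1).1 h2]
  · intro h
    exact ⟨_, h, (key _ h).2 rfl⟩

theorem classicalE_eq_some_iff_tabE (hn : 4 ≤ n) (hi : 1 ≤ i) (hin : i ≤ n) {T T' : Tab n s} :
    classicalE i T = some T' ↔ tabE n i (drop T) = some (drop T') := by
  have key : ∀ t, tabE n i (drop T) = some t → (fill n s t = some T' ↔ drop T' = t) := fun t h =>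
    fill_eq_some_iff (by omega) ((isKN_drop T).tabE hn hi hin h)
      ((length_of_tabF (by omega) hi hin ((tabE_eq_some_iff (by omega) hi hin).1 h)).symm.trans_le
        (length_drop_le T))
  rw [classicalE, Option.bind_eq_some_iff]
  constructor
  · rintro ⟨t, h1, h2⟩
    rw [h1, (key t h1).1 h2]
  · intro h
    exact ⟨_, h, (key _ h).2 rfl⟩

theorem classicalE_eq_some_iff (hn : 4 ≤ n) (hi : 1 ≤ i) (hin : i ≤ n) {T T' : Tab n s} :
    classicalE i T' = some T ↔ classicalF i T = some T' := by
  rw [classicalE_eq_some_iff_tabE hn hi hin, classicalF_eq_some_iff hn hi hin,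
    tabE_eq_some_iff (by omega) hi hin]

theorem classicalF_eq_none_iff (hn : 4 ≤ n) (hi : 1 ≤ i) (hin : i ≤ n) {T : Tab n s} :
    classicalF i T = none ↔ wordF n i (columnWord (drop T)) = none := by
  rw [← tabF_eq_none_iff]
  constructor
  · intro h
    by_contra h'
    obtain ⟨t, ht⟩ := Option.ne_none_iff_exists'.1 h'
    obtain ⟨T', rfl⟩ := exists_drop_eq (s := s) (by omega) ((isKN_drop T).tabF hn hi hin ht)
      ((length_of_tabF (by omega) hi hin ht).trans_le (length_drop_le T))
    rw [(classicalF_eq_some_iff hn hi hin).2 ht] at h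
    exact absurd h (by simp)
  · intro h
    rw [classicalF, h, Option.bind_none]

theorem classicalE_eq_none_iff (hn : 4 ≤ n) (hi : 1 ≤ i) (hin : i ≤ n) {T : Tab n s} :
    classicalE i T = none ↔ wordE n i (columnWord (drop T)) = none := by
  rw [← tabE_eq_none_iff]
  constructor
  · intro h
    by_contra h'
    obtain ⟨t, ht⟩ := Option.ne_none_iff_exists'.1 h'
    obtain ⟨T', rfl⟩ := exists_drop_eq (s := s) (by omega) ((isKN_drop T).tabE hn hi hin ht)
      ((length_of_tabF (by omega) hi hin
        ((tabE_eq_some_iff (by omega) hi hin).1 ht)).symm.trans_le (length_drop_le T))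
    rw [(classicalE_eq_some_iff_tabE hn hi hin).2 ht] at h
    exact absurd h (by simp)
  · intro h
    rw [classicalE, h, Option.bind_none]

theorem length_drop_of_classicalF (hn : 4 ≤ n) (hi : 1 ≤ i) (hin : i ≤ n) {T T' : Tab n s}
    (h : classicalF i T = some T') : (drop T').length = (drop T).length :=
  length_of_tabF (by omega) hi hin ((classicalF_eq_some_iff hn hi hin).1 h)

/-- The coefficient of `ε_j` in the weight of a word. -/
def wordWeight (w : List ℤ) (j : ℕ) : ℤ := (w.count (j : ℤ) : ℤ) - (w.count (-(j : ℤ)) : ℤ)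

theorem wordWeight_append (p q : List ℤ) (j : ℕ) :
    wordWeight (p ++ q) j = wordWeight p j + wordWeight q j := by
  simp [wordWeight]; ring

theorem wordWeight_cons (x : ℤ) (q : List ℤ) (j : ℕ) :
    wordWeight (x :: q) j = wordWeight [x] j + wordWeight q j :=
  wordWeight_append [x] q j

theorem wordWeight_singleton (x : ℤ) (j : ℕ) :
    wordWeight [x] j = (if x = j then 1 else 0) - (if x = -j then 1 else 0) := by
  simp only [wordWeight, List.count_singleton, beq_iff_eq]
  split_ifs <;> simp

/-- The columns `(a, bar a)` that are dropped have weight zero. -/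
theorem weight_eq (T : Tab n s) (j : ℕ) : weight T j = wordWeight (columnWord (drop T)) j := by
  have key : ∀ (a : ℤ) (m : ℕ), wordWeight (columnWord (List.replicate m (a, -a))) j = 0 := by
    intro a m
    induction m with
    | zero => simp [columnWord, wordWeight]
    | succ m ih =>
      rw [List.replicate_succ, columnWord, wordWeight_cons, wordWeight_cons a, ih]
      simp only [wordWeight_singleton]
      split_ifs <;> omega
  have h := dropped_drop T
  obtain ⟨a, M, L, R, j', h1, h2, -⟩ := h
  rw [weight, h1, h2, ← wordWeight]
  simp only [columnWord_append, wordWeight_append, key]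

/-- Only the colour `1` changes the coefficient of `ε₁`. -/
theorem wordWeight_of_wordF (hn : 4 ≤ n) (hi : 1 ≤ i) (hin : i ≤ n) {w w' : List ℤ}
    (h : wordF n i w = some w') :
    wordWeight w' 1 = wordWeight w 1 - if i = 1 then 1 else 0 := by
  obtain ⟨p, x, y, q, rfl, rfl, hxy, -, -⟩ := (wordF_eq_some_iff (by omega) hi hin).1 h
  rw [letterF_eq_some_iff hi hin] at hxy
  rw [wordWeight_append, wordWeight_append, wordWeight_cons x, wordWeight_cons y]
  have : wordWeight [y] 1 = wordWeight [x] 1 - if i = 1 then 1 else 0 := by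
    simp only [wordWeight_singleton, Nat.cast_one]
    split_ifs <;> omega
  omega

theorem weight_one_of_classicalF (hn : 4 ≤ n) (hi : 1 ≤ i) (hin : i ≤ n) {T T' : Tab n s}
    (h : classicalF i T = some T') : weight T' 1 = weight T 1 - if i = 1 then 1 else 0 := by
  rw [weight_eq, weight_eq]
  rw [classicalF_eq_some_iff hn hi hin, tabF_eq_some_iff (by omega) hi hin] at h
  exact wordWeight_of_wordF hn hi hin h

/-! ### Highest and lowest weight vectors -/

/-- The letters `1`, `2` and `bar 1` are the highest weight vectors of the vector crystal,
restricted to the colours `2, …, n`. -/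
theorem eq_of_forall_letterEps_eq_zero (hn : 4 ≤ n) {x : ℤ} (hx : IsLetter n x)
    (h : ∀ i, 2 ≤ i → i ≤ n → letterEps n i x = 0) : x = 1 ∨ x = 2 ∨ x = -1 := by
  have h1 := hx.height_eq
  by_contra hne
  have key : ∀ i, 2 ≤ i → i ≤ n → ¬ ((i < n ∧ (x = i + 1 ∨ x = -i)) ∨
      (i = n ∧ (x = -n ∨ x = -(n - 1)))) := fun i h2 h3 h4 => by
    have := (letterEps_eq_one_iff' h3).2 h4
    have := h i h2 h3
    omega
  have hn' := key n (by omega) (by omega)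
  rcases lt_or_gt_of_ne (show x ≠ 0 by omega) with hx0 | hx0
  · have := key x.natAbs (by omega) (by omega)
    omega
  · have := key (x.natAbs - 1) (by omega) (by omega)
    omega

theorem wordE_eq_none_of_append {p q : List ℤ} (h : wordE n i (p ++ q) = none) :
    wordE n i q = none := by
  induction p with
  | nil => exact h
  | cons x p ih => exact ih (wordE_cons_eq_none_iff.1 h).1

theorem le_neg_one (hn : 2 ≤ n) {x : ℤ} (hx : IsLetter n x) : le n x (-1) := by
  have h1 := hx.height_eq
  have h2 : height n (-1) = 2 * n - 1 := by simp [height]; ring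
  unfold le
  omega

theorem height_two : height n 2 = 2 := by simp [height]

theorem height_neg_two : height n (-2) = 2 * n - 2 := by simp [height]; ring

/-- The top entries of a branching highest weight vector are `1` or `2`: for the last column the
condition `ε_i = 0` passes to the last letter of the column word, and rows increase. -/
theorem IsTableau.top_eq_of_highest (hn : 4 ≤ n) {t : List (ℤ × ℤ)} (ht : IsTableau n t)
    (h : ∀ i, 2 ≤ i → i ≤ n → wordE n i (columnWord t) = none) {c : ℤ × ℤ} (hc : c ∈ t) :
    c.1 = 1 ∨ c.1 = 2 := by
  obtain ⟨L, ⟨a, b⟩, rfl⟩ := List.eq_nil_or_concat' t |>.resolve_left (by rintro rfl; simp at hc)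
  have hab := ht.letters (a, b) (by simp)
  have ha : a = 1 ∨ a = 2 := by
    have := eq_of_forall_letterEps_eq_zero hn hab.1 fun i h2 h3 => by
      have h4 := h i h2 h3
      rw [columnWord_append] at h4
      have h5 := wordE_eq_none_of_append h4
      have h6 := wordE_eq_none_of_append (p := [b]) (q := [a]) h5
      have := (wordE_cons_eq_none_iff.1 h6).2
      simpa only [wordPhi, Nat.le_zero] using this
    rcases this with h1 | h1 | rfl
    · exact Or.inl h1
    · exact Or.inr h1
    · exact absurd (le_neg_one (by omega) hab.2) (ht.columns (-1, b) (by simp))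
  have hpw := ht.pairwise
  rw [List.pairwise_append] at hpw
  have hle : le n c.1 a := by
    rcases List.mem_append.1 hc with hc | hc
    · exact (hpw.2.2 c hc (a, b) (by simp)).1
    · simp at hc; rw [hc]; exact le_refl _
  have h1 := (ht.letters c hc).1.height_eq
  have h2 : height n 1 = 1 := by simp [height]
  have h3 := height_two (n := n)
  unfold le at hle
  rcases ha with rfl | rfl <;> omega

/-- The only highest weight vector of `B(k ϖ₂)` is `(1, 2)^k`. -/
theorem IsKN.eq_replicate_of_highest (hn : 4 ≤ n) {t : List (ℤ × ℤ)} (ht : IsKN n t)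
    (h : ∀ i, 1 ≤ i → i ≤ n → wordE n i (columnWord t) = none) :
    t = List.replicate t.length (1, 2) := by
  rcases List.eq_nil_or_concat' t with rfl | ⟨L, ⟨a, b⟩, rfl⟩
  · rfl
  have hab := ht.letters (a, b) (by simp)
  have hcol := ht.columns (a, b) (by simp)
  simp only at hab hcol
  have hsuf : ∀ i, 1 ≤ i → i ≤ n → letterEps n i a = 0 ∧
      letterEps n i b ≤ letterPhi n i a := by
    intro i h2 h3
    have h4 := h i h2 h3
    rw [columnWord_append] at h4
    have h5 := wordE_cons_eq_none_iff.1 (wordE_eq_none_of_append h4)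
    have h6 := wordE_cons_eq_none_iff.1 h5.1
    simp only [columnWord, wordPhi] at h5 h6
    omega
  have ha : a = 1 := by
    rcases ht.top_eq_of_highest hn (fun i h2 h3 => h i (by omega) h3) (c := (a, b)) (by simp)
      with h1 | h1
    · exact h1
    · have := (hsuf 1 (by omega) (by omega)).1
      have := (letterEps_eq_one_iff' (n := n) (i := 1) (by omega) (x := a)).2 (by simp at h1; omega)
      omega
  subst ha
  have hb : b = 2 := by
    have := eq_of_forall_letterEps_eq_zero hn hab.2 fun i h2 h3 => by
      have h4 := (hsuf i (by omega) h3).2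
      have h5 := letterPhi_le_one (n := n) (i := i) 1
      have h6 := letterPhi_eq_one_iff' (n := n) (i := i) h3 (x := 1)
      omega
    rcases this with rfl | rfl | rfl
    · exact absurd (le_refl _) hcol
    · rfl
    · exact absurd (by simp) ht.noOne
  subst hb
  refine List.eq_replicate_iff.2 ⟨rfl, fun c hc => ?_⟩
  have hpw := ht.pairwise
  rw [List.pairwise_append] at hpw
  rcases List.mem_append.1 hc with hcL | hcL
  · have h1 := hpw.2.2 c hcL (1, 2) (by simp)
    have h2 := ht.letters c hc
    have h3 := ht.columns c hc
    have h4 := eq_one_of_le_one h2.1 h1.1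
    rw [h4] at h3
    have h5 := h2.2.height_eq
    have h6 : height n 1 = 1 := by simp [height]
    have h7 := height_two (n := n)
    have h8 := h1.2
    unfold le at h8 h3
    refine Prod.ext h4 ?_
    simp only at *
    omega
  · simpa using hcL

/-- The only lowest weight vector of `B(k ϖ₂)` is `(bar 2, bar 1)^k`, by duality. -/
theorem IsKN.eq_replicate_of_lowest (hn : 4 ≤ n) {t : List (ℤ × ℤ)} (ht : IsKN n t)
    (h : ∀ i, 1 ≤ i → i ≤ n → wordF n i (columnWord t) = none) :
    t = List.replicate t.length (-2, -1) := by
  have h1 := ht.bar.eq_replicate_of_highest hn fun i hi hin => by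
    rw [← tabE_eq_none_iff]
    by_contra hne
    obtain ⟨t', ht'⟩ := Option.ne_none_iff_exists'.1 hne
    have h2 := tabF_barTab (by omega) hi hin ((tabE_eq_some_iff (by omega) hi hin).1 ht')
    rw [barTab_barTab, tabF_eq_some_iff (by omega) hi hin, h i hi hin] at h2
    simp at h2
  rw [← barTab_barTab t, h1]
  simp [barTab]

end Classical

section Highest

variable {n s i k : ℕ}

theorem wordE_replicate_one_two (hn : 4 ≤ n) (hi : 1 ≤ i) (hin : i ≤ n) (k : ℕ) :
    wordE n i (columnWord (List.replicate k (1, 2))) = none := by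
  induction k with
  | zero => simp [columnWord, wordE]
  | succ k ih =>
    have e1 := letterEps_eq_one_iff' hin (x := 1)
    have e2 := letterEps_eq_one_iff' hin (x := 2)
    have e3 := letterPhi_eq_one_iff' hin (x := 1)
    have l1 := letterEps_le_one (n := n) (i := i) 1
    have l2 := letterEps_le_one (n := n) (i := i) 2
    have l3 := letterPhi_le_one (n := n) (i := i) 1
    rw [List.replicate_succ, columnWord, wordE_cons_eq_none_iff, wordE_cons_eq_none_iff]
    refine ⟨⟨ih, ?_⟩, ?_⟩
    · have : letterEps n i 1 ≠ 1 := by rw [ne_eq, e1]; omega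
      simp only; omega
    · simp only [wordPhi]
      have : letterEps n i 1 ≠ 1 := by rw [ne_eq, e1]; omega
      by_cases h : letterEps n i 2 = 1
      · rw [e2] at h
        have : letterPhi n i 1 = 1 := by rw [e3]; omega
        omega
      · omega

theorem wordPhi_replicate_neg (hn : 4 ≤ n) (hi : 1 ≤ i) (hin : i ≤ n) (k : ℕ) :
    wordPhi n i (columnWord (List.replicate k (-2, -1))) = 0 := by
  induction k with
  | zero => simp [columnWord, wordPhi]
  | succ k ih =>
    have e1 := letterPhi_eq_one_iff' hin (x := -1)
    have e2 := letterPhi_eq_one_iff' hin (x := -2)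
    have e3 := letterEps_eq_one_iff' hin (x := -1)
    have l1 := letterPhi_le_one (n := n) (i := i) (-1)
    have l2 := letterPhi_le_one (n := n) (i := i) (-2)
    rw [List.replicate_succ, columnWord]
    simp only [wordPhi, ih]
    have h1 : letterPhi n i (-1) ≠ 1 := by rw [ne_eq, e1]; omega
    by_cases h : letterPhi n i (-2) = 1
    · rw [e2] at h
      have : letterEps n i (-1) = 1 := by rw [e3]; omega
      omega
    · omega

theorem isHighest_iff (hn : 4 ≤ n) {T : Tab n s} :
    IsHighest k T ↔ drop T = List.replicate k (1, 2) := by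
  constructor
  · rintro ⟨h1, h2⟩
    rw [InB] at h1
    rw [← h1]
    exact (isKN_drop T).eq_replicate_of_highest hn fun i hi hin =>
      (classicalE_eq_none_iff hn hi hin).1 (h2 i hi hin)
  · intro h
    refine ⟨by simp [InB, h], fun i hi hin => ?_⟩
    rw [classicalE_eq_none_iff hn hi hin, h, wordE_replicate_one_two hn hi hin]

theorem isLowest_iff (hn : 4 ≤ n) {T : Tab n s} :
    IsLowest k T ↔ drop T = List.replicate k (-2, -1) := by
  constructor
  · rintro ⟨h1, h2⟩
    rw [InB] at h1
    rw [← h1]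
    exact (isKN_drop T).eq_replicate_of_lowest hn fun i hi hin =>
      (classicalF_eq_none_iff hn hi hin).1 (h2 i hi hin)
  · intro h
    refine ⟨by simp [InB, h], fun i hi hin => ?_⟩
    rw [classicalF_eq_none_iff hn hi hin, h, wordF_eq_none_iff,
      wordPhi_replicate_neg hn hi hin]

/-! ### Branching highest weight vectors of one-row shape -/

/-- The arrays `(1, 2)^p (1, bar 2)^q (2, bar 2)^r (2, bar 1)^t`, which contain all branching
highest weight vectors of one-row shape. -/
def blocks (p q r t : ℕ) : List (ℤ × ℤ) :=
  List.replicate p (1, 2) ++ List.replicate q (1, -2) ++ List.replicate r (2, -2) ++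
    List.replicate t (2, -1)

theorem mem_blocks {p q r t : ℕ} {c : ℤ × ℤ} (hc : c ∈ blocks p q r t) :
    c = (1, 2) ∨ c = (1, -2) ∨ c = (2, -2) ∨ c = (2, -1) := by
  simp only [blocks, List.mem_append, List.mem_replicate] at hc
  tauto

theorem length_blocks (p q r t : ℕ) : (blocks p q r t).length = p + q + r + t := by
  simp [blocks]; ring

theorem isTableau_blocks (hn : 4 ≤ n) (p q r t : ℕ) : IsTableau n (blocks p q r t) := by
  have h1 : height n 1 = 1 := by simp [height]
  have h2 := height_two (n := n)
  have h3 := height_neg_two (n := n)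
  have h4 : height n (-1) = 2 * n - 1 := by simp [height]; ring
  refine isTableau_of_pairwise ?_ ?_ ?_ ?_
  · intro c hc
    rw [isLetter_iff, isLetter_iff]
    rcases mem_blocks hc with rfl | rfl | rfl | rfl <;> simp <;> omega
  · simp only [blocks, List.pairwise_append, List.pairwise_replicate, List.mem_append,
      List.mem_replicate]
    refine ⟨⟨⟨Or.inr ⟨le_refl _, le_refl _⟩, Or.inr ⟨le_refl _, le_refl _⟩, ?_⟩,
      Or.inr ⟨le_refl _, le_refl _⟩, ?_⟩, Or.inr ⟨le_refl _, le_refl _⟩, ?_⟩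
    · rintro c ⟨-, rfl⟩ d ⟨-, rfl⟩
      (simp [ColLe, le, h1, h2, h3]; try omega)
    · rintro c (⟨-, rfl⟩ | ⟨-, rfl⟩) d ⟨-, rfl⟩ <;>
      · (simp [ColLe, le, h1, h2, h3]; try omega)
    · rintro c ((⟨-, rfl⟩ | ⟨-, rfl⟩) | ⟨-, rfl⟩) d ⟨-, rfl⟩ <;>
      · (simp [ColLe, le, h1, h2, h3]; try omega)
  · intro c hc
    rcases mem_blocks hc with rfl | rfl | rfl | rfl <;>
    · simp only [le, h1, h2, h3, h4]; omega
  · refine List.pairwise_of_forall_mem_list ?_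
    intro c hc d hd
    rcases mem_blocks hc with rfl | rfl | rfl | rfl <;>
    · simp only [MiddleFree, Prod.mk.injEq]; omega

theorem isKN_blocks (hn : 4 ≤ n) {p q r t : ℕ} (hr : r ≤ 1) : IsKN n (blocks p q r t) := by
  have ht := isTableau_blocks hn p q r t
  have hL : ∀ c ∈ List.replicate p ((1 : ℤ), (2 : ℤ)) ++ List.replicate q (1, -2),
      c.1 = 1 ∧ ¬ IsDiag c := by
    intro c hc
    simp only [List.mem_append, List.mem_replicate] at hc
    rcases hc with ⟨-, rfl⟩ | ⟨-, rfl⟩ <;> simp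
  have hR : ∀ c ∈ List.replicate t ((2 : ℤ), (-1 : ℤ)), c.2 = -1 ∧ ¬ IsDiag c := by
    intro c hc
    rw [(List.mem_replicate.1 hc).2]
    simp
  rcases Nat.le_one_iff_eq_zero_or_eq_one.1 hr with rfl | rfl
  · refine isKN_of_forall_not_isDiag ht fun c hc => ?_
    rw [blocks, List.replicate_zero, List.append_nil] at hc
    rcases List.mem_append.1 hc with hc | hc
    exacts [(hL c hc).2, (hR c hc).2]
  · have e : blocks p q 1 t = (List.replicate p (1, 2) ++ List.replicate q (1, -2)) ++
        ((2 : ℤ), (-2 : ℤ)) :: List.replicate t (2, -1) := by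
      simp [blocks]
    rw [e] at ht ⊢
    refine isKN_of_not_touches ht (fun c hc => (hL c hc).2) (fun c hc => (hR c hc).2) ?_
    rintro (h | ⟨b, hb⟩ | ⟨d, hd⟩)
    · omega
    · have := (hL _ (List.mem_of_getLast? hb)).1
      simp at this
    · have := (hR _ (List.mem_of_mem_head? hd)).1
      simp at this

theorem wordWeight_of_mem {t : List (ℤ × ℤ)}
    (h : ∀ c ∈ t, c = (1, 2) ∨ c = (1, -2) ∨ c = (2, -2) ∨ c = (2, -1)) :
    wordWeight (columnWord t) 1 = t.count (1, 2) + t.count (1, -2) - t.count (2, -1) ∧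
    wordWeight (columnWord t) 2 = t.count (1, 2) - t.count (1, -2) + t.count (2, -1) ∧
    t.length = t.count (1, 2) + t.count (1, -2) + t.count (2, -2) + t.count (2, -1) ∧
    ∀ j, 3 ≤ j → wordWeight (columnWord t) j = 0 := by
  induction t with
  | nil => simp [columnWord, wordWeight]
  | cons c t ih =>
    obtain ⟨h1, h2, h3, h4⟩ := ih fun c hc => h c (by simp [hc])
    have w : ∀ j, wordWeight (columnWord (c :: t)) j =
        wordWeight [c.2] j + (wordWeight [c.1] j + wordWeight (columnWord t) j) := by
      intro j
      rw [columnWord, wordWeight_cons c.2, wordWeight_cons c.1]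
    refine ⟨?_, ?_, ?_, ?_⟩
    · rw [w]
      rcases h c (by simp) with rfl | rfl | rfl | rfl <;>
        simp [wordWeight_singleton, h1] <;> ring
    · rw [w]
      rcases h c (by simp) with rfl | rfl | rfl | rfl <;>
        simp [wordWeight_singleton, h2] <;> ring
    · rw [List.length_cons]
      rcases h c (by simp) with rfl | rfl | rfl | rfl <;> simp [h3] <;> ring
    · intro j hj
      have z : ∀ x : ℤ, (x = 1 ∨ x = -1 ∨ x = 2 ∨ x = -2) → wordWeight [x] j = 0 := by
        intro x hx
        rw [wordWeight_singleton, if_neg (by omega), if_neg (by omega)]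
        rfl
      rw [w, h4 j hj]
      rcases h c (by simp) with rfl | rfl | rfl | rfl <;> rw [z _ (by simp), z _ (by simp)] <;> rfl

theorem count_blocks (p q r t : ℕ) : (blocks p q r t).count (1, 2) = p ∧
    (blocks p q r t).count (1, -2) = q ∧ (blocks p q r t).count (2, -2) = r ∧
    (blocks p q r t).count (2, -1) = t := by
  simp [blocks, List.count_append, List.count_replicate]

theorem wordWeight_blocks (p q r t : ℕ) :
    wordWeight (columnWord (blocks p q r t)) 1 = p + q - t ∧
    wordWeight (columnWord (blocks p q r t)) 2 = p - q + t ∧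
    ∀ j, 3 ≤ j → wordWeight (columnWord (blocks p q r t)) j = 0 := by
  obtain ⟨h1, h2, -, h4⟩ := wordWeight_of_mem (t := blocks p q r t) fun c hc => mem_blocks hc
  obtain ⟨c1, c2, c3, c4⟩ := count_blocks p q r t
  rw [c1, c2, c4] at h1 h2
  exact ⟨h1, h2, h4⟩

theorem IsKN.count_diag_le_one {t : List (ℤ × ℤ)} (ht : IsKN n t) (a : ℤ) :
    t.count (a, -a) ≤ 1 := by
  obtain ⟨a', M, L, R, j, h1, rfl, hL, hR, hj⟩ := ht.dropped_self
  rw [List.count_append, List.count_append, List.count_eq_zero.2 (fun h => hL _ h rfl),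
    List.count_eq_zero.2 (fun h => hR _ h rfl), List.count_replicate]
  split_ifs <;> omega

theorem mem_columnWord {t : List (ℤ × ℤ)} {x : ℤ} :
    x ∈ columnWord t ↔ ∃ c ∈ t, x = c.1 ∨ x = c.2 := by
  induction t with
  | nil => simp [columnWord]
  | cons c t ih =>
    simp only [columnWord, List.mem_cons, ih, or_and_right, exists_or, exists_eq_left]
    rw [← or_assoc, or_comm (a := x = c.2)]

theorem wordPhi_eq_zero_of_forall {w : List ℤ} (h : ∀ x ∈ w, letterPhi n i x = 0) :
    wordPhi n i w = 0 := by
  induction w with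
  | nil => rfl
  | cons x w ih =>
    rw [wordPhi, h x (by simp), ih fun y hy => h y (by simp [hy])]
    simp

theorem exists_last_of_mem {α : Type*} {P : α → Prop} {t : List α} (h : ∃ c ∈ t, P c) :
    ∃ L c R, t = L ++ c :: R ∧ P c ∧ ∀ d ∈ R, ¬ P d := by
  induction t with
  | nil => simp at h
  | cons c t ih =>
    by_cases ht : ∃ c ∈ t, P c
    · obtain ⟨L, d, R, rfl, h1, h2⟩ := ih ht
      exact ⟨c :: L, d, R, rfl, h1, h2⟩
    · obtain ⟨d, hd, hP⟩ := h
      have hdt : d ∉ t := fun h => ht ⟨d, h, hP⟩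
      obtain rfl : d = c := by simpa [hdt] using hd
      exact ⟨[], d, t, rfl, hP, fun e he h => ht ⟨e, he, h⟩⟩

/-- The columns of a branching highest weight vector whose shape is a single row. -/
theorem IsKN.mem_of_branchHighest (hn : 4 ≤ n) {t : List (ℤ × ℤ)} (ht : IsKN n t)
    (h : ∀ i, 2 ≤ i → i ≤ n → wordE n i (columnWord t) = none)
    (hw : ∀ j, 3 ≤ j → j ≤ n → wordWeight (columnWord t) j = 0) :
    ∀ c ∈ t, c = (1, 2) ∨ c = (1, -2) ∨ c = (2, -2) ∨ c = (2, -1) := by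
  have htop : ∀ c ∈ t, c.1 = 1 ∨ c.1 = 2 := fun c hc => ht.top_eq_of_highest hn h hc
  have hbot : ¬ ∃ c ∈ t, 3 ≤ |c.2| := by
    intro hex
    -- the last bottom entry different from `±1`, `±2` can only be `3`
    obtain ⟨L, ⟨a, b⟩, R, rfl, hb, hR⟩ := exists_last_of_mem hex
    have hlb := (ht.letters (a, b) (by simp)).2.height_eq
    simp only [not_le] at hb hR hlb
    have hsmall : ∀ x ∈ a :: columnWord R, -2 ≤ x ∧ x ≤ 2 := by
      intro x hx
      rcases List.mem_cons.1 hx with rfl | hx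
      · have := htop (x, b) (by simp); simp only at this; omega
      · obtain ⟨c, hc, hx⟩ := mem_columnWord.1 hx
        have h1 := htop c (by simp [hc])
        have h2 := abs_lt.1 (hR c hc)
        omega
    have heps : ∀ i, 3 ≤ i → i ≤ n → letterEps n i b = 0 := by
      intro i hi hin
      have h1 := h i (by omega) hin
      rw [columnWord_append] at h1
      have h2 := (wordE_cons_eq_none_iff.1 (wordE_eq_none_of_append h1)).2
      rwa [wordPhi_eq_zero_of_forall, Nat.le_zero] at h2
      intro x hx
      have h3 := hsmall x hx
      have h4 := letterPhi_eq_one_iff' (n := n) (i := i) hin (x := x)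
      have h5 := letterPhi_le_one (n := n) (i := i) x
      omega
    have key : ∀ i, 3 ≤ i → i ≤ n → ¬ ((i < n ∧ (b = i + 1 ∨ b = -i)) ∨
        (i = n ∧ (b = -n ∨ b = -(n - 1)))) := fun i h2 h3 h4 => by
      have := (letterEps_eq_one_iff' h3).2 h4
      have := heps i h2 h3
      omega
    have hb3 : b = 3 := by
      have k1 := key n (by omega) (by omega)
      have k2 := key b.natAbs
      have k3 := key (b.natAbs - 1)
      rcases le_abs.1 hb with hb | hb <;> omega
    subst hb3
    have hw3 := hw 3 (by omega) (by omega)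
    have hc1 : List.count (3 : ℤ) (columnWord (L ++ (a, 3) :: R)) ≠ 0 := by
      rw [ne_eq, List.count_eq_zero, not_not, mem_columnWord]
      exact ⟨(a, 3), by simp, Or.inr rfl⟩
    have hc2 : List.count (-3 : ℤ) (columnWord (L ++ (a, 3) :: R)) = 0 := by
      rw [List.count_eq_zero, mem_columnWord]
      rintro ⟨c, hc, hx⟩
      have h1 := htop c hc
      have hc2 : c.2 = -3 := by omega
      rcases List.mem_append.1 hc with hc | hc
      · have hpw := ht.pairwise
        rw [List.pairwise_append] at hpw
        have h2 := (hpw.2.2 c hc (a, 3) (by simp)).2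
        have h3 : height n 3 = 3 := by simp [height]
        have h4 : height n (-3) = 2 * n - 3 := by simp [height]; ring
        simp only [hc2] at h2
        unfold le at h2
        omega
      · rcases List.mem_cons.1 hc with rfl | hc
        · simp at hc2
        · have := hR c hc
          rw [hc2] at this
          norm_num at this
    simp only [wordWeight, Nat.cast_ofNat] at hw3
    omega
  intro c hc
  have h1 := htop c hc
  have h2 : |c.2| < 3 := by
    by_contra h'
    exact hbot ⟨c, hc, not_lt.1 h'⟩
  have h3 := (ht.letters c hc).2.height_eq
  have h4 := ht.columns c hc
  rw [abs_lt] at h2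
  have h5 : c ≠ (1, -1) := fun h => ht.noOne (h ▸ hc)
  have h6 : height n 1 = 1 := by simp [height]
  have h7 := height_two (n := n)
  obtain ⟨a, b⟩ := c
  unfold le at h4
  simp only [Prod.mk.injEq, ne_eq] at *
  rcases h1 with rfl | rfl <;> omega

/-- A branching highest weight vector whose shape is a single row is determined by its weight
and its number of columns. -/
theorem IsKN.eq_of_branchHighest {t t' : List (ℤ × ℤ)} (ht : IsKN n t) (ht' : IsKN n t')
    (h : ∀ c ∈ t, c = (1, 2) ∨ c = (1, -2) ∨ c = (2, -2) ∨ c = (2, -1))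
    (h' : ∀ c ∈ t', c = (1, 2) ∨ c = (1, -2) ∨ c = (2, -2) ∨ c = (2, -1))
    (hlen : t.length = t'.length)
    (h1 : wordWeight (columnWord t) 1 = wordWeight (columnWord t') 1)
    (h2 : wordWeight (columnWord t) 2 = wordWeight (columnWord t') 2) : t = t' := by
  refine List.Perm.eq_of_pairwise (fun a b _ _ h h' => ColLe.antisymm h h') ht.pairwise
    ht'.pairwise ?_
  obtain ⟨a1, a2, a3, -⟩ := wordWeight_of_mem h
  obtain ⟨b1, b2, b3, -⟩ := wordWeight_of_mem h'
  have a4 := ht.count_diag_le_one 2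
  have b4 := ht'.count_diag_le_one 2
  rw [List.perm_iff_count]
  intro c
  by_cases hc : c = (1, 2) ∨ c = (1, -2) ∨ c = (2, -2) ∨ c = (2, -1)
  · rcases hc with rfl | rfl | rfl | rfl <;> omega
  · rw [List.count_eq_zero.2 (fun hm => hc (h c hm)),
      List.count_eq_zero.2 (fun hm => hc (h' c hm))]

end Highest

/-! ### The rank function of the branching component graph -/

section Rank

variable {n s i k : ℕ}

theorem vertexOf_eq_of_classicalF (h2 : 2 ≤ i) (hin : i ≤ n) {b c : Tab n s}
    (h : classicalF i b = some c) : vertexOf b = vertexOf c := by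
  by_cases hbc : b = c
  · rw [hbc]
  · refine SimpleGraph.ConnectedComponent.sound (SimpleGraph.Adj.reachable ?_)
    rw [branchingGraph, SimpleGraph.fromRel_adj]
    exact ⟨hbc, Or.inl ⟨i, h2, hin, h⟩⟩

/-- Induction along a branching component. -/
theorem branching_induction {P : Tab n s → Prop} {b c : Tab n s} (h : vertexOf b = vertexOf c)
    (hF : ∀ i, 2 ≤ i → i ≤ n → ∀ x y, classicalF i x = some y → (P x ↔ P y)) (hb : P b) :
    P c := by
  obtain ⟨p⟩ := SimpleGraph.ConnectedComponent.exact h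
  induction p with
  | nil => exact hb
  | cons hadj p ih =>
    rw [branchingGraph, SimpleGraph.fromRel_adj] at hadj
    refine ih (SimpleGraph.ConnectedComponent.sound ⟨p⟩) ?_
    rcases hadj.2 with ⟨i, h2, hin, h⟩ | ⟨i, h2, hin, h⟩
    · exact (hF i h2 hin _ _ h).1 hb
    · exact (hF i h2 hin _ _ h).2 hb

theorem weight_one_eq_of_vertexOf_eq (hn : 4 ≤ n) {b c : Tab n s} (h : vertexOf b = vertexOf c) :
    weight b 1 = weight c 1 := by
  refine branching_induction (P := fun x => weight b 1 = weight x 1) h ?_ rfl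
  intro i h2 hin x y hxy
  rw [weight_one_of_classicalF hn (by omega) hin hxy, if_neg (by omega), sub_zero]

theorem length_drop_eq_of_vertexOf_eq (hn : 4 ≤ n) {b c : Tab n s}
    (h : vertexOf b = vertexOf c) : (drop b).length = (drop c).length := by
  refine branching_induction (P := fun x => (drop b).length = (drop x).length) h ?_ rfl
  intro i h2 hin x y hxy
  rw [length_drop_of_classicalF hn (by omega) hin hxy]

theorem inBC_vertexOf_iff (hn : 4 ≤ n) {b : Tab n s} : InBC k (vertexOf b) ↔ InB k b := by
  constructor
  · rintro ⟨c, hc, h⟩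
    rw [InB] at *
    rw [← h, length_drop_eq_of_vertexOf_eq hn hc]
  · exact fun h => ⟨b, rfl, h⟩

/-- The sum of the heights of the letters, which decreases under `e_i`. -/
def heightSum (n : ℕ) (w : List ℤ) : ℤ := (w.map (height n)).sum

theorem heightSum_of_wordF (hn : 2 ≤ n) (hi : 1 ≤ i) (hin : i ≤ n) {w w' : List ℤ}
    (h : wordF n i w = some w') : heightSum n w < heightSum n w' := by
  obtain ⟨p, x, y, q, rfl, rfl, hxy, -, -⟩ := (wordF_eq_some_iff hn hi hin).1 h
  rw [letterF_eq_some_iff hi hin] at hxy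
  have : height n x < height n y := by
    unfold height
    split_ifs <;> omega
  simp only [heightSum, List.map_append, List.map_cons, List.sum_append, List.sum_cons]
  omega

theorem heightSum_nonneg {t : List (ℤ × ℤ)} (ht : IsTableau n t) :
    0 ≤ heightSum n (columnWord t) := by
  refine List.sum_nonneg fun y hy => ?_
  obtain ⟨x, hx, rfl⟩ := List.mem_map.1 hy
  obtain ⟨c, hc, h⟩ := mem_columnWord.1 hx
  have h1 := (ht.letters c hc).1.height_eq
  have h2 := (ht.letters c hc).2.height_eq
  rcases h with rfl | rfl <;> omega

theorem heightSum_of_classicalF (hn : 4 ≤ n) (hi : 1 ≤ i) (hin : i ≤ n) {b c : Tab n s}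
    (h : classicalF i b = some c) :
    heightSum n (columnWord (drop b)) < heightSum n (columnWord (drop c)) := by
  rw [classicalF_eq_some_iff hn hi hin, tabF_eq_some_iff (by omega) hi hin] at h
  exact heightSum_of_wordF (by omega) hi hin h

theorem bcGraph_adj_or_eq {b c : Tab n s} (h : classicalF 1 b = some c) :
    vertexOf c = vertexOf b ∨ (bcGraph n s).Adj (vertexOf c) (vertexOf b) := by
  by_cases hbc : vertexOf c = vertexOf b
  · exact Or.inl hbc
  · right
    rw [bcGraph, SimpleGraph.fromRel_adj]
    exact ⟨hbc, Or.inr ⟨b, c, rfl, h, rfl⟩⟩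

theorem weight_replicate_one_two {u : Tab n s} (hu : drop u = List.replicate k (1, 2)) :
    weight u 1 = k := by
  have : List.replicate k ((1 : ℤ), (2 : ℤ)) = blocks k 0 0 0 := by simp [blocks]
  rw [weight_eq, hu, this, (wordWeight_blocks k 0 0 0).1]
  simp

/-- Every branching component of `B(k ϖ₂)` is joined to that of the highest weight vector by a
path along which the coefficient of `ε₁` in the weight increases. -/
theorem exists_walk (hn : 4 ≤ n) {u : Tab n s} (hu : drop u = List.replicate k (1, 2))
    (b : Tab n s) (hb : InB k b) :
    ∃ p : (bcGraph n s).Walk (vertexOf b) (vertexOf u), (p.length : ℤ) ≤ k - weight b 1 := by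
  by_cases hhigh : IsHighest k b
  · rw [isHighest_iff hn, ← hu] at hhigh
    obtain rfl := drop_injective hhigh
    refine ⟨SimpleGraph.Walk.nil, ?_⟩
    rw [weight_replicate_one_two hu]
    simp
  · have : ∃ i, 1 ≤ i ∧ i ≤ n ∧ ∃ c, classicalE i b = some c := by
      by_contra hne
      refine hhigh ⟨hb, fun i hi hin => ?_⟩
      by_contra h
      exact hne ⟨i, hi, hin, Option.ne_none_iff_exists'.1 h⟩
    obtain ⟨i, hi, hin, c, hc⟩ := this
    rw [classicalE_eq_some_iff hn hi hin] at hc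
    have hlt := heightSum_of_classicalF hn hi hin hc
    have hnn := heightSum_nonneg (isKN_drop c).toIsTableau
    obtain ⟨p, hp⟩ := exists_walk hn hu c
      (by rw [InB, ← length_drop_of_classicalF hn hi hin hc, hb])
    have hw := weight_one_of_classicalF hn hi hin hc
    by_cases h1 : i = 1
    · subst h1
      rw [if_pos rfl] at hw
      rcases bcGraph_adj_or_eq hc with h | h
      · rw [h]
        exact ⟨p, by omega⟩
      · refine ⟨SimpleGraph.Walk.cons h p, ?_⟩
        rw [SimpleGraph.Walk.length_cons]
        push_cast
        omega
    · rw [← vertexOf_eq_of_classicalF (by omega) hin hc]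
      rw [if_neg h1] at hw
      exact ⟨p, by omega⟩
termination_by (heightSum n (columnWord (drop b))).toNat
decreasing_by omega

/-- Each edge of the branching component graph changes the coefficient of `ε₁` by one. -/
theorem weight_sub_le_length (hn : 4 ≤ n) {v w : BCVertex n s} (p : (bcGraph n s).Walk v w) :
    ∀ b c : Tab n s, vertexOf b = v → vertexOf c = w → weight c 1 - weight b 1 ≤ p.length := by
  induction p with
  | nil =>
    rintro b c rfl h
    rw [weight_one_eq_of_vertexOf_eq hn h]
    simp
  | cons hadj p ih =>
    rintro b c rfl hc
    rw [bcGraph, SimpleGraph.fromRel_adj] at hadj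
    rw [SimpleGraph.Walk.length_cons]
    push_cast
    rcases hadj.2 with ⟨x, y, h1, h2, h3⟩ | ⟨x, y, h1, h2, h3⟩
    · have e1 := ih y c h3 hc
      have e2 := weight_one_of_classicalF hn le_rfl (by omega) h2
      have e3 := weight_one_eq_of_vertexOf_eq hn h1
      rw [if_pos rfl] at e2
      omega
    · have e1 := ih x c h1 hc
      have e2 := weight_one_of_classicalF hn le_rfl (by omega) h2
      have e3 := weight_one_eq_of_vertexOf_eq hn h3
      rw [if_pos rfl] at e2
      omega

theorem dist_vertexOf (hn : 4 ≤ n) {u b : Tab n s} (hu : drop u = List.replicate k (1, 2))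
    (hb : InB k b) : ((bcGraph n s).dist (vertexOf b) (vertexOf u) : ℤ) = k - weight b 1 := by
  obtain ⟨p, hp⟩ := exists_walk hn hu b hb
  have h1 := SimpleGraph.dist_le p
  obtain ⟨q, hq⟩ := (SimpleGraph.Walk.reachable p).exists_walk_length_eq_dist
  have h2 := weight_sub_le_length hn q b u rfl rfl
  rw [weight_replicate_one_two hu] at h2
  omega

theorem exists_tab_of_blocks (hn : 4 ≤ n) {p q r t : ℕ} (hr : r ≤ 1) (h : p + q + r + t ≤ s) :
    ∃ T : Tab n s, drop T = blocks p q r t :=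
  exists_drop_eq (by omega) (isKN_blocks hn hr) (by rw [length_blocks]; exact h)

/-- The rank of a branching component is `s` minus the coefficient of `ε₁` in its weight. -/
theorem hasRank_iff (hn : 4 ≤ n) {b : Tab n s} {p : ℕ} :
    HasRank (vertexOf b) p ↔ (p : ℤ) = s - weight b 1 := by
  constructor
  · rintro ⟨k, u, hk, hv, hu, rfl⟩
    rw [inBC_vertexOf_iff hn] at hv
    rw [isHighest_iff hn] at hu
    have := dist_vertexOf hn hu hv
    omega
  · intro h
    have hk := length_drop_le b
    obtain ⟨u, hu⟩ := exists_tab_of_blocks (s := s) hn (p := (drop b).length) (q := 0) (r := 0)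
      (t := 0) (by omega) (by omega)
    have hu' : drop u = List.replicate (drop b).length (1, 2) := by simpa [blocks] using hu
    refine ⟨(drop b).length, u, hk, (inBC_vertexOf_iff hn).2 rfl, (isHighest_iff hn).2 hu', ?_⟩
    have := dist_vertexOf hn hu' (rfl : InB _ b)
    omega

end Rank

/-! ### Branching components of one-row shape -/

section Model

variable {n s i k : ℕ}

/-- The word `B` spans a trivial crystal for the colour `i`, so that it can be ignored on the
left of a tensor product. -/
def Neutral (n i : ℕ) (B : List ℤ) : Prop :=
  ∀ w, wordPhi n i (B ++ w) = wordPhi n i w ∧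
    wordF n i (B ++ w) = (wordF n i w).map (B ++ ·) ∧
    wordE n i (B ++ w) = (wordE n i w).map (B ++ ·)

theorem neutral_nil : Neutral n i [] := fun w => by simp

theorem Neutral.append {B C : List ℤ} (hB : Neutral n i B) (hC : Neutral n i C) :
    Neutral n i (B ++ C) := by
  intro w
  rw [List.append_assoc, (hB _).1, (hB _).2.1, (hB _).2.2, (hC _).1, (hC _).2.1, (hC _).2.2]
  simp [Option.map_map, Function.comp_def]

theorem wordF_cons_of_neutral {z : ℤ} (h1 : letterPhi n i z = 0) (h2 : letterEps n i z = 0)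
    (w : List ℤ) : wordPhi n i (z :: w) = wordPhi n i w ∧
      wordF n i (z :: w) = (wordF n i w).map (z :: ·) ∧
      wordE n i (z :: w) = (wordE n i w).map (z :: ·) := by
  refine ⟨by simp [wordPhi, h1, h2], ?_, by simp [wordE, h2]⟩
  by_cases hw : wordPhi n i w = 0
  · simp [wordF, hw, letterPhi_eq_zero_iff.1 h1, wordF_eq_none_iff.2 hw]
  · simp [wordF, h2, hw]

theorem neutral_singleton {z : ℤ} (h1 : letterPhi n i z = 0) (h2 : letterEps n i z = 0) :
    Neutral n i [z] := fun w => wordF_cons_of_neutral h1 h2 w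

theorem letter_one_neutral (hn : 4 ≤ n) (h2 : 2 ≤ i) (hin : i ≤ n) {z : ℤ}
    (hz : z = 1 ∨ z = -1) : letterPhi n i z = 0 ∧ letterEps n i z = 0 := by
  have e1 := letterPhi_eq_one_iff' hin (x := z)
  have e2 := letterEps_eq_one_iff' hin (x := z)
  have l1 := letterPhi_le_one (n := n) (i := i) z
  have l2 := letterEps_le_one (n := n) (i := i) z
  omega

theorem letter_two (hn : 4 ≤ n) (h2 : 2 ≤ i) (hin : i ≤ n) :
    letterEps n i 2 = 0 ∧ letterPhi n i (-2) = 0 ∧ letterPhi n i 2 = letterEps n i (-2) := by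
  have e1 := letterEps_eq_one_iff' hin (x := 2)
  have l1 := letterEps_le_one (n := n) (i := i) 2
  rw [letterPhi_neg (by omega) hin, letterEps_neg (by omega) hin]
  omega

/-- The letters `bar 2` and `2` around a neutral word cancel. -/
theorem Neutral.wrap (hn : 4 ≤ n) (h2 : 2 ≤ i) (hin : i ≤ n) {B : List ℤ}
    (hB : Neutral n i B) : Neutral n i (-2 :: (B ++ [2])) := by
  obtain ⟨a1, a2, a3⟩ := letter_two hn h2 hin
  intro w
  have hphi : wordPhi n i (B ++ 2 :: w) = letterEps n i (-2) + wordPhi n i w := by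
    rw [(hB _).1, wordPhi, a1, a3, Nat.sub_zero]
  have e : -2 :: (B ++ [2]) ++ w = -2 :: (B ++ 2 :: w) := by simp
  rw [e]
  refine ⟨?_, ?_, ?_⟩
  · rw [wordPhi, hphi, a2]; omega
  · rw [wordF, hphi]
    by_cases hw : wordPhi n i w = 0
    · rw [if_pos (by omega), wordF_eq_none_iff.2 hw, letterPhi_eq_zero_iff.1 a2]
      rfl
    · rw [if_neg (by omega), (hB _).2.1, wordF, a1, if_neg (by omega)]
      simp [Option.map_map, Function.comp_def]
  · rw [wordE, hphi, if_neg (by omega), (hB _).2.2, wordE, a1, if_neg (by omega)]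
    simp [Option.map_map, Function.comp_def]

theorem blocks_core_succ (q r : ℕ) :
    blocks 0 (q + 1) r (q + 1) = (1, -2) :: (blocks 0 q r q ++ [(2, -1)]) := by
  simp only [blocks, List.replicate_succ (n := q) (a := ((1 : ℤ), (-2 : ℤ))),
    List.replicate_succ' (n := q) (a := ((2 : ℤ), (-1 : ℤ)))]
  simp

/-- The array `(1, bar 2)^q (2, bar 2)^r (2, bar 1)^q` is neutral for the colours `2, …, n`: its
column word is obtained by nesting and concatenating pairs `bar 2 … 2`. -/
theorem neutral_core (hn : 4 ≤ n) (h2 : 2 ≤ i) (hin : i ≤ n) (q r : ℕ) :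
    Neutral n i (columnWord (blocks 0 q r q)) := by
  induction q with
  | zero =>
    have : blocks 0 0 r 0 = List.replicate r (2, -2) := by simp [blocks]
    rw [this]
    induction r with
    | zero => exact neutral_nil
    | succ r ih =>
      rw [List.replicate_succ]
      exact (neutral_nil.wrap hn h2 hin).append (ih (by simp [blocks]))
  | succ q ih =>
    have h1 := letter_one_neutral hn h2 hin (z := 1) (Or.inl rfl)
    have h3 := letter_one_neutral hn h2 hin (z := -1) (Or.inr rfl)
    have := (((neutral_singleton h1.1 h1.2).append ih).append
      (neutral_singleton h3.1 h3.2)).wrap hn h2 hin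
    rw [blocks_core_succ]
    simpa [columnWord, columnWord_append] using this

/-- A neutral word can also be ignored on the right. -/
theorem neutral_append_right {R : List ℤ} (hR : Neutral n i R) (w : List ℤ) :
    wordPhi n i (w ++ R) = wordPhi n i w ∧
    wordF n i (w ++ R) = (wordF n i w).map (· ++ R) ∧
    wordE n i (w ++ R) = (wordE n i w).map (· ++ R) := by
  induction w with
  | nil => simpa [wordPhi, wordF, wordE] using hR []
  | cons x w ih =>
    simp only [List.cons_append, wordPhi, wordF, wordE, ih]
    refine ⟨trivial, ?_, ?_⟩ <;> split_ifs <;> simp [Option.map_map, Function.comp_def]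

/-- A top row of letters `1` can be ignored. -/
theorem columnWord_map_bottom (h1 : letterPhi n i 1 = 0) (h2 : letterEps n i 1 = 0) (A : List ℤ) :
    wordPhi n i (columnWord (A.map fun x => (1, x))) = wordPhi n i A ∧
    wordF n i (columnWord (A.map fun x => (1, x))) =
      (wordF n i A).map (fun A => columnWord (A.map fun x => (1, x))) ∧
    wordE n i (columnWord (A.map fun x => (1, x))) =
      (wordE n i A).map (fun A => columnWord (A.map fun x => (1, x))) := by
  induction A with
  | nil => simp [columnWord, wordPhi, wordF, wordE]
  | cons x A ih =>
    have h := wordF_cons_of_neutral h1 h2 (columnWord (A.map fun x => (1, x)))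
    simp only [List.map_cons, columnWord]
    rw [wordPhi, wordF, wordE, h.1, h.2.1, h.2.2, ih.1, ih.2.1, ih.2.2, wordPhi, wordF, wordE]
    refine ⟨rfl, ?_, ?_⟩ <;> split_ifs <;>
      simp [Option.map_map, Function.comp_def, columnWord]

/-- A bottom row of letters `bar 1` can be ignored. -/
theorem columnWord_map_top (h1 : letterPhi n i (-1) = 0) (h2 : letterEps n i (-1) = 0)
    (A : List ℤ) :
    wordPhi n i (columnWord (A.map fun x => (x, -1))) = wordPhi n i A ∧
    wordF n i (columnWord (A.map fun x => (x, -1))) =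
      (wordF n i A).map (fun A => columnWord (A.map fun x => (x, -1))) ∧
    wordE n i (columnWord (A.map fun x => (x, -1))) =
      (wordE n i A).map (fun A => columnWord (A.map fun x => (x, -1))) := by
  induction A with
  | nil => simp [columnWord, wordPhi, wordF, wordE]
  | cons x A ih =>
    simp only [List.map_cons, columnWord]
    have h := wordF_cons_of_neutral h1 h2 (x :: columnWord (A.map fun x => (x, -1)))
    rw [h.1, h.2.1, h.2.2, wordPhi, wordF, wordE, ih.1, ih.2.1, ih.2.2, wordPhi, wordF, wordE]
    refine ⟨rfl, ?_, ?_⟩ <;> split_ifs <;>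
      simp [Option.map_map, Function.comp_def, columnWord]

/-- `Ψ` embeds the branching crystal of one-row words of length `k` into the two-row arrays with
`m` columns, the highest weight vector `2^k` being sent to a vector of `ε₁`-weight `c`. -/
structure IsModel (n k m : ℕ) (c : ℤ) (Ψ : List ℤ → List (ℤ × ℤ)) : Prop where
  tabF_eq : ∀ i, 2 ≤ i → i ≤ n → ∀ A, tabF n i (Ψ A) = (wordF n i A).map Ψ
  tabE_eq : ∀ i, 2 ≤ i → i ≤ n → ∀ A, tabE n i (Ψ A) = (wordE n i A).map Ψ
  injective : Function.Injective Ψ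
  isKN_base : IsKN n (Ψ (List.replicate k 2))
  length_base : (Ψ (List.replicate k 2)).length = m
  sorted : ∀ A, IsTableau n (Ψ A) → (∀ x ∈ A, IsLetter n x) ∧ A.Pairwise (le n)
  weight_one : wordWeight (columnWord (Ψ (List.replicate k 2))) 1 = c
  weight_two : wordWeight (columnWord (Ψ (List.replicate k 2))) 2 = k
  weight_ge : ∀ j, 3 ≤ j → wordWeight (columnWord (Ψ (List.replicate k 2))) j = 0

/-- One-row words placed beside letters `±1` and between neutral arrays form a model. -/
theorem isModel_of_neutral {L R : List (ℤ × ℤ)} {f : ℤ → ℤ × ℤ} (hn : 4 ≤ n)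
    (hL : ∀ i, 2 ≤ i → i ≤ n → Neutral n i (columnWord L))
    (hR : ∀ i, 2 ≤ i → i ≤ n → Neutral n i (columnWord R))
    (hf : f = (fun x => (1, x)) ∨ f = fun x => (x, -1)) {p q r t m : ℕ} {c : ℤ}
    (hb : L ++ (List.replicate k 2).map f ++ R = blocks p q r t) (hr : r ≤ 1)
    (hm : p + q + r + t = m) (h1 : (p : ℤ) + q - t = c) (h2 : (p : ℤ) - q + t = k) :
    IsModel n k m c (fun A => L ++ A.map f ++ R) := by
  have key : ∀ i, 2 ≤ i → i ≤ n → ∀ A : List ℤ,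
      wordF n i (columnWord (A.map f)) = (wordF n i A).map (fun A => columnWord (A.map f)) ∧
      wordE n i (columnWord (A.map f)) = (wordE n i A).map (fun A => columnWord (A.map f)) := by
    intro i h2 hin A
    rcases hf with rfl | rfl
    · have h := letter_one_neutral hn h2 hin (z := 1) (Or.inl rfl)
      exact (columnWord_map_bottom h.1 h.2 A).2
    · have h := letter_one_neutral hn h2 hin (z := -1) (Or.inr rfl)
      exact (columnWord_map_top h.1 h.2 A).2
  have hof : ∀ A : List ℤ, ofColumnWord (columnWord L ++ columnWord (A.map f) ++ columnWord R) =
      L ++ A.map f ++ R := by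
    intro A
    rw [← columnWord_append, ← columnWord_append, ofColumnWord_columnWord]
  have hw := wordWeight_blocks p q r t
  refine ⟨?_, ?_, ?_, ?_, ?_, ?_, ?_, ?_, ?_⟩
  · intro i h2 hin A
    rw [tabF, columnWord_append, columnWord_append,
      (neutral_append_right (hR i h2 hin) _).2.1, (hL i h2 hin _).2.1, (key i h2 hin A).1]
    simp only [Option.map_map, Function.comp_def, hof]
  · intro i h2 hin A
    rw [tabE, columnWord_append, columnWord_append,
      (neutral_append_right (hR i h2 hin) _).2.2, (hL i h2 hin _).2.2, (key i h2 hin A).2]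
    simp only [Option.map_map, Function.comp_def, hof]
  · intro A A' h
    simp only [List.append_cancel_right_eq, List.append_cancel_left_eq] at h
    refine List.map_injective_iff.2 ?_ h
    rcases hf with rfl | rfl <;> intro x y h <;> simpa using h
  · rw [hb]; exact isKN_blocks hn hr
  · rw [hb, length_blocks, hm]
  · intro A hA
    have hA' : IsTableau n (A.map f) := hA.sublist (by simp)
    have hpw := hA'.pairwise
    rw [List.pairwise_map] at hpw
    rcases hf with rfl | rfl
    · exact ⟨fun x hx => (hA'.letters _ (List.mem_map_of_mem hx)).2, hpw.imp fun h => h.2⟩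
    · exact ⟨fun x hx => (hA'.letters _ (List.mem_map_of_mem hx)).1, hpw.imp fun h => h.1⟩
  · rw [hb, hw.1, h1]
  · rw [hb, hw.2.1, h2]
  · rw [hb]; exact hw.2.2

theorem isModel_top (hn : 4 ≤ n) (k : ℕ) : IsModel n k k k (fun A => A.map fun x => (1, x)) := by
  have := isModel_of_neutral (k := k) (m := k) (c := k) (L := []) (R := [])
    (f := fun x => (1, x)) (p := k) (q := 0) (r := 0) (t := 0) hn
    (fun _ _ _ => neutral_nil) (fun _ _ _ => neutral_nil) (Or.inl rfl) (by simp [blocks])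
    (by omega) (by omega) (by simp) (by simp)
  simpa using this

theorem isModel_bottom (hn : 4 ≤ n) (k : ℕ) :
    IsModel n k k (-k) (fun A => A.map fun x => (x, -1)) := by
  have := isModel_of_neutral (k := k) (m := k) (c := -k) (L := []) (R := [])
    (f := fun x => (x, -1)) (p := 0) (q := 0) (r := 0) (t := k) hn
    (fun _ _ _ => neutral_nil) (fun _ _ _ => neutral_nil) (Or.inr rfl) (by simp [blocks])
    (by omega) (by omega) (by simp) (by simp)
  simpa using this

theorem isModel_core_append (hn : 4 ≤ n) {k q r : ℕ} (hr : r ≤ 1) (hs : 2 * q + r + k = s) :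
    IsModel n k s (-k) (fun A => blocks 0 q r q ++ A.map fun x => (x, -1)) := by
  have := isModel_of_neutral (k := k) (m := s) (c := -k) (L := blocks 0 q r q) (R := [])
    (f := fun x => (x, -1)) (p := 0) (q := q) (r := r) (t := q + k) hn
    (fun i h2 hin => neutral_core hn h2 hin q r) (fun _ _ _ => neutral_nil) (Or.inr rfl)
    (by simp [blocks])
    hr (by omega) (by push_cast; ring) (by push_cast; ring)
  simpa using this

theorem isModel_append_core (hn : 4 ≤ n) {k q r : ℕ} (hr : r ≤ 1) (hs : 2 * q + r + k = s) :
    IsModel n k s k (fun A => (A.map fun x => (1, x)) ++ blocks 0 q r q) := by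
  have := isModel_of_neutral (k := k) (m := s) (c := k) (R := blocks 0 q r q) (L := [])
    (f := fun x => (1, x)) (p := k) (q := q) (r := r) (t := q) hn
    (fun _ _ _ => neutral_nil) (fun i h2 hin => neutral_core hn h2 hin q r) (Or.inl rfl)
    (by simp [blocks])
    hr (by omega) (by ring) (by ring)
  simpa using this

theorem wordE_replicate_two (hn : 4 ≤ n) (h2 : 2 ≤ i) (hin : i ≤ n) (k : ℕ) :
    wordE n i (List.replicate k 2) = none := by
  induction k with
  | zero => rfl
  | succ k ih =>
    rw [List.replicate_succ, wordE_cons_eq_none_iff, (letter_two hn h2 hin).1]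
    exact ⟨ih, Nat.zero_le _⟩

theorem ne_one_of_wordF (hn : 4 ≤ n) (h2 : 2 ≤ i) (hin : i ≤ n) {A A' : List ℤ}
    (h : wordF n i A = some A') :
    A.length = A'.length ∧ ((∀ z ∈ A, z ≠ 1 ∧ z ≠ -1) ↔ ∀ z ∈ A', z ≠ 1 ∧ z ≠ -1) := by
  obtain ⟨p, x, y, q, rfl, rfl, hxy, -, -⟩ :=
    (wordF_eq_some_iff (by omega) (by omega) hin).1 h
  rw [letterF_eq_some_iff (by omega) hin] at hxy
  have hx : x ≠ 1 ∧ x ≠ -1 := by omega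
  have hy : y ≠ 1 ∧ y ≠ -1 := by omega
  refine ⟨by simp, ?_⟩
  simp only [List.mem_append, List.mem_cons, or_imp, forall_and, forall_eq]
  tauto

variable {m : ℕ} {c : ℤ} {Ψ : List ℤ → List (ℤ × ℤ)}

/-- A branching component that contains a vector of a model consists of vectors of the model. -/
theorem IsModel.exists_word (M : IsModel n k m c Ψ) (hn : 4 ≤ n) {b x : Tab n s} {A : List ℤ}
    (hb : drop b = Ψ A) (hA : A.length = k ∧ ∀ z ∈ A, z ≠ 1 ∧ z ≠ -1)
    (h : vertexOf b = vertexOf x) :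
    ∃ A, drop x = Ψ A ∧ A.length = k ∧ ∀ z ∈ A, z ≠ 1 ∧ z ≠ -1 := by
  refine branching_induction
    (P := fun x => ∃ A, drop x = Ψ A ∧ A.length = k ∧ ∀ z ∈ A, z ≠ 1 ∧ z ≠ -1) h ?_ ⟨A, hb, hA⟩
  intro i h2 hin x y hxy
  rw [classicalF_eq_some_iff hn (by omega) hin] at hxy
  constructor
  · rintro ⟨A, h1, h3, h4⟩
    rw [h1, M.tabF_eq i h2 hin, Option.map_eq_some_iff] at hxy
    obtain ⟨A', hA', h5⟩ := hxy
    have h6 := ne_one_of_wordF hn h2 hin hA'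
    exact ⟨A', h5.symm, by rw [← h6.1, h3], h6.2.1 h4⟩
  · rintro ⟨A, h1, h3, h4⟩
    rw [← tabE_eq_some_iff (by omega) (by omega) hin, h1, M.tabE_eq i h2 hin,
      Option.map_eq_some_iff] at hxy
    obtain ⟨A', hA', h5⟩ := hxy
    rw [wordE_eq_some_iff_wordF (by omega) (by omega) hin] at hA'
    have h6 := ne_one_of_wordF hn h2 hin hA'
    exact ⟨A', h5.symm, by rw [h6.1, h3], h6.2.2 h4⟩

/-- A branching highest weight vector that belongs to a model is the image of `2^k`. -/
theorem IsModel.eq_base (M : IsModel n k m c Ψ) (hn : 4 ≤ n) {x : Tab n s} {A : List ℤ}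
    (hx : drop x = Ψ A) (hA : A.length = k ∧ ∀ z ∈ A, z ≠ 1 ∧ z ≠ -1)
    (h : IsBranchHighest x) : drop x = Ψ (List.replicate k 2) := by
  have hE : ∀ i, 2 ≤ i → i ≤ n → wordE n i A = none := by
    intro i h2 hin
    have := (classicalE_eq_none_iff hn (by omega) hin).1 (h i h2 hin)
    rwa [← tabE_eq_none_iff, hx, M.tabE_eq i h2 hin, Option.map_eq_none_iff] at this
  obtain ⟨hlet, hpw⟩ := M.sorted A (hx ▸ (isKN_drop x).toIsTableau)
  rw [hx]
  congr 1
  refine List.eq_replicate_iff.2 ⟨hA.1, fun y hy => ?_⟩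
  obtain ⟨A', z, rfl⟩ := List.eq_nil_or_concat' A |>.resolve_left (by rintro rfl; simp at hy)
  have hz : z = 2 := by
    have := eq_of_forall_letterEps_eq_zero hn (hlet z (by simp)) fun i h2 hin => by
      have h3 := (wordE_cons_eq_none_iff.1 (wordE_eq_none_of_append (hE i h2 hin))).2
      simpa [wordPhi] using h3
    have h4 := hA.2 z (by simp)
    omega
  subst hz
  rw [List.pairwise_append] at hpw
  rcases List.mem_append.1 hy with hy' | hy'
  · have h1 := hpw.2.2 y hy' 2 (by simp)
    have h2 := (hlet y hy).height_eq
    have h3 := height_two (n := n)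
    have h4 := hA.2 y hy
    unfold le at h1
    omega
  · simpa using hy'

theorem base_ne_one (k : ℕ) : (List.replicate k (2 : ℤ)).length = k ∧
    ∀ z ∈ List.replicate k (2 : ℤ), z ≠ 1 ∧ z ≠ -1 := by
  refine ⟨by simp, fun z hz => ?_⟩
  rw [(List.mem_replicate.1 hz).2]
  omega

/-- The branching highest weight vector of a model is unique. -/
theorem IsModel.eq_base_of_vertexOf_eq (M : IsModel n k m c Ψ) (hn : 4 ≤ n) {b x : Tab n s}
    (hb : drop b = Ψ (List.replicate k 2)) (h : vertexOf b = vertexOf x)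
    (hx : IsBranchHighest x) : x = b := by
  obtain ⟨A, h1, h2⟩ := M.exists_word hn hb (base_ne_one k) h
  exact drop_injective ((M.eq_base hn h1 h2 hx).trans hb.symm)

theorem IsModel.isBranchHighest (M : IsModel n k m c Ψ) (hn : 4 ≤ n) {b : Tab n s}
    (hb : drop b = Ψ (List.replicate k 2)) : IsBranchHighest b := by
  intro i h2 hin
  rw [classicalE_eq_none_iff hn (by omega) hin, ← tabE_eq_none_iff, hb, M.tabE_eq i h2 hin,
    wordE_replicate_two hn h2 hin, Option.map_none]

theorem IsModel.exists_base (M : IsModel n k m c Ψ) (hn : 4 ≤ n) (hm : m ≤ s) :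
    ∃ b : Tab n s, drop b = Ψ (List.replicate k 2) :=
  exists_drop_eq (by omega) M.isKN_base (M.length_base.trans_le hm)

/-- `f_{i₁} ⋯ f_{iₘ}` on words. -/
def applyWordF (n : ℕ) : List ℕ → List ℤ → Option (List ℤ)
  | [], w => some w
  | i :: I, w => (applyWordF n I w).bind (wordF n i)

theorem IsModel.applyF_eq (M : IsModel n k m c Ψ) (hn : 4 ≤ n) {I : List ℕ}
    (hI : ∀ i ∈ I, 2 ≤ i ∧ i ≤ n) {x b : Tab n s} {A : List ℤ} (hx : drop x = Ψ A)
    (h : applyF I x = some b) : ∃ A', applyWordF n I A = some A' ∧ drop b = Ψ A' := by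
  induction I generalizing b with
  | nil =>
    simp only [applyF, Option.some.injEq] at h
    exact ⟨A, rfl, h ▸ hx⟩
  | cons i I ih =>
    rw [applyF, Option.bind_eq_some_iff] at h
    obtain ⟨b', h1, h2⟩ := h
    obtain ⟨A', h3, h4⟩ := ih (fun j hj => hI j (by simp [hj])) h1
    obtain ⟨hi, hin⟩ := hI i (by simp)
    rw [classicalF_eq_some_iff hn (by omega) hin, h4, M.tabF_eq i hi hin,
      Option.map_eq_some_iff] at h2
    obtain ⟨A'', h5, h6⟩ := h2
    exact ⟨A'', by rw [applyWordF, h3, Option.bind_some, h5], h6.symm⟩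

theorem IsModel.exists_applyF_eq (M : IsModel n k m c Ψ) (hn : 4 ≤ n) {I : List ℕ}
    (hI : ∀ i ∈ I, 2 ≤ i ∧ i ≤ n) {x : Tab n s} {A A' : List ℤ} (hx : drop x = Ψ A)
    (h : applyWordF n I A = some A') : ∃ b, applyF I x = some b ∧ drop b = Ψ A' := by
  induction I generalizing A' with
  | nil =>
    simp only [applyWordF, Option.some.injEq] at h
    exact ⟨x, rfl, h ▸ hx⟩
  | cons i I ih =>
    rw [applyWordF, Option.bind_eq_some_iff] at h
    obtain ⟨A₁, h1, h2⟩ := h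
    obtain ⟨b', h3, h4⟩ := ih (fun j hj => hI j (by simp [hj])) h1
    obtain ⟨hi, hin⟩ := hI i (by simp)
    have h5 : tabF n i (drop b') = some (Ψ A') := by
      rw [h4, M.tabF_eq i hi hin, h2, Option.map_some]
    obtain ⟨b, hb⟩ := exists_drop_eq (s := s) (by omega)
      ((isKN_drop b').tabF hn (by omega) hin h5)
      ((length_of_tabF (by omega) (by omega) hin h5).trans_le (length_drop_le b'))
    refine ⟨b, ?_, hb⟩
    rw [applyF, h3, Option.bind_some, classicalF_eq_some_iff hn (by omega) hin, h5, hb]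

theorem vertexOf_eq_of_applyF {I : List ℕ} (hI : ∀ i ∈ I, 2 ≤ i ∧ i ≤ n) {x b : Tab n s}
    (h : applyF I x = some b) : vertexOf x = vertexOf b := by
  induction I generalizing b with
  | nil =>
    simp only [applyF, Option.some.injEq] at h
    rw [h]
  | cons i I ih =>
    rw [applyF, Option.bind_eq_some_iff] at h
    obtain ⟨b', h1, h2⟩ := h
    obtain ⟨hi, hin⟩ := hI i (by simp)
    rw [ih (fun j hj => hI j (by simp [hj])) h1, vertexOf_eq_of_classicalF hi hin h2]

end Model

/-! ### The involution on branching components of one-row shape -/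

section Sigma

variable {n s k m m' : ℕ} {c : ℤ} {Ψ Ψ' Ψ'' : List ℤ → List (ℤ × ℤ)}

/-- A column contains the letter `2` at most once. -/
theorem IsTableau.wordWeight_two_le {t : List (ℤ × ℤ)} (ht : IsTableau n t) :
    wordWeight (columnWord t) 2 ≤ t.length := by
  have hcol := ht.columns
  clear ht
  induction t with
  | nil => simp [columnWord, wordWeight]
  | cons d t ih =>
    have h1 := ih fun e he => hcol e (by simp [he])
    have h2 : ¬ (d.1 = 2 ∧ d.2 = 2) := fun h => hcol d (by simp) (Or.inl (h.2.trans h.1.symm))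
    rw [columnWord, wordWeight_cons, wordWeight_cons d.1, wordWeight_singleton,
      wordWeight_singleton, List.length_cons]
    push_cast
    split_ifs <;> omega

theorem IsModel.weight_base (M : IsModel n k m c Ψ) {x : Tab n s}
    (hx : drop x = Ψ (List.replicate k 2)) :
    weight x 1 = c ∧ weight x 2 = k ∧ ∀ j, 3 ≤ j → weight x j = 0 := by
  simp only [weight_eq, hx]
  exact ⟨M.weight_one, M.weight_two, M.weight_ge⟩

theorem IsModel.inB_base (M : IsModel n k m c Ψ) {x : Tab n s}
    (hx : drop x = Ψ (List.replicate k 2)) : InB m x := by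
  rw [InB, hx, M.length_base]

theorem IsModel.weight_eq_weight (M : IsModel n k m c Ψ) {c' : ℤ} (M' : IsModel n k m' c' Ψ')
    {x y : Tab n s} (hx : drop x = Ψ (List.replicate k 2))
    (hy : drop y = Ψ' (List.replicate k 2)) {j : ℕ} (hj : 2 ≤ j) : weight x j = weight y j := by
  obtain ⟨-, h1, h2⟩ := M.weight_base hx
  obtain ⟨-, h1', h2'⟩ := M'.weight_base hy
  rcases hj.eq_or_lt with rfl | hj
  · rw [h1, h1']
  · rw [h2 j hj, h2' j hj]

/-- A component of shape `k` has at least `k` columns, and the model `Ψ''` attains this bound. -/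
theorem IsModel.isLeast (hn : 4 ≤ n) (M : IsModel n k m c Ψ) (M'' : IsModel n k k c Ψ'')
    (hk : k ≤ s) {x : Tab n s} (hx : drop x = Ψ (List.replicate k 2)) {p : ℕ}
    (hp : (p : ℤ) = s - c) :
    IsLeast {j : ℕ | ∃ w : BCVertex n s, InBC j w ∧ HasRank w p ∧ SameShape (vertexOf x) w} k := by
  constructor
  · obtain ⟨z, hz⟩ := M''.exists_base hn hk
    refine ⟨vertexOf z, (inBC_vertexOf_iff hn).2 (M''.inB_base hz),
      (hasRank_iff hn).2 (by rw [(M''.weight_base hz).1, hp]), x, z, rfl, rfl,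
      M.isBranchHighest hn hx, M''.isBranchHighest hn hz,
      fun j hj _ => M.weight_eq_weight M'' hx hz hj⟩
  · rintro j ⟨w, hw, -, x₀, y₀, hx₀, rfl, hbx, -, hwt⟩
    obtain rfl := M.eq_base_of_vertexOf_eq hn hx hx₀.symm hbx
    rw [inBC_vertexOf_iff hn, InB] at hw
    have h1 := hwt 2 le_rfl (by omega)
    rw [(M.weight_base hx).2.1, weight_eq] at h1
    have h2 := (isKN_drop y₀).toIsTableau.wordWeight_two_le
    omega

/-- The component that `σ` assigns to that of a model of weight `c` is the component of the model
of weight `-c`, whose number of columns is complementary; the model `Ψ''` with `k` columns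
realizes the minimal `ℓ = k`. -/
theorem IsModel.isSigmaCheck_iff (hn : 4 ≤ n) (M : IsModel n k m c Ψ)
    (M' : IsModel n k m' (-c) Ψ') (M'' : IsModel n k k c Ψ'') (hk : k ≤ s)
    (hm : m + m' = s + k) (hc : |c| ≤ s) {x y : Tab n s}
    (hx : drop x = Ψ (List.replicate k 2)) (hy : drop y = Ψ' (List.replicate k 2))
    {w : BCVertex n s} : IsSigmaCheck (vertexOf x) w ↔ w = vertexOf y := by
  have hx1 := (M.weight_base hx).1
  have hy1 := (M'.weight_base hy).1
  rw [abs_le] at hc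
  constructor
  · rintro ⟨k₀, l, p, k', p', h1, h2, h3, h4, h5, h6, h7, x₀, y₀, hx₀, rfl, hbx, hby, hwt⟩
    obtain rfl := M.eq_base_of_vertexOf_eq hn hx hx₀.symm hbx
    rw [inBC_vertexOf_iff hn, InB] at h1 h6
    rw [hasRank_iff hn] at h2 h7
    obtain rfl := (IsLeast.unique h3 (M.isLeast hn M'' hk hx (by omega)))
    have hx0 := M.inB_base hx
    have hy0 := M'.inB_base hy
    rw [InB] at hx0 hy0
    have hwt' : ∀ j, 2 ≤ j → j ≤ n → weight y₀ j = weight y j := fun j hj hjn => by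
      rw [← hwt j hj hjn, M.weight_eq_weight M' hx hy hj]
    have hmem : ∀ z : Tab n s, IsBranchHighest z → (∀ j, 3 ≤ j → j ≤ n → weight z j = 0) →
        ∀ d ∈ drop z, d = (1, 2) ∨ d = (1, -2) ∨ d = (2, -2) ∨ d = (2, -1) := by
      intro z hz hzw
      refine (isKN_drop z).mem_of_branchHighest hn (fun i h2 hin => ?_) fun j hj hjn => ?_
      · exact (classicalE_eq_none_iff hn (by omega) hin).1 (hz i h2 hin)
      · rw [← weight_eq, hzw j hj hjn]
    have hyw := (M'.weight_base hy).2.2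
    have : drop y₀ = drop y := by
      refine (isKN_drop y₀).eq_of_branchHighest (isKN_drop y)
        (hmem y₀ hby fun j hj hjn => ?_)
        (hmem y (M'.isBranchHighest hn hy) fun j hj _ => hyw j hj) (by omega) ?_ ?_
      · rw [hwt' j (by omega) hjn, hyw j hj]
      · rw [← weight_eq, ← weight_eq]; omega
      · rw [← weight_eq, ← weight_eq]; exact hwt' 2 le_rfl (by omega)
    rw [drop_injective this]
  · rintro rfl
    refine ⟨m, k, (s - c).toNat, m', (s + c).toNat, (inBC_vertexOf_iff hn).2 (M.inB_base hx),
      (hasRank_iff hn).2 (by omega), M.isLeast hn M'' hk hx (by omega), by omega, by omega,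
      (inBC_vertexOf_iff hn).2 (M'.inB_base hy), (hasRank_iff hn).2 (by omega), x, y, rfl, rfl,
      M.isBranchHighest hn hx, M'.isBranchHighest hn hy,
      fun j hj _ => M.weight_eq_weight M' hx hy hj⟩

/-- On components of one-row shape, `σ` exchanges the two models of opposite `ε₁`-weight. -/
theorem IsModel.sigma_eq (hn : 4 ≤ n) (M : IsModel n k m c Ψ) (M' : IsModel n k m' (-c) Ψ')
    (M'' : IsModel n k k c Ψ'') (hk : k ≤ s) (hm : m + m' = s + k) (hms : m ≤ s) (hms' : m' ≤ s)
    (hc : |c| ≤ s) {I : List ℕ} (hI : ∀ i ∈ I, 2 ≤ i ∧ i ≤ n) {A : List ℤ}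
    (hA : applyWordF n I (List.replicate k 2) = some A) {b b' : Tab n s}
    (hb : drop b = Ψ A) (hb' : drop b' = Ψ' A) : sigma b = b' := by
  obtain ⟨x, hx⟩ := M.exists_base hn hms
  obtain ⟨y, hy⟩ := M'.exists_base hn hms'
  obtain ⟨b₀, hxb, hb₀⟩ := M.exists_applyF_eq hn hI hx hA
  obtain ⟨b₀', hyb, hb₀'⟩ := M'.exists_applyF_eq hn hI hy hA
  obtain rfl := drop_injective (hb.trans hb₀.symm)
  obtain rfl := drop_injective (hb'.trans hb₀'.symm)
  have hvb := vertexOf_eq_of_applyF hI hxb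
  have hvb' := vertexOf_eq_of_applyF hI hyb
  have hcheck := fun w => M.isSigmaCheck_iff hn M' M'' hk hm hc hx hy (w := w)
  have hex : ∃ d, IsSigma b d :=
    ⟨b', by rw [← hvb, hcheck, hvb'], x, y, I, M.isBranchHighest hn hx, M'.isBranchHighest hn hy,
      hI, hxb, hyb⟩
  rw [sigma, dif_pos hex]
  obtain ⟨h1, x₁, y₁, J, hbx, hby, hJ, hxJ, hyJ⟩ := hex.choose_spec
  rw [← hvb, hcheck] at h1
  obtain rfl := M.eq_base_of_vertexOf_eq hn hx (hvb.trans (vertexOf_eq_of_applyF hJ hxJ).symm) hbx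
  obtain rfl := M'.eq_base_of_vertexOf_eq hn hy
    (h1.symm.trans (vertexOf_eq_of_applyF hJ hyJ).symm) hby
  obtain ⟨A₁, hA₁, h2⟩ := M.applyF_eq hn hJ hx hxJ
  obtain ⟨A₂, hA₂, h3⟩ := M'.applyF_eq hn hJ hy hyJ
  obtain rfl := Option.some.inj (hA₁.symm.trans hA₂)
  obtain rfl := M.injective (hb.symm.trans h2)
  exact drop_injective (h3.trans hb'.symm)

end Sigma

/-! ### The lowest weight vector of the one-row crystal -/

section Path

variable {n i k : ℕ}

theorem applyWordF_append (I J : List ℕ) (w : List ℤ) :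
    applyWordF n (I ++ J) w = (applyWordF n J w).bind (applyWordF n I) := by
  induction I with
  | nil => simp [applyWordF]
  | cons i I ih => rw [List.cons_append, applyWordF, ih, Option.bind_assoc]; rfl

theorem applyWordF_replicate (hn : 2 ≤ n) (hi : 1 ≤ i) (hin : i ≤ n) {x y : ℤ}
    (h : letterF n i x = some y) (a b : ℕ) :
    applyWordF n (List.replicate a i) (List.replicate a x ++ List.replicate b y) =
      some (List.replicate (a + b) y) := by
  obtain ⟨hx, hy⟩ : letterEps n i x = 0 ∧ letterPhi n i y = 0 := by
    have h1 := string_of_letterF hn hi hin h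
    omega
  induction a generalizing b with
  | zero => simp [applyWordF]
  | succ a ih =>
    have hstep : wordF n i (List.replicate (a + 1) x ++ List.replicate b y) =
        some (List.replicate a x ++ List.replicate (b + 1) y) := by
      rw [wordF_eq_some_iff hn hi hin]
      refine ⟨List.replicate a x, x, y, List.replicate b y, ?_, ?_, h, ?_, ?_⟩
      · rw [List.replicate_succ']; simp
      · rw [List.replicate_succ]
      · clear ih
        induction a with
        | zero => rfl
        | succ a ih => simp [List.replicate_succ, wordEps, ih, hx]
      · exact wordPhi_eq_zero_of_forall fun z hz => (List.mem_replicate.1 hz).2 ▸ hy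
    rw [List.replicate_succ', applyWordF_append]
    simp only [applyWordF, Option.bind_some, hstep]
    rw [ih, Nat.add_right_comm, Nat.add_assoc]

/-- Lowering operators of the colours `2, …, n` carry `2^k` to `bar 2^k`. -/
theorem exists_applyWordF_replicate (hn : 4 ≤ n) (k : ℕ) :
    ∃ I : List ℕ, (∀ i ∈ I, 2 ≤ i ∧ i ≤ n) ∧
      applyWordF n I (List.replicate k 2) = some (List.replicate k (-2)) := by
  let P : ℤ → ℤ → Prop := fun x y => ∃ I : List ℕ, (∀ i ∈ I, 2 ≤ i ∧ i ≤ n) ∧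
    applyWordF n I (List.replicate k x) = some (List.replicate k y)
  have step : ∀ (i : ℕ) (x y : ℤ), 2 ≤ i → i ≤ n → letterF n i x = some y → P x y := by
    intro i x y h2 hin h
    refine ⟨List.replicate k i, fun j hj => (List.mem_replicate.1 hj).2 ▸ ⟨h2, hin⟩, ?_⟩
    simpa using applyWordF_replicate (by omega) (by omega) hin h k 0
  have trans : ∀ x y z : ℤ, P x y → P y z → P x z := by
    rintro x y z ⟨I, hI, h⟩ ⟨J, hJ, h'⟩
    refine ⟨J ++ I, fun i hi => (List.mem_append.1 hi).elim (hJ i) (hI i), ?_⟩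
    rw [applyWordF_append, h, Option.bind_some, h']
  have up : ∀ j : ℕ, j + 2 ≤ n → P 2 (j + 2 : ℕ) := by
    intro j
    induction j with
    | zero => exact fun _ => ⟨[], by simp, rfl⟩
    | succ j ih =>
      refine fun hj => trans _ _ _ (ih (by omega)) (step (j + 2) _ _ (by omega) (by omega) ?_)
      rw [letterF_eq_some_iff (by omega) (by omega)]
      omega
  have down : ∀ j : ℕ, j + 3 ≤ n → P (-(j + 2 : ℕ)) (-2) := by
    intro j
    induction j with
    | zero => exact fun _ => ⟨[], by simp, rfl⟩
    | succ j ih =>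
      refine fun hj => trans _ _ _ (step (j + 2) _ _ (by omega) (by omega) ?_) (ih (by omega))
      rw [letterF_eq_some_iff (by omega) (by omega)]
      omega
  obtain ⟨j, rfl⟩ := Nat.exists_eq_add_of_le hn
  refine trans _ _ _ (up (j + 2) (by omega))
    (trans _ _ _ (step (4 + j) _ _ (by omega) le_rfl ?_) (down (j + 1) (by omega)))
  rw [letterF_eq_some_iff (by omega) (by omega)]
  omega

end Path

/-! ### The `0`-string through the extremal vectors -/

section String

variable {n s k q r t : ℕ}

theorem wordEps_eq_zero_of_forall {i : ℕ} {w : List ℤ} (h : ∀ x ∈ w, letterEps n i x = 0) :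
    wordEps n i w = 0 := by
  induction w with
  | nil => rfl
  | cons x w ih =>
    simp [wordEps, ih fun y hy => h y (by simp [hy]), h x (by simp)]

theorem wordE_eq_none_of_forall {i : ℕ} {w : List ℤ} (h : ∀ x ∈ w, letterEps n i x = 0) :
    wordE n i w = none := by
  induction w with
  | nil => rfl
  | cons x w ih =>
    rw [wordE_cons_eq_none_iff, h x (by simp)]
    exact ⟨ih fun y hy => h y (by simp [hy]), Nat.zero_le _⟩

theorem letter_colour_one (hn : 4 ≤ n) :
    (∀ x : ℤ, x = 1 ∨ x = -2 → letterEps n 1 x = 0) ∧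
    ∀ x : ℤ, x = 2 ∨ x = -1 → letterPhi n 1 x = 0 := by
  have hin : 1 ≤ n := by omega
  constructor
  · intro x hx
    have h1 := letterEps_eq_one_iff' hin (x := x)
    have h2 := letterEps_le_one (n := n) (i := 1) x
    push_cast at h1
    omega
  · intro x hx
    have h1 := letterPhi_eq_one_iff' hin (x := x)
    have h2 := letterPhi_le_one (n := n) (i := 1) x
    push_cast at h1
    omega

theorem letter_of_mem_columnWord_blocks_left {x : ℤ}
    (hx : x ∈ columnWord (blocks 0 q 0 0)) : x = 1 ∨ x = -2 := by
  obtain ⟨d, hd, h⟩ := mem_columnWord.1 hx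
  simp only [blocks, List.replicate_zero, List.nil_append, List.append_nil,
    List.mem_replicate] at hd
  obtain ⟨-, rfl⟩ := hd
  omega

theorem letter_of_mem_columnWord_blocks_right {x : ℤ}
    (hx : x ∈ columnWord (blocks 0 0 0 t)) : x = 2 ∨ x = -1 := by
  obtain ⟨d, hd, h⟩ := mem_columnWord.1 hx
  simp only [blocks, List.replicate_zero, List.nil_append, List.mem_replicate] at hd
  obtain ⟨-, rfl⟩ := hd
  omega

/-- The operator `f₁` changes the last column `(1, bar 2)` to `(2, bar 2)`. -/
theorem tabF_one_blocks_zero (hn : 4 ≤ n) (q t : ℕ) :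
    tabF n 1 (blocks 0 (q + 1) 0 t) = some (blocks 0 q 1 t) := by
  obtain ⟨hE, hP⟩ := letter_colour_one hn
  rw [tabF_eq_some_iff (by omega) le_rfl (by omega), wordF_eq_some_iff (by omega) le_rfl (by omega)]
  refine ⟨columnWord (blocks 0 q 0 0) ++ [-2], 1, 2, columnWord (blocks 0 0 0 t), ?_, ?_, ?_,
    wordEps_eq_zero_of_forall fun x hx => hE x ?_,
    wordPhi_eq_zero_of_forall fun x hx => hP x (letter_of_mem_columnWord_blocks_right hx)⟩
  · simp [blocks, List.replicate_succ', columnWord_append, columnWord]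
  · simp [blocks, columnWord_append, columnWord]
  · rw [letterF_eq_some_iff le_rfl (by omega)]
    omega
  · rcases List.mem_append.1 hx with hx | hx
    · exact letter_of_mem_columnWord_blocks_left hx
    · exact Or.inr (by simpa using hx)

/-- The operator `f₁` changes the column `(2, bar 2)` to `(2, bar 1)`. -/
theorem tabF_one_blocks_one (hn : 4 ≤ n) (q t : ℕ) :
    tabF n 1 (blocks 0 q 1 t) = some (blocks 0 q 0 (t + 1)) := by
  obtain ⟨hE, hP⟩ := letter_colour_one hn
  rw [tabF_eq_some_iff (by omega) le_rfl (by omega), wordF_eq_some_iff (by omega) le_rfl (by omega)]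
  refine ⟨columnWord (blocks 0 q 0 0), -2, -1, 2 :: columnWord (blocks 0 0 0 t), ?_, ?_, ?_,
    wordEps_eq_zero_of_forall fun x hx => hE x (letter_of_mem_columnWord_blocks_left hx),
    wordPhi_eq_zero_of_forall fun x hx => hP x ?_⟩
  · simp [blocks, columnWord_append, columnWord]
  · simp [blocks, List.replicate_succ, columnWord_append, columnWord]
  · rw [letterF_eq_some_iff le_rfl (by omega)]
    omega
  · rcases List.mem_cons.1 hx with hx | hx
    · exact Or.inl hx
    · exact letter_of_mem_columnWord_blocks_right hx

/-- The vector at position `j` of the `1`-string of length `2s` through `(1, bar 2)^s`. -/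
def oneString (s j : ℕ) : List (ℤ × ℤ) := blocks 0 (s - (j + 1) / 2) (j % 2) (j / 2)

/-- The vector at position `j` of the `0`-string through the highest and lowest weight vectors of
the components `B(k ϖ₂)`: it is `(bar 2, bar 1)^(s - j)` for `j ≤ s` and `(1, 2)^(j - s)` for
`j ≥ s` (the truncated subtractions leave one of the two factors). -/
def zeroString (s j : ℕ) : List (ℤ × ℤ) :=
  List.replicate (j - s) (1, 2) ++ List.replicate (s - j) (-2, -1)

theorem zeroString_add (s k : ℕ) : zeroString s (s + k) = List.replicate k (1, 2) := by
  simp [zeroString]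

theorem zeroString_sub (hk : k ≤ s) : zeroString s (s - k) = List.replicate k (-2, -1) := by
  simp [zeroString, show s - (s - k) = k by omega]

theorem exists_drop_eq_oneString (hn : 4 ≤ n) {j : ℕ} (hj : j ≤ 2 * s) :
    ∃ T : Tab n s, drop T = oneString s j :=
  exists_tab_of_blocks hn (by omega) (by omega)

theorem exists_drop_eq_zeroString (hn : 4 ≤ n) {j : ℕ} (hj : j ≤ 2 * s) :
    ∃ T : Tab n s, drop T = zeroString s j := by
  rcases le_total s j with h | h
  · obtain ⟨k, rfl⟩ := Nat.exists_eq_add_of_le h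
    obtain ⟨T, hT⟩ := (isModel_top hn k).exists_base (s := s) hn (by omega)
    exact ⟨T, by simpa [zeroString_add] using hT⟩
  · obtain ⟨k, rfl⟩ := Nat.exists_eq_add_of_le h
    obtain ⟨I, hI, hA⟩ := exists_applyWordF_replicate hn k
    have M := isModel_bottom hn k
    obtain ⟨x, hx⟩ := M.exists_base (s := j + k) hn (by omega)
    obtain ⟨T, -, hT⟩ := M.exists_applyF_eq hn hI hx hA
    exact ⟨T, by simpa [zeroString] using hT⟩

theorem classicalF_one_oneString (hn : 4 ≤ n) {j : ℕ} (hj : j < 2 * s) {b c : Tab n s}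
    (hb : drop b = oneString s j) (hc : drop c = oneString s (j + 1)) :
    classicalF 1 b = some c := by
  rw [classicalF_eq_some_iff hn le_rfl (by omega), hb, hc]
  obtain ⟨t, rfl | rfl⟩ := Nat.even_or_odd' j
  · have h := tabF_one_blocks_zero hn (s - (t + 1)) t
    unfold oneString
    convert h using 3 <;> omega
  · have h := tabF_one_blocks_one hn (s - (t + 1)) t
    unfold oneString
    convert h using 3 <;> omega

theorem classicalF_one_oneString_last (hn : 4 ≤ n) {b : Tab n s}
    (hb : drop b = oneString s (2 * s)) : classicalF 1 b = none := by
  rw [classicalF_eq_none_iff hn le_rfl (by omega), hb, wordF_eq_none_iff]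
  have : oneString s (2 * s) = blocks 0 0 0 s := by
    unfold oneString; congr 1 <;> omega
  rw [this]
  exact wordPhi_eq_zero_of_forall fun x hx =>
    (letter_colour_one hn).2 x (letter_of_mem_columnWord_blocks_right hx)

theorem classicalE_one_oneString_zero (hn : 4 ≤ n) {b : Tab n s}
    (hb : drop b = oneString s 0) : classicalE 1 b = none := by
  rw [classicalE_eq_none_iff hn le_rfl (by omega), hb]
  exact wordE_eq_none_of_forall fun x hx =>
    (letter_colour_one hn).1 x (letter_of_mem_columnWord_blocks_left (q := s) hx)

/-- The involution `σ` exchanges the `0`-string and the `1`-string. -/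
theorem sigma_zeroString (hn : 4 ≤ n) {j : ℕ} (hj : j ≤ 2 * s) {b c : Tab n s}
    (hb : drop b = zeroString s j) (hc : drop c = oneString s j) :
    sigma b = c ∧ sigma c = b := by
  rcases le_total s j with h | h
  · obtain ⟨k, rfl⟩ := Nat.exists_eq_add_of_le h
    have hks : k ≤ s := by omega
    have M := isModel_top hn k
    have M' := isModel_core_append (s := s) (k := k) (q := (s - k) / 2) (r := (s - k) % 2) hn
      (by omega) (by omega)
    have hA : applyWordF n [] (List.replicate k 2) = some (List.replicate k 2) := rfl
    have hb' : drop b = (List.replicate k (2 : ℤ)).map fun x => (1, x) := by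
      simpa [zeroString_add] using hb
    have hc' : drop c = blocks 0 ((s - k) / 2) ((s - k) % 2) ((s - k) / 2) ++
        (List.replicate k (2 : ℤ)).map fun x => (x, -1) := by
      rw [hc, oneString, show (s + k) / 2 = (s - k) / 2 + k by omega,
        show s - (s + k + 1) / 2 = (s - k) / 2 by omega,
        show (s + k) % 2 = (s - k) % 2 by omega]
      simp [blocks]
    have hcast : |(k : ℤ)| ≤ s := by rw [Nat.abs_cast]; omega
    exact ⟨M.sigma_eq hn M' M hks (by omega) hks le_rfl hcast (by simp) hA hb' hc',
      M'.sigma_eq hn (by simpa using M) (isModel_bottom hn k) hks (by omega) le_rfl hks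
        (by rwa [abs_neg]) (by simp) hA hc' hb'⟩
  · obtain ⟨k, rfl⟩ := Nat.exists_eq_add_of_le h
    have M := isModel_bottom hn k
    have M' := isModel_append_core (s := j + k) (k := k) (q := j / 2) (r := j % 2) hn
      (by omega) (by omega)
    obtain ⟨I, hI, hA⟩ := exists_applyWordF_replicate hn k
    have hb' : drop b = (List.replicate k (-2 : ℤ)).map fun x => (x, -1) := by
      simpa [zeroString] using hb
    have hc' : drop c = ((List.replicate k (-2 : ℤ)).map fun x => (1, x)) ++
        blocks 0 (j / 2) (j % 2) (j / 2) := by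
      rw [hc, oneString, show j + k - (j + 1) / 2 = k + j / 2 by omega]
      simp [blocks, ← List.append_assoc]
    have hcast : |(k : ℤ)| ≤ (j + k : ℕ) := by rw [Nat.abs_cast]; omega
    exact ⟨M.sigma_eq hn (by simpa using M') M (by omega) (by omega) (by omega) le_rfl
        (by rwa [abs_neg]) hI hA hb' hc',
      M'.sigma_eq hn M (isModel_top hn k) (by omega) (by omega) le_rfl (by omega) hcast hI hA
        hc' hb'⟩

theorem crystalF_zero_zeroString (hn : 4 ≤ n) {j : ℕ} (hj : j < 2 * s) {b c : Tab n s}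
    (hb : drop b = zeroString s j) (hc : drop c = zeroString s (j + 1)) :
    crystalF 0 b = some c := by
  obtain ⟨b', hb'⟩ := exists_drop_eq_oneString (s := s) hn hj.le
  obtain ⟨c', hc'⟩ := exists_drop_eq_oneString (s := s) hn (show j + 1 ≤ 2 * s by omega)
  rw [crystalF, if_pos rfl, (sigma_zeroString hn hj.le hb hb').1,
    classicalF_one_oneString hn hj hb' hc', Option.map_some,
    (sigma_zeroString hn (by omega) hc hc').2]

theorem crystalE_zero_zeroString (hn : 4 ≤ n) {j : ℕ} (hj : j < 2 * s) {b c : Tab n s}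
    (hb : drop b = zeroString s j) (hc : drop c = zeroString s (j + 1)) :
    crystalE 0 c = some b := by
  obtain ⟨b', hb'⟩ := exists_drop_eq_oneString (s := s) hn hj.le
  obtain ⟨c', hc'⟩ := exists_drop_eq_oneString (s := s) hn (show j + 1 ≤ 2 * s by omega)
  rw [crystalE, if_pos rfl, (sigma_zeroString hn (by omega) hc hc').1,
    (classicalE_eq_some_iff hn le_rfl (by omega)).2 (classicalF_one_oneString hn hj hb' hc'),
    Option.map_some, (sigma_zeroString hn hj.le hb hb').2]

theorem crystalF_zero_zeroString_last (hn : 4 ≤ n) {b : Tab n s}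
    (hb : drop b = zeroString s (2 * s)) : crystalF 0 b = none := by
  obtain ⟨b', hb'⟩ := exists_drop_eq_oneString (s := s) hn le_rfl
  rw [crystalF, if_pos rfl, (sigma_zeroString hn le_rfl hb hb').1,
    classicalF_one_oneString_last hn hb', Option.map_none]

theorem crystalE_zero_zeroString_zero (hn : 4 ≤ n) {b : Tab n s}
    (hb : drop b = zeroString s 0) : crystalE 0 b = none := by
  obtain ⟨b', hb'⟩ := exists_drop_eq_oneString (s := s) hn (Nat.zero_le _)
  rw [crystalE, if_pos rfl, (sigma_zeroString hn (Nat.zero_le _) hb hb').1,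
    classicalE_one_oneString_zero hn hb', Option.map_none]

theorem dual_eq (hn : 4 ≤ n) {b c : Tab n s} (hb : drop b = List.replicate k (1, 2))
    (hc : drop c = List.replicate k (-2, -1)) : dual b = some c := by
  have h1 : letterDual n 1 = -1 := by
    rw [letterDual, if_neg]; simp only [abs_one]; omega
  have h2 : letterDual n 2 = -2 := by
    rw [letterDual, if_neg]; simp only [abs_two]; omega
  have hw : (columnWord (List.replicate k ((1 : ℤ), (2 : ℤ)))).reverse.map (letterDual n) =
      columnWord (List.replicate k (-2, -1)) := by
    clear hb hc
    induction k with
    | zero => rfl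
    | succ k ih =>
      rw [List.replicate_succ', List.replicate_succ, columnWord_append]
      simp [columnWord, h1, h2, ← ih]
  have hKN := isKN_drop c
  have hlen := length_drop_le c
  rw [hc] at hKN hlen
  rw [dual, hb, hw, ofColumnWord_columnWord, fill_eq_some_iff (by omega) hKN hlen, hc]

/-- The string length of an element of a complete string. -/
theorem isGreatest_iter {V : Type} {g : V → Option V} {z : ℕ → V} {N : ℕ}
    (h : ∀ j < N, g (z j) = some (z (j + 1))) (hN : g (z N) = none) {j : ℕ} (hj : j ≤ N) :
    IsGreatest {m : ℕ | iter g m (z j) ≠ none} (N - j) := by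
  have h1 : ∀ m, j + m ≤ N → iter g m (z j) = some (z (j + m)) := by
    intro m
    induction m with
    | zero => exact fun _ => rfl
    | succ m ih =>
      intro hm
      rw [iter, ih (by omega), Option.bind_some, h _ (by omega)]
      rfl
  have h2 : ∀ m, iter g (N - j + 1 + m) (z j) = none := by
    intro m
    induction m with
    | zero =>
      rw [Nat.add_zero, iter, h1 _ (by omega), Option.bind_some, Nat.add_sub_cancel' hj, hN]
    | succ m ih => rw [← Nat.add_assoc, iter, ih, Option.bind_none]
  refine ⟨by simp [h1 (N - j) (by omega)], fun m hm => ?_⟩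
  by_contra hlt
  obtain ⟨d, rfl⟩ := Nat.exists_eq_add_of_le (show N - j + 1 ≤ m by omega)
  exact hm (h2 d)

end String

end TypeD

theorem lemma6p3 (n s : ℕ) (hn : 4 ≤ n) (hs : 1 ≤ s) :
    ∃ u uStar : ℕ → TypeD.Tab n s,
      -- `u k` is the unique highest weight vector of `B(k ϖ₂)`,
      -- and `uStar k`, the dual of `u k`, is the unique lowest weight vector
      (∀ k ≤ s, (∀ b, TypeD.IsHighest k b ↔ b = u k) ∧
        (∀ b, TypeD.IsLowest k b ↔ b = uStar k) ∧
        TypeD.dual (u k) = some (uStar k)) ∧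
      (∀ k < s, TypeD.crystalF 0 (u k) = some (u (k + 1))) ∧
      TypeD.crystalF 0 (u s) = none ∧
      (∀ k, 0 < k → k ≤ s → TypeD.crystalE 0 (u k) = some (u (k - 1))) ∧
      (∀ k ≤ s,
        TypeD.HasPhi 0 (u k) (s - k) ∧ TypeD.HasEps 0 (uStar k) (s - k) ∧
        TypeD.HasPhi 0 (uStar k) (s + k) ∧ TypeD.HasEps 0 (u k) (s + k)) := by
  have hex : ∀ j, ∃ T : TypeD.Tab n s, j ≤ 2 * s → TypeD.drop T = TypeD.zeroString s j := by
    intro j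
    by_cases hj : j ≤ 2 * s
    · obtain ⟨T, hT⟩ := TypeD.exists_drop_eq_zeroString (s := s) hn hj
      exact ⟨T, fun _ => hT⟩
    · obtain ⟨T, -⟩ := TypeD.exists_drop_eq_zeroString (s := s) hn (Nat.zero_le _)
      exact ⟨T, fun h => absurd h hj⟩
  choose z hz using hex
  have hu : ∀ k ≤ s, TypeD.drop (z (s + k)) = List.replicate k (1, 2) := fun k hk => by
    rw [hz _ (by omega), TypeD.zeroString_add]
  have hv : ∀ k ≤ s, TypeD.drop (z (s - k)) = List.replicate k (-2, -1) := fun k hk => by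
    rw [hz _ (by omega), TypeD.zeroString_sub hk]
  have hF : ∀ j < 2 * s, TypeD.crystalF 0 (z j) = some (z (j + 1)) := fun j hj =>
    TypeD.crystalF_zero_zeroString hn hj (hz j hj.le) (hz (j + 1) hj)
  have hE : ∀ j < 2 * s, TypeD.crystalE 0 (z (j + 1)) = some (z j) := fun j hj =>
    TypeD.crystalE_zero_zeroString hn hj (hz j hj.le) (hz (j + 1) hj)
  have hFlast : TypeD.crystalF 0 (z (2 * s)) = none :=
    TypeD.crystalF_zero_zeroString_last hn (hz _ le_rfl)
  have hphi : ∀ j ≤ 2 * s, TypeD.HasPhi 0 (z j) (2 * s - j) := fun j hj =>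
    TypeD.isGreatest_iter hF hFlast hj
  have heps : ∀ j ≤ 2 * s, TypeD.HasEps 0 (z j) j := by
    intro j hj
    -- the reversed string `j ↦ z (2s - j)` is a string for `e₀`
    have h := TypeD.isGreatest_iter (g := TypeD.crystalE 0) (z := fun j => z (2 * s - j))
      (N := 2 * s) (fun i hi => ?_) ?_ (Nat.sub_le (2 * s) j)
    · simpa [Nat.sub_sub_self hj, TypeD.HasEps] using h
    · have := hE (2 * s - (i + 1)) (by omega)
      rwa [show 2 * s - (i + 1) + 1 = 2 * s - i by omega] at this
    · simpa using TypeD.crystalE_zero_zeroString_zero hn (hz 0 (Nat.zero_le _))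
  refine ⟨fun k => z (s + k), fun k => z (s - k), fun k hk => ⟨fun b => ?_, fun b => ?_, ?_⟩,
    fun k hk => hF (s + k) (by omega), ?_, fun k h0 hk => ?_, fun k hk => ⟨?_, ?_, ?_, ?_⟩⟩
  · rw [TypeD.isHighest_iff hn, ← hu k hk]
    exact TypeD.drop_injective.eq_iff
  · rw [TypeD.isLowest_iff hn, ← hv k hk]
    exact TypeD.drop_injective.eq_iff
  · exact TypeD.dual_eq hn (hu k hk) (hv k hk)
  · rwa [two_mul] at hFlast
  · obtain ⟨k, rfl⟩ := Nat.exists_eq_succ_of_ne_zero h0.ne'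
    exact hE (s + k) (by omega)
  · exact (show 2 * s - (s + k) = s - k by omega) ▸ hphi (s + k) (by omega)
  · exact heps (s - k) (by omega)
  · exact (show 2 * s - (s - k) = s + k by omega) ▸ hphi (s - k) (by omega)
  · exact heps (s + k) (by omega)
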